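/- Let $M$ be a finite monoid and $p>0$ a prime. Let $\mathcal O$ be a complete discrete valuation ring of characteristic $0$ with maximal ideal $\mathfrak m$, field of fractions $F$ and residue field $k=\mathcal O/\mathfrak m$ of characteristic $p$, such that $F$ and $k$ are splitting fields for $FM$ and $kM$ (every simple module is absolutely simple). Notation. For an idempotent $e\in M$, let $G_e$ (a maximal subgroup of $M$) be the group of units of $eMe$, let $L_e=\{x\in M: Mx=Me\}$ and $R_e=\{x\in M: xM=eM\}$, and let $$\varphi_e\colon \mathbb ZL_e\to \operatorname{Hom}_{\mathbb ZG_e}(\mathbb ZR_e,\mathbb ZG_e),\qquad \varphi_e(\ell)(r)=\begin{cases} r\ell,& r\ell\in G_e,\\ 0,&\text{otherwise.}\end{cases}$$ The prime $p$ is *strongly modular* for $M$ if there is an idempotent $e$ such that $p$ divides $|G_e|$ or the order of the torsion subgroup of $\operatorname{coker}\varphi_e$. An *$\mathcal OM$-lattice* is an $\mathcal OM$-module that is finitely generated and free over $\mathcal O$. The *top* of a module $X$ is $X/\operatorname{rad}X$. Let $(S_i)_i$ and $(T_j)_j$ be representatives of the isomorphism classes of simple $FM$-modules and simple $kM$-modules.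 The *decomposition matrix* $D=(d_{ij})$ has as entry $d_{ij}$ the multiplicity of $T_j$ as a composition factor of $k\otimes_{\mathcal O}L$, where $L$ is any $\mathcal OM$-lattice with $F\otimes_{\mathcal O}L\cong S_i$ (it does not depend on $L$). The *Cartan matrix* $C(A)$ of a finite dimensional algebra $A$ has as $(i,j)$ entry the multiplicity of the $i$-th simple module as a composition factor of the projective indecomposable module whose top is the $j$-th simple module. 1. Suppose that $p$ does not divide the order of any maximal subgroup of $M$. Then there is a bijection $V\mapsto\overline V$ from the isomorphism classes of simple $kM$-modules to those of simple $FM$-modules such that $\dim_kV\le\dim_F\overline V$ for all $V$, and such that $D$ is upper triangular with ones on the diagonal when the simple $kM$-modules are listed in a suitable order $V_1,\dots,V_n$ and the simple $FM$-modules in the order $\overline V_1,\dots,\overline V_n$. 2. Suppose that $p$ is not strongly modular for $M$, and let $V\mapsto\overline V$ be a bijection as in (1). Then for each simple $kM$-module $V$ there is an $\mathcal OM$-lattice $\widetilde V$ such that $k\otimes_{\mathcal O}\widetilde V\cong V$ and $F\otimes_{\mathcal O}\widetilde V\cong\overline V$ is simple. Moreover, $D$ is the permutation matrix of the bijection $V\mapsto\overline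 V$, and the Cartan matrices $C(FM)$ and $C(kM)$ are conjugate by this permutation matrix. If $P$ is a projective indecomposable $\mathcal OM$-module with simple top $V$, then $F\otimes_{\mathcal O}P$ is a projective indecomposable $FM$-module with simple top $F\otimes_{\mathcal O}\widetilde V$. 3. If $p$ is strongly modular for $M$, then $D$ is not a permutation matrix. -/

import Mathlib

open scoped MonoidAlgebra TensorProduct

universe u v w

namespace MonoidRep

noncomputable section

/-! ### Modules over rings: indecomposables, tops, composition multiplicities, Cartan matrices -/

section Modules

/-- A nonzero module with no nontrivial direct sum decomposition. -/
structure IsIndecomposable (A : Type u) [Ring A] (V : Type v) [AddCommGroup V] [Module A V] :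
    Prop where
  nontrivial : Nontrivial V
  eq_bot_or_eq_bot : ∀ N N' : Submodule A V, IsCompl N N' → N = ⊥ ∨ N' = ⊥

/-- Projective indecomposable modules. -/
structure IsProjectiveIndecomposable (A : Type u) [Ring A] (V : Type v) [AddCommGroup V]
    [Module A V] : Prop where
  projective : Module.Projective A V
  indecomposable : IsIndecomposable A V

/-- The top `V / rad V` of a module; `rad V` is the intersection of the maximal submodules. -/
abbrev ModuleTop (A : Type u) [Ring A] (V : Type v) [AddCommGroup V] [Module A V] : Type v :=
  V ⧸ Module.jacobson A V

/-- The number of factors isomorphic to `S` in a composition series. -/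
def factorCount {A : Type u} [Ring A] {V : Type v} [AddCommGroup V] [Module A V]
    (s : CompositionSeries (Submodule A V)) (S : Type w) [AddCommGroup S] [Module A S] : ℕ :=
  Nat.card {i : Fin s.length //
    Nonempty ((s i.succ ⧸ (s i.castSucc).submoduleOf (s i.succ)) ≃ₗ[A] S)}

open Classical in
/-- The multiplicity of `S` as a composition factor of a module `V` of finite length, computed
in some composition series of `V` from `⊥` to `⊤` (by Jordan–Hölder, the choice does not matter);
it is set to be `0` if `V` does not have finite length. -/
def compositionMultiplicity (A : Type u) [Ring A] (V : Type v) [AddCommGroup V] [Module A V]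
    (S : Type w) [AddCommGroup S] [Module A S] : ℕ :=
  if h : ∃ s : CompositionSeries (Submodule A V), s.head = ⊥ ∧ s.last = ⊤ then
    factorCount h.choose S
  else 0

/-- A complete and irredundant system of representatives, indexed by `ι`, of the isomorphism
classes of simple `A`-modules. -/
structure SimpleSystem (A : Type u) [Ring A] (ι : Type v) where
  mod : ι → ModuleCat.{u} A
  simple : ∀ i, IsSimpleModule A (mod i)
  irredundant : ∀ i j, Nonempty (mod i ≃ₗ[A] mod j) → i = j
  complete : ∀ V : ModuleCat.{u} A, IsSimpleModule A V → ∃ i, Nonempty (V ≃ₗ[A] mod i)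

/-- A family of projective indecomposable modules `P i` with simple tops `P i / rad (P i) ≅ S i`. -/
structure ProjectiveSystem {A : Type u} [Ring A] {ι : Type v} (S : SimpleSystem A ι) where
  mod : ι → ModuleCat.{u} A
  projectiveIndecomposable : ∀ i, IsProjectiveIndecomposable A (mod i)
  top : ∀ i, Nonempty (ModuleTop A (mod i) ≃ₗ[A] S.mod i)

/-- The Cartan matrix: the entry at `(i, j)` is the multiplicity of the simple module `S i` as a
composition factor of the projective indecomposable module `P j`. -/
def cartanMatrix {A : Type u} [Ring A] {ι : Type v} (S : SimpleSystem A ι)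
    (P : ProjectiveSystem S) : Matrix ι ι ℕ :=
  Matrix.of fun i j => compositionMultiplicity A (P.mod j) (S.mod i)

open Classical in
/-- The permutation matrix of a bijection between the column indices and the row indices. -/
def permutationMatrix {ι : Type v} {κ : Type w} (σ : κ ≃ ι) : Matrix ι κ ℕ :=
  Matrix.of fun i j => if σ j = i then 1 else 0

/-- Permutation matrices, with rows and columns indexed by possibly different sets. -/
def IsPermutationMatrix {ι : Type v} {κ : Type w} (D : Matrix ι κ ℕ) : Prop :=
  ∃ σ : κ ≃ ι, D = permutationMatrix σ

/-- `D` is upper triangular with ones on the diagonal if its columns are listed as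
`g 0, …, g (n - 1)` for a suitable enumeration `g` and its rows as `σ (g 0), …, σ (g (n - 1))`. -/
def IsUpperUnitriangular {ι : Type v} {κ : Type w} (D : Matrix ι κ ℕ) (σ : κ ≃ ι) : Prop :=
  ∃ (n : ℕ) (g : Fin n ≃ κ), (∀ a, D (σ (g a)) (g a) = 1) ∧
    ∀ a b, b < a → D (σ (g a)) (g b) = 0

end Modules

/-! ### Extension of scalars, splitting fields, lattices and the decomposition matrix -/

section Scalars

/-- The representation of `M` on `B ⊗[A] L`, for an `A[M]`-module `L`. -/
def extendScalarsRep (A : Type*) [CommRing A] (B : Type*) [CommRing B] [Algebra A B]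
    (M : Type*) [Monoid M] (L : Type*) [AddCommGroup L] [Module A[M] L] :
    Representation B M (B ⊗[A] RestrictScalars A A[M] L) :=
  ((Module.End.baseChangeHom A B (RestrictScalars A A[M] L) : _ →ₐ[A] _) : _ →* _).comp
    (Representation.ofModule (k := A) (G := M) L)

/-- The `B[M]`-module `B ⊗[A] L`, for an `A[M]`-module `L`. -/
abbrev ExtendScalars (A : Type*) [CommRing A] (B : Type*) [CommRing B] [Algebra A B]
    (M : Type*) [Monoid M] (L : Type*) [AddCommGroup L] [Module A[M] L] : Type _ :=
  (extendScalarsRep A B M L).asModule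

/-- `K` is a splitting field for `K[M]`: every simple `K[M]`-module `V` is absolutely simple, that
is, `E ⊗[K] V` is a simple `E[M]`-module for every field extension `E` of `K`. -/
def IsSplittingField (K : Type u) [Field K] (M : Type u) [Monoid M] : Prop :=
  ∀ (V : Type u) [AddCommGroup V] [Module K[M] V], IsSimpleModule K[M] V →
    ∀ (E : Type u) [Field E] [Algebra K E], IsSimpleModule E[M] (ExtendScalars K E M V)

/-- `𝒪[M]`-lattices: `𝒪[M]`-modules that are finitely generated free over `𝒪`. -/
structure IsLattice (𝒪 : Type*) [CommRing 𝒪] (M : Type*) [Monoid M] (L : Type*)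
    [AddCommGroup L] [Module 𝒪[M] L] : Prop where
  finite : Module.Finite 𝒪 (RestrictScalars 𝒪 𝒪[M] L)
  free : Module.Free 𝒪 (RestrictScalars 𝒪 𝒪[M] L)

/-- `L` is an `𝒪[M]`-form of the `F[M]`-module `V`: an `𝒪[M]`-lattice with `F ⊗[𝒪] L ≅ V`. -/
structure IsForm (𝒪 : Type*) [CommRing 𝒪] (F : Type*) [Field F] [Algebra 𝒪 F]
    (M : Type*) [Monoid M] (V : Type*) [AddCommGroup V] [Module F[M] V]
    (L : Type*) [AddCommGroup L] [Module 𝒪[M] L] : Prop where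
  lattice : IsLattice 𝒪 M L
  equiv : Nonempty (ExtendScalars 𝒪 F M L ≃ₗ[F[M]] V)

theorem exists_isForm (𝒪 : Type*) [CommRing 𝒪] [IsDomain 𝒪] [IsPrincipalIdealRing 𝒪]
    (F : Type*) [Field F] [Algebra 𝒪 F] [IsFractionRing 𝒪 F] (M : Type*) [Monoid M] [Finite M]
    (V : Type w) [AddCommGroup V] [Module F[M] V] [Module.Finite F[M] V] :
    ∃ L : ModuleCat.{w} 𝒪[M], IsForm 𝒪 F M V L := by
  let _ : Module F V := Module.compHom V (algebraMap F F[M])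
  have : IsScalarTower F F[M] V := IsScalarTower.of_compHom F F[M] V
  let _ : Module 𝒪 V := Module.compHom V (algebraMap 𝒪 F)
  have : IsScalarTower 𝒪 F V := IsScalarTower.of_compHom 𝒪 F V
  have : Module.Finite F V := Module.Finite.trans F[M] V
  let b := Module.finBasis F V
  let ρ : Representation F M V := Representation.ofModule' V
  let ρ' : Representation 𝒪 M V :=
    { toFun := fun m => (ρ m).restrictScalars 𝒪
      map_one' := by ext; simp
      map_mul' := fun _ _ => by ext; simp }
  let L₀ : Submodule 𝒪 V := Submodule.span 𝒪 (Set.range fun x : M × Fin _ => ρ x.1 (b x.2))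
  have hstab : ∀ (m : M) ⦃v : V⦄, v ∈ L₀ → ρ' m v ∈ L₀ := by
    intro m v hv
    induction hv using Submodule.span_induction with
    | mem x hx =>
      obtain ⟨⟨n, i⟩, rfl⟩ := hx
      refine Submodule.subset_span ⟨(m * n, i), ?_⟩
      change ρ (m * n) (b i) = ρ m (ρ n (b i))
      rw [map_mul]
      rfl
    | zero => simp
    | add x y _ _ hx hy => simpa using L₀.add_mem hx hy
    | smul a x _ hx => simpa using L₀.smul_mem a hx
  have hL : Submodule.IsLattice F L₀ :=
    { fg := Submodule.fg_span (Set.finite_range _)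
      span_eq_top := by
        rw [eq_top_iff, ← b.span_eq]
        refine Submodule.span_mono ?_
        rintro _ ⟨i, rfl⟩
        refine Submodule.subset_span ⟨(1, i), ?_⟩
        simp }
  let σ : Representation 𝒪 M L₀ :=
    { toFun := fun m => (ρ' m).restrict (hstab m)
      map_one' := by ext; simp
      map_mul' := fun _ _ => by ext; simp }
  have hfree : Module.Free 𝒪 L₀ := Submodule.IsLattice.free F L₀
  let e₀ : RestrictScalars 𝒪 𝒪[M] σ.asModule ≃ₗ[𝒪] L₀ :=
    { (RestrictScalars.addEquiv 𝒪 𝒪[M] σ.asModule).trans σ.asModuleEquiv.toAddEquiv with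
      map_smul' := fun r x => by
        change σ.asAlgebraHom (algebraMap 𝒪 𝒪[M] r) x = r • (show L₀ from x)
        rw [AlgHom.commutes]
        rfl }
  have hfin : Module.Finite 𝒪 (RestrictScalars 𝒪 𝒪[M] σ.asModule) := Module.Finite.equiv e₀.symm
  have hfree' : Module.Free 𝒪 (RestrictScalars 𝒪 𝒪[M] σ.asModule) := Module.Free.of_equiv e₀.symm
  refine ⟨ModuleCat.of 𝒪[M] σ.asModule, ⟨hfin, hfree'⟩, ?_⟩
  let f : F ⊗[𝒪] RestrictScalars 𝒪 𝒪[M] σ.asModule →ₗ[F] V :=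
    LinearMap.liftBaseChange F (L₀.subtype ∘ₗ e₀.toLinearMap)
  have hf : Function.Bijective f := by
    let c := Module.Free.chooseBasis 𝒪 L₀
    let c₁ := Algebra.TensorProduct.basis F (c.map e₀.symm)
    let c₂ := c.extendOfIsLattice F
    have : f = (c₁.equiv c₂ (Equiv.refl _)).toLinearMap := by
      refine c₁.ext fun i => ?_
      rw [LinearEquiv.coe_coe, Module.Basis.equiv_apply]
      simp [c₁, c₂, f]
    rw [this]
    exact (c₁.equiv c₂ (Equiv.refl _)).bijective
  let h : ExtendScalars 𝒪 F M σ.asModule →ₗ[F[M]] V :=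
    MonoidAlgebra.equivariantOfLinearOfComm
      (f ∘ₗ (extendScalarsRep 𝒪 F M σ.asModule).asModuleEquiv.toLinearMap) (fun g v => by
        obtain ⟨x, rfl⟩ := (extendScalarsRep 𝒪 F M σ.asModule).asModuleEquiv.symm.surjective v
        rw [Representation.single_smul, one_smul, LinearEquiv.apply_symm_apply]
        simp only [LinearMap.comp_apply, LinearEquiv.coe_coe, LinearEquiv.apply_symm_apply]
        change f (extendScalarsRep 𝒪 F M σ.asModule g x) = ρ g (f x)
        induction x using TensorProduct.induction_on with
        | zero => simp
        | add x y hx hy => rw [map_add, map_add, map_add, map_add, hx, hy]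
        | tmul a y =>
          have h₁ : extendScalarsRep 𝒪 F M σ.asModule g (a ⊗ₜ y) =
              a ⊗ₜ Representation.ofModule (k := 𝒪) (G := M) σ.asModule g y := rfl
          rw [h₁, LinearMap.liftBaseChange_tmul, LinearMap.liftBaseChange_tmul, map_smul]
          congr 1
          change ((σ.asAlgebraHom (MonoidAlgebra.single g 1) y : L₀) : V) = _
          rw [Representation.asAlgebraHom_single, one_smul]
          rfl)
  exact ⟨LinearEquiv.ofBijective h hf⟩

/-- An `𝒪[M]`-form of a finitely generated `F[M]`-module. -/
def form (𝒪 : Type*) [CommRing 𝒪] [IsDomain 𝒪] [IsPrincipalIdealRing 𝒪]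
    (F : Type*) [Field F] [Algebra 𝒪 F] [IsFractionRing 𝒪 F] (M : Type*) [Monoid M] [Finite M]
    (V : Type w) [AddCommGroup V] [Module F[M] V] [Module.Finite F[M] V] : ModuleCat.{w} 𝒪[M] :=
  (exists_isForm 𝒪 F M V).choose

theorem SimpleSystem.finite {A : Type u} [Ring A] {ι : Type v} (S : SimpleSystem A ι) (i : ι) :
    Module.Finite A (S.mod i) :=
  have := S.simple i
  inferInstance

/-- The decomposition matrix: the entry at `(i, j)` is the multiplicity of `T j` as a composition
factor of the reduction `k ⊗[𝒪] L` of an `𝒪[M]`-form `L` of `S i` (by Brauer–Nesbitt, the choice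
of the form does not matter), where `k` is the residue field of `𝒪`. -/
def decompositionMatrix (𝒪 : Type u) [CommRing 𝒪] [IsDomain 𝒪] [IsDiscreteValuationRing 𝒪]
    (F : Type u) [Field F] [Algebra 𝒪 F] [IsFractionRing 𝒪 F] (M : Type u) [Monoid M] [Finite M]
    {ι : Type v} {κ : Type w} (S : SimpleSystem F[M] ι)
    (T : SimpleSystem (IsLocalRing.ResidueField 𝒪)[M] κ) : Matrix ι κ ℕ :=
  Matrix.of fun i j =>
    have := S.finite i
    compositionMultiplicity (IsLocalRing.ResidueField 𝒪)[M]
      (ExtendScalars 𝒪 (IsLocalRing.ResidueField 𝒪) M (form 𝒪 F M (S.mod i))) (T.mod j)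

/-- A `k[M]`-module, for the residue field `k` of `𝒪`, inflated to an `𝒪[M]`-module. -/
abbrev inflate (𝒪 : Type u) [CommRing 𝒪] [IsLocalRing 𝒪] (M : Type u) [Monoid M]
    (W : ModuleCat.{u} (IsLocalRing.ResidueField 𝒪)[M]) : ModuleCat.{u} 𝒪[M] :=
  (ModuleCat.restrictScalars (MonoidAlgebra.mapRingHom M (IsLocalRing.residue 𝒪))).obj W

/-- The dimension over the field `K` of a `K[M]`-module. -/
def dim (K : Type*) [Field K] (M : Type*) [Monoid M] (V : Type*) [AddCommGroup V]
    [Module K[M] V] : ℕ :=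
  Module.finrank K (RestrictScalars K K[M] V)

end Scalars

/-! ### Maximal subgroups, sandwich maps and strongly modular primes -/

section Monoids

variable {M : Type u} [Monoid M]

/-- The idempotents of `M`. -/
abbrev Idem (M : Type u) [Monoid M] : Type u := {e : M // IsIdempotentElem e}

/-- The monoid `eMe`, with identity `e`. -/
def Corner (e : Idem M) : Type u := Subsemigroup.corner (e : M)

instance (e : Idem M) : Monoid (Corner e) where
  __ : Semigroup (Corner e) := inferInstanceAs (Semigroup (Subsemigroup.corner (e : M)))
  one := ⟨e, e, by simp only [e.2.eq]⟩
  one_mul r := Subtype.ext ((Subsemigroup.mem_corner_iff e.2).mp r.2).1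
  mul_one r := Subtype.ext ((Subsemigroup.mem_corner_iff e.2).mp r.2).2

/-- The maximal subgroup `G_e`: the group of units of `eMe`. -/
abbrev MaxSubgroup (e : Idem M) : Type u := (Corner e)ˣ

/-- The element of `M` underlying an element of `G_e`. -/
def MaxSubgroup.toM {e : Idem M} (g : MaxSubgroup e) : M := (g : Corner e).1

/-- The `ℒ`-class of `e`: all `x` with `Mx = Me`. -/
abbrev LClass (e : Idem M) : Type u :=
  {x : M // Set.range (fun m : M => m * x) = Set.range (fun m : M => m * e)}

/-- The `ℛ`-class of `e`: all `x` with `xM = eM`. -/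
abbrev RClass (e : Idem M) : Type u :=
  {x : M // Set.range (fun m : M => x * m) = Set.range (fun m : M => (e : M) * m)}

theorem MaxSubgroup.toM_mul {e : Idem M} (g h : MaxSubgroup e) :
    (g * h).toM = g.toM * h.toM := rfl

theorem MaxSubgroup.toM_one {e : Idem M} : (1 : MaxSubgroup e).toM = e := rfl

theorem MaxSubgroup.toM_injective {e : Idem M} :
    Function.Injective (MaxSubgroup.toM : MaxSubgroup e → M) :=
  fun _ _ h => Units.ext (Subtype.ext h)

theorem MaxSubgroup.idem_mul_toM {e : Idem M} (g : MaxSubgroup e) : (e : M) * g.toM = g.toM := by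
  rw [← MaxSubgroup.toM_one, ← MaxSubgroup.toM_mul, one_mul]

theorem RClass.idem_mul {e : Idem M} (r : RClass e) : (e : M) * r.1 = r.1 := by
  have h : r.1 ∈ Set.range (fun m : M => (e : M) * m) := by
    exact (Set.ext_iff.mp r.2 r.1).mp ⟨1, mul_one r.1⟩
  obtain ⟨m, hm⟩ := h
  simp only at hm
  rw [← hm, ← mul_assoc, e.2.eq]

/-- `G_e` acts on the left of `R_e` by multiplication. -/
instance (e : Idem M) : MulAction (MaxSubgroup e) (RClass e) where
  smul g r := ⟨g.toM * r.1, by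
    have hr := r.2
    rw [Set.ext_iff] at hr ⊢
    intro x
    constructor
    · rintro ⟨m, rfl⟩
      exact ⟨g.toM * r.1 * m, by simp only [← mul_assoc, g.idem_mul_toM]⟩
    · rintro ⟨m, rfl⟩
      obtain ⟨n, hn⟩ := (hr ((e : M) * ((g⁻¹).toM * m))).2 ⟨_, rfl⟩
      refine ⟨n, ?_⟩
      simp only at hn ⊢
      rw [mul_assoc, hn, ← mul_assoc (e : M), (g⁻¹).idem_mul_toM, ← mul_assoc,
        ← MaxSubgroup.toM_mul, mul_inv_cancel, MaxSubgroup.toM_one]⟩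
  one_smul r := Subtype.ext r.idem_mul
  mul_smul g h r := Subtype.ext (mul_assoc g.toM h.toM r.1)

theorem RClass.coe_smul {e : Idem M} (g : MaxSubgroup e) (r : RClass e) :
    (g • r).1 = g.toM * r.1 := rfl

/-- The left `ℤ[G_e]`-module `ℤR_e`. -/
abbrev ZR (e : Idem M) : Type u :=
  (Representation.ofMulAction ℤ (MaxSubgroup e) (RClass e)).asModule

/-- The abelian group `ℤR_e^∨ = Hom_{ℤG_e}(ℤR_e, ℤG_e)`. -/
abbrev ZRDual (e : Idem M) : Type u := ZR e →ₗ[ℤ[MaxSubgroup e]] ℤ[MaxSubgroup e]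

open Classical in
/-- For `r` in `R_e` and `l` in `L_e`, the element `rl` of `ℤG_e` if `rl` lies in `G_e`, and `0`
otherwise. -/
def sandwichEntry {e : Idem M} (l : LClass e) (r : RClass e) : ℤ[MaxSubgroup e] :=
  if h : ∃ g : MaxSubgroup e, g.toM = r.1 * l.1 then MonoidAlgebra.single h.choose 1 else 0

theorem sandwichEntry_of_eq {e : Idem M} {l : LClass e} {r : RClass e} {g : MaxSubgroup e}
    (h : g.toM = r.1 * l.1) : sandwichEntry l r = MonoidAlgebra.single g 1 := by
  have h' : ∃ g : MaxSubgroup e, g.toM = r.1 * l.1 := ⟨g, h⟩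
  rw [sandwichEntry, dif_pos h', MaxSubgroup.toM_injective (h'.choose_spec.trans h.symm)]

theorem sandwichEntry_smul {e : Idem M} (l : LClass e) (g : MaxSubgroup e) (r : RClass e) :
    sandwichEntry l (g • r) = MonoidAlgebra.single g 1 * sandwichEntry l r := by
  by_cases h : ∃ x : MaxSubgroup e, x.toM = r.1 * l.1
  · obtain ⟨x, hx⟩ := h
    have hx' : (g * x).toM = (g • r).1 * l.1 := by
      rw [MaxSubgroup.toM_mul, hx, RClass.coe_smul, mul_assoc]
    rw [sandwichEntry_of_eq hx, sandwichEntry_of_eq hx', MonoidAlgebra.single_mul_single, one_mul]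
  · have h' : ¬ ∃ x : MaxSubgroup e, x.toM = (g • r).1 * l.1 := by
      rintro ⟨x, hx⟩
      refine h ⟨g⁻¹ * x, ?_⟩
      rw [MaxSubgroup.toM_mul, hx, RClass.coe_smul, mul_assoc, ← mul_assoc, ← MaxSubgroup.toM_mul,
        inv_mul_cancel, MaxSubgroup.toM_one, ← mul_assoc, r.idem_mul]
    rw [sandwichEntry, sandwichEntry, dif_neg h, dif_neg h', mul_zero]

/-- The `ℤG_e`-linear map `ℤR_e → ℤG_e` with `r ↦ rl` if `rl` lies in `G_e` and `r ↦ 0`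
otherwise. -/
def sandwichFunctional {e : Idem M} (l : LClass e) : ZRDual e :=
  MonoidAlgebra.equivariantOfLinearOfComm
    (Finsupp.linearCombination ℤ (sandwichEntry l) ∘ₗ
      (MonoidAlgebra.coeffLinearEquiv ℤ).toLinearMap ∘ₗ
      (Representation.asModuleEquiv _).toLinearMap) (fun g v => by
    obtain ⟨x, rfl⟩ := (Representation.asModuleEquiv _).symm.surjective v
    rw [Representation.single_smul, one_smul, LinearEquiv.apply_symm_apply]
    simp only [LinearMap.comp_apply, LinearEquiv.coe_coe, LinearEquiv.apply_symm_apply]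
    change Finsupp.linearCombination ℤ (sandwichEntry l) (MonoidAlgebra.coeffLinearEquiv ℤ
      (Representation.ofMulAction ℤ (MaxSubgroup e) (RClass e) g x)) = _
    induction x using MonoidAlgebra.induction_linear with
    | zero => simp
    | add x y hx hy => simp only [map_add, hx, hy, smul_add]
    | single r n =>
      rw [Representation.ofMulAction_single]
      simp [sandwichEntry_smul, Int.cast_comm, mul_assoc])

/-- The map `φ_e : ℤL_e → ℤR_e^∨` with `φ_e(l)(r) = rl` if `rl` lies in `G_e` and
`φ_e(l)(r) = 0` otherwise. -/
def sandwichMap (e : Idem M) : ℤ[LClass e] →+ ZRDual e :=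
  ((Finsupp.linearCombination ℤ (sandwichFunctional (e := e))).toAddMonoidHom).comp
    (MonoidAlgebra.coeffLinearEquiv ℤ).toLinearMap.toAddMonoidHom

/-- The cokernel of `φ_e`. -/
abbrev SandwichCoker (e : Idem M) : Type u := ZRDual e ⧸ (sandwichMap e).range

/-- `p` is strongly modular for `M` if, for some idempotent `e`, it divides the order of `G_e` or
the order of the torsion subgroup of the cokernel of `φ_e`. -/
def IsStronglyModular (M : Type u) [Monoid M] (p : ℕ) : Prop :=
  ∃ e : Idem M, p ∣ Nat.card (MaxSubgroup e) ∨
    p ∣ Nat.card (AddCommGroup.torsion (SandwichCoker e))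

end Monoids

end

end MonoidRep

open MonoidRep

/-! Everything is measured by the numbers dim fV, for idempotents f of a monoid algebra. The functor
V ↦ fV is exact, so dim fV is additive along composition series. If f is an idempotent of 𝒪[M] and L
is a lattice, then fL is a direct summand of L, so f(F ⊗ L) and f(k ⊗ L) have the same dimension
(`imageDim_extendScalars_eq`). As k is a splitting field and 𝒪 is complete, each T_j has an
idempotent f of 𝒪[M] whose reduction has rank one on T_j and kills the other simple modules; then
d_ij = dim f S_i (`imageDim_simple_eq_decompositionMatrix`).

Simple modules are classified in the manner of Clifford, Munn and Ponizovskii, by an apex e and a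
primitive idempotent v of K[G_e] that acts as nonzero. If p divides no |G_e|, then k[G_e] is
semisimple, and its primitive idempotents lift to 𝒪[G_e] and stay primitive over F. So the same
labels (e, v) serve for the simple modules over k and over F, which gives the bijection
(`exists_equiv_label`). If T_j' is a factor of the reduction of S_σ(j), then v_j' acts as nonzero on
S_σ(j); so the apex of j lies below that of j' in the 𝒥-order, strictly if j ≠ j'. This is the
triangular shape.

The simple module with label (e, v) is a quotient of K L_e, of dimension the rank of the v-part of
the sandwich matrix of e (`dim_eq_finrank_range`). A matrix over 𝒪 has the same rank over F and over
k exactly when its column space is pure at π (`rank_map_eq_rank_map_iff`), and purity of the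
integral sandwich matrix at p says that coker φ_e has no p-torsion (`dvd_card_torsion_iff`). So if p
is not strongly modular, S_σ(j) and T_j have equal dimensions, and dim S_i = ∑ d_ij dim T_j leaves
no room off the diagonal. Projective indecomposables over k and over F both come from modules 𝒪[M]f,
and the Cartan numbers on both sides are ranks of f'𝒪[M]f.

Conversely, let D be a permutation matrix. The simple F[M]-module S with apex e on which G_e acts
trivially on eS has a simple reduction T. Elements passing through the idempotent f of T kill all
other simple F[M]-modules, so their corners in 𝒪[G_e] are multiples of the sum of the group. One of
them fixes a nonzero vector of eT, on which that sum acts as |G_e|; hence p does not divide |G_e|.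
Now labels are available, equal dimensions give purity for every v, and the reductions of the v's
generate k[G_e], so the sandwich matrix itself is pure. -/

namespace MonoidRep

noncomputable section

/-! ### Dimensions of the images of idempotents -/

section IdempotentDimension

variable (K : Type*) [Field K] {A : Type*} [Ring A] [Algebra K A]

/-- The dimension over `K` of `f V`, for an element `f` of a `K`-algebra `A` and an
`A`-module `V`. -/
def imageDim (f : A) (V : Type*) [AddCommGroup V] [Module A V] : ℕ :=
  letI : Module K V := Module.compHom V (algebraMap K A)
  haveI : IsScalarTower K A V := IsScalarTower.of_compHom K A V
  Module.finrank K (LinearMap.range (Algebra.lsmul K K V f))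

/-- Compatibility with the action of `A` leaves only one `K`-structure on `V`, so any available
instance may be used. -/
theorem imageDim_eq (f : A) (V : Type*) [AddCommGroup V] [Module A V] [inst : Module K V]
    [IsScalarTower K A V] :
    imageDim K f V = Module.finrank K (LinearMap.range (Algebra.lsmul K K V f)) := by
  have : inst = Module.compHom V (algebraMap K A) :=
    Module.ext' _ _ fun r x => (algebraMap_smul A r x).symm
  subst this
  rfl

theorem imageDim_congr (f : A) {V W : Type*} [AddCommGroup V] [Module A V] [AddCommGroup W]
    [Module A W] (e : V ≃ₗ[A] W) : imageDim K f V = imageDim K f W := by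
  let : Module K V := Module.compHom V (algebraMap K A)
  have : IsScalarTower K A V := IsScalarTower.of_compHom K A V
  let : Module K W := Module.compHom W (algebraMap K A)
  have : IsScalarTower K A W := IsScalarTower.of_compHom K A W
  rw [imageDim_eq, imageDim_eq]
  have h : LinearMap.range (Algebra.lsmul K K W f) =
      (LinearMap.range (Algebra.lsmul K K V f)).map (e.restrictScalars K).toLinearMap := by
    ext w
    simp only [LinearMap.mem_range, Submodule.mem_map, Algebra.lsmul_coe]
    constructor
    · rintro ⟨y, rfl⟩
      exact ⟨_, ⟨e.symm y, rfl⟩, by simp⟩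
    · rintro ⟨_, ⟨y, rfl⟩, rfl⟩
      exact ⟨e y, by simp⟩
  rw [h]
  exact ((e.restrictScalars K).submoduleMap _).finrank_eq

variable {K} in
theorem mem_range_lsmul {f : A} (hf : IsIdempotentElem f) {V : Type*} [AddCommGroup V]
    [Module A V] [Module K V] [IsScalarTower K A V] {v : V} :
    v ∈ LinearMap.range (Algebra.lsmul K K V f) ↔ f • v = v := by
  constructor
  · rintro ⟨y, rfl⟩
    simp [smul_smul, hf.eq]
  · intro h
    exact ⟨v, h⟩

/-- The functor `V ↦ f V` is exact because `f` is idempotent: an element of `f V` that lies in `N`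
equals `f` times itself, hence lies in `f N`. -/
theorem imageDim_eq_add [Module.Finite K A] {f : A} (hf : IsIdempotentElem f) {V : Type*}
    [AddCommGroup V] [Module A V] [Module.Finite A V] (N : Submodule A V) :
    imageDim K f V = imageDim K f N + imageDim K f (V ⧸ N) := by
  let : Module K V := Module.compHom V (algebraMap K A)
  have : IsScalarTower K A V := IsScalarTower.of_compHom K A V
  have : Module.Finite K V := Module.Finite.trans A V
  rw [imageDim_eq, imageDim_eq, imageDim_eq]
  let q : LinearMap.range (Algebra.lsmul K K V f) →ₗ[K] (V ⧸ N) :=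
    (N.mkQ.restrictScalars K) ∘ₗ Submodule.subtype _
  have h1 : LinearMap.range q = LinearMap.range (Algebra.lsmul K K (V ⧸ N) f) := by
    ext w
    constructor
    · rintro ⟨⟨_, y, rfl⟩, rfl⟩
      exact ⟨N.mkQ y, by simp [q]⟩
    · rintro ⟨y, rfl⟩
      obtain ⟨y, rfl⟩ := N.mkQ_surjective y
      exact ⟨⟨f • y, y, rfl⟩, by simp [q]⟩
  let j : LinearMap.range (Algebra.lsmul K K N f) →ₗ[K] LinearMap.range (Algebra.lsmul K K V f) :=
    LinearMap.codRestrict _ ((N.subtype.restrictScalars K) ∘ₗ Submodule.subtype _) (by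
      rintro ⟨_, y, rfl⟩
      exact ⟨y, by simp⟩)
  have hj : Function.Injective j := by
    intro a b hab
    have := congrArg Subtype.val hab
    exact Subtype.ext (Subtype.ext this)
  have h2 : LinearMap.ker q = LinearMap.range j := by
    ext ⟨w, hw⟩
    have hfw := (mem_range_lsmul hf).1 hw
    constructor
    · intro h
      have hwN : w ∈ N := by simpa [q] using h
      refine ⟨⟨⟨w, hwN⟩, ⟨w, hwN⟩, Subtype.ext hfw⟩, rfl⟩
    · rintro ⟨⟨⟨y, hy⟩, hy'⟩, h⟩
      have : y = w := congrArg Subtype.val h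
      subst this
      simpa [q] using hy
  rw [← LinearMap.finrank_range_add_finrank_ker q, h1, h2, LinearMap.finrank_range_of_inj hj,
    add_comm]

theorem imageDim_pos_iff [Module.Finite K A] {f : A} {V : Type*}
    [AddCommGroup V] [Module A V] [Module.Finite A V] :
    0 < imageDim K f V ↔ ∃ v : V, f • v ≠ 0 := by
  let : Module K V := Module.compHom V (algebraMap K A)
  have : IsScalarTower K A V := IsScalarTower.of_compHom K A V
  have : Module.Finite K V := Module.Finite.trans A V
  rw [imageDim_eq, Module.finrank_pos_iff, Submodule.nontrivial_iff_ne_bot, ne_eq,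
    LinearMap.range_eq_bot]
  constructor
  · intro h
    by_contra! h'
    exact h (LinearMap.ext h')
  · rintro ⟨v, hv⟩ h
    exact hv (LinearMap.congr_fun h v)

theorem imageDim_eq_zero [Module.Finite K A] {f : A} {V : Type*}
    [AddCommGroup V] [Module A V] [Module.Finite A V] (h : ∀ v : V, f • v = 0) :
    imageDim K f V = 0 := by
  by_contra h'
  obtain ⟨v, hv⟩ := (imageDim_pos_iff K).1 (Nat.pos_of_ne_zero h')
  exact hv (h v)

/-- If `f V` is the line spanned by `x`, then `imageDim K f V = 1`. -/
theorem imageDim_eq_one {f : A} (hf : IsIdempotentElem f) {V : Type*}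
    [AddCommGroup V] [Module A V] {x : V} (hx : x ≠ 0) (hfx : f • x = x)
    (h : ∀ y : V, f • y = y → ∃ c : K, y = algebraMap K A c • x) :
    imageDim K f V = 1 := by
  let : Module K V := Module.compHom V (algebraMap K A)
  have : IsScalarTower K A V := IsScalarTower.of_compHom K A V
  rw [imageDim_eq]
  have hr : LinearMap.range (Algebra.lsmul K K V f) = Submodule.span K {x} := by
    ext y
    rw [mem_range_lsmul hf, Submodule.mem_span_singleton]
    constructor
    · intro hy
      obtain ⟨c, hc⟩ := h y hy
      exact ⟨c, hc.symm⟩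
    · rintro ⟨c, rfl⟩
      rw [smul_comm, hfx]
  rw [hr, finrank_span_singleton hx]

theorem exists_eq_smul_of_imageDim_eq_one {f : A} (hf : IsIdempotentElem f) {V : Type*}
    [AddCommGroup V] [Module A V] (h : imageDim K f V = 1) {x y : V} (hx : x ≠ 0)
    (hfx : f • x = x) (hfy : f • y = y) : ∃ c : K, y = algebraMap K A c • x := by
  let : Module K V := Module.compHom V (algebraMap K A)
  have : IsScalarTower K A V := IsScalarTower.of_compHom K A V
  rw [imageDim_eq] at h
  obtain ⟨c, hc⟩ := (finrank_eq_one_iff_of_nonzero' (⟨x, (mem_range_lsmul hf).2 hfx⟩ :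
    LinearMap.range (Algebra.lsmul K K V f)) (by simpa using hx)).1 h
    ⟨y, (mem_range_lsmul hf).2 hfy⟩
  exact ⟨c, (congrArg Subtype.val hc).symm⟩

theorem imageDim_compositionSeries [Module.Finite K A] {f : A} (hf : IsIdempotentElem f)
    {V : Type*} [AddCommGroup V] [Module A V] [Module.Finite A V]
    (s : CompositionSeries (Submodule A V)) (h0 : s.head = ⊥) (h1 : s.last = ⊤) :
    imageDim K f V = ∑ i : Fin s.length,
      imageDim K f (s i.succ ⧸ (s i.castSucc).submoduleOf (s i.succ)) := by
  have : IsNoetherianRing A := IsNoetherianRing.of_finite K A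
  have hstep : ∀ i : Fin s.length, imageDim K f (s i.succ) =
      imageDim K f (s i.castSucc) +
        imageDim K f (s i.succ ⧸ (s i.castSucc).submoduleOf (s i.succ)) := by
    intro i
    rw [imageDim_eq_add K hf ((s i.castSucc).submoduleOf (s i.succ)),
      imageDim_congr K f (Submodule.submoduleOfEquivOfLe (s.step i).le)]
  -- Telescoping over partial sums: the `i`-th term of the series accounts for the factors with
  -- index below `i`.
  have htel : ∀ i : Fin (s.length + 1), imageDim K f (s i) =
      ∑ j : Fin s.length with j.castSucc < i,
        imageDim K f (s j.succ ⧸ (s j.castSucc).submoduleOf (s j.succ)) := by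
    intro i
    induction i using Fin.induction with
    | zero =>
      rw [Finset.filter_false_of_mem (by simp), Finset.sum_empty]
      change imageDim K f s.head = 0
      rw [h0]
      exact imageDim_eq_zero K fun v => Subsingleton.elim _ _
    | succ i ih =>
      rw [hstep, ih]
      have : (Finset.univ.filter fun j : Fin s.length => j.castSucc < i.succ) =
          insert i (Finset.univ.filter fun j : Fin s.length => j.castSucc < i.castSucc) := by
        ext j
        simp only [Finset.mem_filter, Finset.mem_univ, true_and, Finset.mem_insert, Fin.lt_def,
          Fin.ext_iff, Fin.val_castSucc, Fin.val_succ]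
        omega
      rw [this, Finset.sum_insert (by simp), add_comm]
  have := htel (Fin.last _)
  rw [Finset.filter_true_of_mem (fun j _ => Fin.castSucc_lt_last j)] at this
  rw [← this]
  change _ = imageDim K f s.last
  rw [h1]
  exact imageDim_congr K f Submodule.topEquiv.symm

end IdempotentDimension

/-! ### Composition multiplicities from dimensions of idempotent images -/

section Multiplicity

variable (K : Type u) [Field K] {A : Type u} [Ring A] [Algebra K A] [Module.Finite K A]
variable {κ : Type w} (T : SimpleSystem A κ)

/-- For every idempotent `f`, the dimension of `f V` is determined by the composition factors
of `V`. -/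
theorem imageDim_eq_sum [Fintype κ] {f : A} (hf : IsIdempotentElem f) (V : Type u)
    [AddCommGroup V] [Module A V] [Module.Finite A V] :
    imageDim K f V = ∑ j, compositionMultiplicity A V (T.mod j) * imageDim K f (T.mod j) := by
  classical
  have : IsNoetherianRing A := IsNoetherianRing.of_finite K A
  have : IsArtinianRing A := IsArtinianRing.of_finite K A
  have hex := exists_compositionSeries_of_isNoetherian_isArtinian A V
  obtain ⟨h0, h1⟩ := hex.choose_spec
  set s := hex.choose with hs
  rw [imageDim_compositionSeries K hf s h0 h1]
  have hsimple : ∀ i : Fin s.length,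
      IsSimpleModule A (s i.succ ⧸ (s i.castSucc).submoduleOf (s i.succ)) := fun i =>
    (covBy_iff_quot_is_simple (s.step i).le).1 (s.step i)
  -- `c i` is the index of the simple module isomorphic to the `i`-th factor. Multiplicities are the
  -- sizes of the fibres of `c`, and the sum is regrouped along these fibres.
  choose c hc using fun i => T.complete (ModuleCat.of A _) (hsimple i)
  have hc' : ∀ i j, Nonempty ((s i.succ ⧸ (s i.castSucc).submoduleOf (s i.succ)) ≃ₗ[A] T.mod j) ↔
      c i = j := by
    intro i j
    constructor
    · rintro ⟨e⟩
      obtain ⟨e'⟩ := hc i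
      exact T.irredundant _ _ ⟨e'.symm.trans e⟩
    · rintro rfl
      exact hc i
  have hcount : ∀ j, compositionMultiplicity A V (T.mod j) =
      (Finset.univ.filter fun i => c i = j).card := by
    intro j
    rw [compositionMultiplicity, dif_pos hex, factorCount, ← hs]
    simp_rw [hc']
    rw [Nat.card_eq_fintype_card, Fintype.card_subtype]
  simp_rw [hcount]
  rw [← Finset.sum_fiberwise (s := Finset.univ) (g := c)]
  refine Finset.sum_congr rfl fun j _ => ?_
  rw [← smul_eq_mul]
  refine Finset.sum_eq_card_nsmul fun i hi => ?_
  obtain ⟨e⟩ := (hc' i j).2 (by simpa using hi)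
  exact imageDim_congr K f e

/-- An idempotent that singles out the simple module `T j` computes multiplicities. -/
theorem compositionMultiplicity_eq_imageDim [Fintype κ] {f : A} (hf : IsIdempotentElem f) (j : κ)
    (hj : imageDim K f (T.mod j) = 1) (hne : ∀ i, i ≠ j → imageDim K f (T.mod i) = 0) (V : Type u)
    [AddCommGroup V] [Module A V] [Module.Finite A V] :
    compositionMultiplicity A V (T.mod j) = imageDim K f V := by
  rw [imageDim_eq_sum K T hf, Finset.sum_eq_single j, hj, mul_one]
  · intro i _ hi
    rw [hne i hi, mul_zero]
  · simp

end Multiplicity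

/-! ### Extension of scalars -/

section ExtendScalars

variable (A : Type*) [CommRing A] (B : Type*) [CommRing B] [Algebra A B] (M : Type*) [Monoid M]

/-- Pure tensors in `B ⊗[A] L`. -/
def extTmul {L : Type*} [AddCommGroup L] [Module A[M] L] (b : B) (l : L) :
    ExtendScalars A B M L :=
  (extendScalarsRep A B M L).asModuleEquiv.symm
    (b ⊗ₜ[A] ((RestrictScalars.addEquiv A A[M] L).symm l))

/-- The ring homomorphism `A[M] → B[M]`. -/
abbrev algMap : A[M] →+* B[M] := MonoidAlgebra.mapRingHom M (algebraMap A B)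

variable {A B M}

variable {L : Type*} [AddCommGroup L] [Module A[M] L]

theorem algMap_single (m : M) (a : A) :
    algMap A B M (MonoidAlgebra.single m a) = MonoidAlgebra.single m (algebraMap A B a) := by
  simp

theorem extTmul_add (b : B) (l l' : L) :
    extTmul A B M b (l + l') = extTmul A B M b l + extTmul A B M b l' := by
  simp only [extTmul, map_add, TensorProduct.tmul_add]

theorem extTmul_zero (b : B) : extTmul A B M b (0 : L) = 0 := by
  simp only [extTmul, map_zero, TensorProduct.tmul_zero]

theorem algebraMap_smul_extTmul (b b' : B) (l : L) :
    algebraMap B B[M] b' • extTmul A B M b l = extTmul A B M (b' * b) l := by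
  rw [algebraMap_smul, extTmul, ← map_smul]
  rfl

theorem single_smul_extTmul (m : M) (c b : B) (l : L) :
    MonoidAlgebra.single m c • extTmul A B M b l =
      extTmul A B M (c * b) ((MonoidAlgebra.single m 1 : A[M]) • l) := by
  rw [Representation.single_smul]
  change c • (b ⊗ₜ[A] _) = _
  rw [TensorProduct.smul_tmul']
  rfl

theorem extTmul_algebraMap_smul (b : B) (a : A) (l : L) :
    extTmul A B M b (algebraMap A A[M] a • l) = extTmul A B M (algebraMap A B a * b) l := by
  have : (RestrictScalars.addEquiv A A[M] L).symm (algebraMap A A[M] a • l) =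
      a • (RestrictScalars.addEquiv A A[M] L).symm l := rfl
  rw [extTmul, extTmul, this, ← TensorProduct.smul_tmul, Algebra.smul_def]

theorem algMap_smul_extTmul (f : A[M]) (b : B) (l : L) :
    algMap A B M f • extTmul A B M b l = extTmul A B M b (f • l) := by
  induction f using MonoidAlgebra.induction_linear with
  | zero => rw [map_zero, zero_smul, zero_smul, extTmul_zero]
  | add x y hx hy => rw [map_add, add_smul, add_smul, hx, hy, extTmul_add]
  | single m a =>
    rw [algMap_single, single_smul_extTmul, ← extTmul_algebraMap_smul, smul_smul]
    congr 2
    simp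

theorem extendScalars_induction {P : ExtendScalars A B M L → Prop} (h0 : P 0)
    (hadd : ∀ x y, P x → P y → P (x + y)) (h : ∀ b l, P (extTmul A B M b l)) (x) : P x := by
  refine TensorProduct.induction_on (motive := P) x h0 ?_ hadd
  intro b l
  exact h b _

/-- The linear map `B ⊗[A] L → W` that extends a semilinear map `L → W`. -/
def extLift {W : Type*} [AddCommGroup W] [Module B[M] W] (h : L →+ W)
    (hs : ∀ (f : A[M]) l, h (f • l) = algMap A B M f • h l) :
    ExtendScalars A B M L →ₗ[B[M]] W :=
  letI : Module B W := Module.compHom W (algebraMap B B[M])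
  haveI : IsScalarTower B B[M] W := IsScalarTower.of_compHom B B[M] W
  letI : Module A W := Module.compHom W (algebraMap A B)
  haveI : IsScalarTower A B W := IsScalarTower.of_compHom A B W
  let h' : RestrictScalars A A[M] L →ₗ[A] W :=
    { h.comp (RestrictScalars.addEquiv A A[M] L).toAddMonoidHom with
      map_smul' := fun a l => by
        change h (algebraMap A A[M] a • (RestrictScalars.addEquiv A A[M] L) l) =
          algebraMap B B[M] (algebraMap A B a) • h _
        rw [hs]
        simp
        rfl }
  MonoidAlgebra.equivariantOfLinearOfComm
    (LinearMap.liftBaseChange B h' ∘ₗ (extendScalarsRep A B M L).asModuleEquiv.toLinearMap)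
    (fun g x => by
      have hb : ∀ (b : B) (l : L), (LinearMap.liftBaseChange B h' ∘ₗ
          (extendScalarsRep A B M L).asModuleEquiv.toLinearMap) (extTmul A B M b l) =
          algebraMap B B[M] b • h l := fun b l => LinearMap.liftBaseChange_tmul _ _ _ _
      induction x using extendScalars_induction with
      | h0 => simp only [smul_zero, map_zero]
      | hadd x y hx hy => rw [smul_add, map_add, map_add, smul_add, hx, hy]
      | h b l =>
        rw [single_smul_extTmul, one_mul, hb, hb, hs, algMap_single, map_one, smul_smul, smul_smul,
          Algebra.commutes])

@[simp]
theorem extLift_extTmul {W : Type*} [AddCommGroup W] [Module B[M] W] (h : L →+ W)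
    (hs : ∀ (f : A[M]) l, h (f • l) = algMap A B M f • h l) (b : B) (l : L) :
    extLift h hs (extTmul A B M b l) = algebraMap B B[M] b • h l :=
  letI : Module B W := Module.compHom W (algebraMap B B[M])
  letI : Module A W := Module.compHom W (algebraMap A B)
  haveI : IsScalarTower A B W := IsScalarTower.of_compHom A B W
  LinearMap.liftBaseChange_tmul (R := A) (A := B) _ _ _

variable (B) in
/-- Extension of scalars for linear maps. -/
def extMap {L' : Type*} [AddCommGroup L'] [Module A[M] L'] (h : L →ₗ[A[M]] L') :
    ExtendScalars A B M L →ₗ[B[M]] ExtendScalars A B M L' :=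
  extLift ⟨⟨fun l => extTmul A B M 1 (h l), by simp [extTmul_zero]⟩, by simp [extTmul_add]⟩
    (fun f l => by simp [algMap_smul_extTmul])

@[simp]
theorem extMap_extTmul {L' : Type*} [AddCommGroup L'] [Module A[M] L'] (h : L →ₗ[A[M]] L')
    (b : B) (l : L) : extMap B h (extTmul A B M b l) = extTmul A B M b (h l) := by
  rw [extMap, extLift_extTmul]
  simp only [AddMonoidHom.coe_mk, ZeroHom.coe_mk]
  rw [algebraMap_smul_extTmul, mul_one]

variable (B) in
/-- Extension of scalars for linear equivalences. -/
def extEquiv {L' : Type*} [AddCommGroup L'] [Module A[M] L'] (h : L ≃ₗ[A[M]] L') :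
    ExtendScalars A B M L ≃ₗ[B[M]] ExtendScalars A B M L' :=
  LinearEquiv.ofLinearMap (extMap B h.toLinearMap) (extMap B h.symm.toLinearMap)
    (by
      ext x
      induction x using extendScalars_induction with
      | h0 => simp only [map_zero]
      | hadd x y hx hy => rw [map_add, hx, hy, map_add]
      | h b l => simp)
    (by
      ext x
      induction x using extendScalars_induction with
      | h0 => simp only [map_zero]
      | hadd x y hx hy => rw [map_add, hx, hy, map_add]
      | h b l => simp)

end ExtendScalars

/-! ### Simple modules and idempotents -/

section Simple

variable {A : Type*} [Ring A]

theorem exists_smul_eq_of_isSimpleModule {S : Type*} [AddCommGroup S] [Module A S]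
    [IsSimpleModule A S] {x : S} (hx : x ≠ 0) (y : S) : ∃ a : A, a • x = y :=
  IsSimpleModule.toSpanSingleton_surjective A hx y

/-- Both modules are quotients of `A` by annihilators of a generator. The inclusion of annihilators
gives a nonzero map between them, which is bijective by Schur's lemma. -/
theorem exists_linearEquiv_of_annihilator_le {S S' : Type*} [AddCommGroup S] [Module A S]
    [AddCommGroup S'] [Module A S'] [IsSimpleModule A S] [IsSimpleModule A S'] {x : S} {x' : S'}
    (hx : x ≠ 0) (hx' : x' ≠ 0) (h : ∀ a : A, a • x = 0 → a • x' = 0) :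
    ∃ e : S ≃ₗ[A] S', e x = x' := by
  let φ := LinearMap.toSpanSingleton A S x
  have hφ : Function.Surjective φ := IsSimpleModule.toSpanSingleton_surjective A hx
  let e₀ := φ.quotKerEquivOfSurjective hφ
  let ψ : (A ⧸ LinearMap.ker φ) →ₗ[A] S' :=
    (LinearMap.ker φ).liftQ (LinearMap.toSpanSingleton A S' x') (fun a ha => h a ha)
  have he₀ : e₀.symm x = Submodule.Quotient.mk 1 := by
    rw [LinearEquiv.symm_apply_eq]
    simp [e₀, φ]
  have h1 : (ψ ∘ₗ e₀.symm.toLinearMap) x = x' := by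
    rw [LinearMap.comp_apply, LinearEquiv.coe_coe, he₀]
    exact (Submodule.liftQ_apply _ _ _).trans (one_smul A x')
  have hne : ψ ∘ₗ e₀.symm.toLinearMap ≠ 0 := by
    intro h0
    rw [h0] at h1
    exact hx' h1.symm
  exact ⟨LinearEquiv.ofBijective _ (LinearMap.bijective_of_ne_zero hne), h1⟩

/-- For every simple module `S` over an Artinian ring there is an idempotent `f` such that `f S'`
is nonzero only for the simple modules `S'` isomorphic to `S`, and such that the automorphisms of
`S` act transitively on the nonzero elements of `f S`. -/
theorem exists_idempotent_of_isSimpleModule [IsArtinianRing A] (S : Type*) [AddCommGroup S]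
    [Module A S] [IsSimpleModule A S] :
    ∃ (f : A) (x : S), IsIdempotentElem f ∧ x ≠ 0 ∧ f • x = x ∧
      ∀ (S' : Type u) [AddCommGroup S'] [Module A S'], IsSimpleModule A S' →
        ∀ y : S', y ≠ 0 → f • y = y → ∃ e : S ≃ₗ[A] S', e x = y := by
  have := IsSimpleModule.nontrivial A S
  obtain ⟨x, hx⟩ := exists_ne (0 : S)
  let J := Ring.jacobson A
  let π : A →+* A ⧸ J := Ideal.Quotient.mk J
  let 𝔪 : Ideal A := LinearMap.ker (LinearMap.toSpanSingleton A S x)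
  have hJ : ∀ (S' : Type _) [AddCommGroup S'] [Module A S'] [IsSimpleModule A S'], ∀ a ∈ J,
      ∀ y : S', a • y = 0 := fun S' _ _ _ a ha y =>
    Module.mem_annihilator.1 (IsSemisimpleModule.jacobson_le_annihilator A S' ha) y
  -- In the semisimple quotient `A ⧸ J` the annihilator of `x` becomes a left ideal generated by an
  -- idempotent `ε`; `f` will lift `1 - ε` through the nilpotent radical.
  obtain ⟨ε, hε, hmε⟩ := IsSemisimpleRing.ideal_eq_span_idempotent (𝔪.map π)
  have hmem : ∀ a : A, a • x = 0 → π a * (1 - ε) = 0 := by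
    intro a ha
    have : π a ∈ Ideal.span {ε} := hmε ▸ Ideal.mem_map_of_mem π ha
    obtain ⟨b, hb⟩ := Ideal.mem_span_singleton'.1 this
    rw [← hb, mul_assoc, mul_sub, mul_one, hε.eq, sub_self, mul_zero]
  have hker : ∀ z ∈ RingHom.ker π, IsNilpotent z := by
    intro z hz
    rw [Ideal.mk_ker] at hz
    obtain ⟨n, hn⟩ := IsSemiprimaryRing.isNilpotent (R := A)
    refine ⟨n, ?_⟩
    have := Ideal.pow_mem_pow hz n
    rwa [hn] at this
  obtain ⟨f, hf, hfε⟩ := exists_isIdempotentElem_eq_of_ker_isNilpotent π hker (1 - ε)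
    (Ideal.Quotient.mk_surjective _) hε.one_sub
  refine ⟨f, x, hf, hx, ?_, ?_⟩
  -- Modulo `J`, which acts as zero on `S`, the element `1 - f` agrees with an element annihilating
  -- `x`.
  · have h1 : ε ∈ 𝔪.map π := hmε ▸ Ideal.mem_span_singleton_self ε
    obtain ⟨a, ha, haε⟩ := (Ideal.mem_map_iff_of_surjective π Ideal.Quotient.mk_surjective).1 h1
    have h2 : (1 - f) - a ∈ J := by
      rw [← Ideal.Quotient.eq_zero_iff_mem]
      change π _ = 0
      rw [map_sub, map_sub, map_one, hfε, haε, sub_sub_cancel, sub_self]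
    have h3 := hJ S _ h2 x
    have h4 : a • x = 0 := ha
    rw [sub_smul, sub_smul, one_smul, h4, sub_zero, sub_eq_zero] at h3
    exact h3.symm
  · intro S' _ _ hS' y hy hfy
    refine exists_linearEquiv_of_annihilator_le hx hy fun a ha => ?_
    -- Whatever annihilates `x` has product with `f` in the radical, so it annihilates `y = f y` as
    -- well.
    have : a * f ∈ J := by
      rw [← Ideal.Quotient.eq_zero_iff_mem]
      change π _ = 0
      rw [map_mul, hfε, hmem a ha]
    rw [← hfy, smul_smul]
    exact Module.mem_annihilator.1 (IsSemisimpleModule.jacobson_le_annihilator A S' this) y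

/-- The simple module is the quotient by a maximal left ideal containing `I` and `1 - v`. Such an
ideal exists: if `1 = i + b (1 - v)` with `i ∈ I`, then multiplication by `v` on the right gives `v
= i v ∈ I`. -/
theorem exists_simple_of_idempotent {A : Type u} [Ring A] (I : Ideal A) [I.IsTwoSided] {v : A}
    (hv : IsIdempotentElem v) (hvI : v ∉ I) :
    ∃ S : ModuleCat.{u} A, IsSimpleModule A S ∧ (∀ a ∈ I, ∀ s : S, a • s = 0) ∧
      ∃ x : S, x ≠ 0 ∧ v • x = x := by
  let J : Ideal A := I ⊔ Ideal.span {1 - v}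
  have hJ : J ≠ ⊤ := by
    intro h
    have h1 : (1 : A) ∈ J := h ▸ Submodule.mem_top
    obtain ⟨i, hi, b, hb, hib⟩ := Submodule.mem_sup.1 h1
    obtain ⟨c, rfl⟩ := Ideal.mem_span_singleton'.1 hb
    apply hvI
    have : v = i * v := by
      calc v = 1 * v := (one_mul v).symm
        _ = _ := by rw [← hib, add_mul, mul_assoc, sub_mul, one_mul, hv.eq, sub_self, mul_zero,
          add_zero]
    rw [this]
    exact I.mul_mem_right _ hi
  obtain ⟨𝔪, h𝔪, hJ𝔪⟩ := Ideal.exists_le_maximal J hJ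
  refine ⟨ModuleCat.of A (A ⧸ 𝔪), isSimpleModule_iff_isCoatom.2 h𝔪.out, ?_,
    Submodule.Quotient.mk 1, ?_, ?_⟩
  · intro a ha s
    obtain ⟨b, rfl⟩ := Submodule.Quotient.mk_surjective _ s
    rw [← Submodule.Quotient.mk_smul, Submodule.Quotient.mk_eq_zero]
    exact hJ𝔪 (Submodule.mem_sup_left (I.mul_mem_right _ ha))
  · rw [ne_eq, Submodule.Quotient.mk_eq_zero]
    exact fun h => h𝔪.ne_top ((Ideal.eq_top_iff_one _).2 h)
  · rw [← Submodule.Quotient.mk_smul, Submodule.Quotient.eq, smul_eq_mul, mul_one,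
      ← neg_mem_iff, neg_sub]
    exact hJ𝔪 (Submodule.mem_sup_right (Ideal.mem_span_singleton_self _))

end Simple

/-! ### Idempotents that are primitive modulo an ideal -/

section Primitive

variable {K : Type*} [Field K] {A : Type*} [Ring A] [Algebra K A]

/-- If `v A v` is contained in `K v + I`, then there is at most one simple module `S` with
`I S = 0` and `v S ≠ 0`. -/
theorem exists_linearEquiv_of_primitive (I : Ideal A) {v : A}
    (hprim : ∀ a, ∃ c : K, v * a * v - algebraMap K A c * v ∈ I)
    {S S' : Type*} [AddCommGroup S] [Module A S] [AddCommGroup S'] [Module A S']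
    [IsSimpleModule A S] [IsSimpleModule A S'] (hS : ∀ a ∈ I, ∀ s : S, a • s = 0)
    (hS' : ∀ a ∈ I, ∀ s : S', a • s = 0) {x : S} {x' : S'} (hx : x ≠ 0) (hx' : x' ≠ 0)
    (hvx : v • x = x) (hvx' : v • x' = x') : ∃ e : S ≃ₗ[A] S', e x = x' := by
  refine exists_linearEquiv_of_annihilator_le hx hx' fun a ha => ?_
  -- If `a x = 0` but `b a x' = x'`, then `v b a v` acts on both vectors by the same scalar `c`,
  -- which is `0` on `x` and `1` on `x'`.
  by_contra hax
  obtain ⟨b, hb⟩ := exists_smul_eq_of_isSimpleModule (A := A) hax x'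
  obtain ⟨c, hc⟩ := hprim (b * a)
  have h1 : (v * (b * a) * v) • x = algebraMap K A c • x := by
    have := hS _ hc x
    rwa [sub_smul, sub_eq_zero, mul_smul (algebraMap K A c), hvx] at this
  have h2 : (v * (b * a) * v) • x' = algebraMap K A c • x' := by
    have := hS' _ hc x'
    rwa [sub_smul, sub_eq_zero, mul_smul (algebraMap K A c), hvx'] at this
  rw [mul_smul, hvx, mul_smul, mul_smul, ha, smul_zero, smul_zero] at h1
  rw [mul_smul, hvx', mul_smul, mul_smul, hb, hvx'] at h2
  have hc0 : c = 0 := by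
    by_contra hc0
    apply hx
    calc x = (algebraMap K A c⁻¹ * algebraMap K A c) • x := by
            rw [← map_mul, inv_mul_cancel₀ hc0, map_one, one_smul]
      _ = 0 := by rw [mul_smul, ← h1, smul_zero]
  rw [hc0, map_zero, zero_smul] at h2
  exact hx' h2

/-- If `y = a x`, then `y = (v a v) x`, and `v a v` acts on `x` as a scalar. -/
theorem exists_smul_eq_of_primitive (I : Ideal A) {v : A}
    (hprim : ∀ a, ∃ c : K, v * a * v - algebraMap K A c * v ∈ I)
    {S : Type*} [AddCommGroup S] [Module A S] [IsSimpleModule A S]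
    (hS : ∀ a ∈ I, ∀ s : S, a • s = 0) {x y : S} (hx : x ≠ 0)
    (hvx : v • x = x) (hvy : v • y = y) : ∃ c : K, y = algebraMap K A c • x := by
  obtain ⟨a, ha⟩ := exists_smul_eq_of_isSimpleModule (A := A) hx y
  obtain ⟨c, hc⟩ := hprim a
  refine ⟨c, ?_⟩
  have := hS _ hc x
  rw [sub_smul, sub_eq_zero, mul_smul (algebraMap K A c), hvx] at this
  rw [← this, mul_smul, hvx, mul_smul, ha, hvy]

end Primitive

/-! ### Modules with a unique maximal submodule -/

section Local

variable {A : Type u} [Ring A]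

/-- Let `Q` be generated by an element `q = f q`, and let `S` be a simple module such that `f S'`
is zero for the simple modules `S'` not isomorphic to `S`, and such that all nonzero elements of
`f S` have the same annihilator. Then all proper submodules of `Q` lie in the kernel of each
nonzero map from `Q` to `S`. -/
theorem le_ker_of_ne_top {f : A} {Q : Type u} [AddCommGroup Q] [Module A Q] {q : Q}
    (hq : ∀ y : Q, ∃ a : A, a • q = y) (hfq : f • q = q) {S : Type u} [AddCommGroup S] [Module A S]
    (hann : ∀ x y : S, x ≠ 0 → y ≠ 0 → f • x = x → f • y = y → ∀ a : A, a • x = 0 → a • y = 0)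
    (hiso : ∀ (S' : Type u) [AddCommGroup S'] [Module A S'], IsSimpleModule A S' →
      (∃ y : S', y ≠ 0 ∧ f • y = y) → Nonempty (S' ≃ₗ[A] S))
    {θ : Q →ₗ[A] S} (hθ : θ ≠ 0) {N : Submodule A Q} (hN : N ≠ ⊤) : N ≤ LinearMap.ker θ := by
  have hqt : Submodule.span A {q} = ⊤ := by
    rw [eq_top_iff]
    intro y _
    obtain ⟨a, rfl⟩ := hq y
    exact Submodule.smul_mem _ _ (Submodule.mem_span_singleton_self q)
  have hfin : Module.Finite A Q := ⟨⟨{q}, by simpa using hqt⟩⟩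
  obtain ⟨N', hN', hNN'⟩ := (eq_top_or_exists_le_coatom N).resolve_left hN
  refine hNN'.trans ?_
  have hsimple : IsSimpleModule A (Q ⧸ N') := isSimpleModule_iff_isCoatom.2 hN'
  have hq0 : N'.mkQ q ≠ 0 := by
    intro h
    apply hN'.1
    rw [eq_top_iff, ← hqt, Submodule.span_singleton_le_iff_mem]
    simpa using h
  obtain ⟨e⟩ := hiso _ hsimple ⟨N'.mkQ q, hq0, by rw [← map_smul, hfq]⟩
  have hθq : θ q ≠ 0 := by
    intro h
    apply hθ
    ext y
    obtain ⟨a, rfl⟩ := hq y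
    rw [map_smul, h, smul_zero, LinearMap.zero_apply]
  intro y hy
  obtain ⟨a, rfl⟩ := hq y
  rw [LinearMap.mem_ker, map_smul]
  refine hann (e (N'.mkQ q)) (θ q) (by simpa using hq0) hθq (by rw [← map_smul, ← map_smul, hfq])
    (by rw [← map_smul, hfq]) a ?_
  rw [← map_smul, ← map_smul, N'.mkQ_apply, (Submodule.Quotient.mk_eq_zero N').2 hy, map_zero]

variable {Q S : Type*} [AddCommGroup Q] [Module A Q] [AddCommGroup S] [Module A S]

/-- Two proper summands would both lie in the kernel of `θ`, and so would their sum, which is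
everything. -/
theorem isIndecomposable_of_le_ker [Nontrivial Q] {θ : Q →ₗ[A] S} (hθ : θ ≠ 0)
    (h : ∀ N : Submodule A Q, N ≠ ⊤ → N ≤ LinearMap.ker θ) : IsIndecomposable A Q := by
  refine ⟨inferInstance, fun N N' hc => ?_⟩
  by_contra! hne
  have h1 : N ≠ ⊤ := fun ht => hne.2 (by simpa [ht] using hc.inf_eq_bot)
  have h2 : N' ≠ ⊤ := fun ht => hne.1 (by simpa [ht] using hc.inf_eq_bot)
  have : (⊤ : Submodule A Q) ≤ LinearMap.ker θ := hc.sup_eq_top ▸ sup_le (h N h1) (h N' h2)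
  exact hθ (LinearMap.ker_eq_top.1 (top_le_iff.1 this))

theorem jacobson_eq_ker [IsSimpleModule A S] {θ : Q →ₗ[A] S} (hθ : θ ≠ 0)
    (h : ∀ N : Submodule A Q, N ≠ ⊤ → N ≤ LinearMap.ker θ) :
    Module.jacobson A Q = LinearMap.ker θ := by
  have hs : Function.Surjective θ := LinearMap.surjective_of_ne_zero hθ
  have hmax : IsCoatom (LinearMap.ker θ) := by
    rw [← isSimpleModule_iff_isCoatom]
    exact IsSimpleModule.congr (θ.quotKerEquivOfSurjective hs)
  refine le_antisymm (sInf_le hmax) (le_sInf fun N hN => ?_)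
  rcases hN.le_iff.1 (h N hN.1) with h1 | h1
  · exact absurd h1 hmax.1
  · exact h1.le

theorem nonempty_moduleTop_equiv [IsSimpleModule A S] {θ : Q →ₗ[A] S} (hθ : θ ≠ 0)
    (h : ∀ N : Submodule A Q, N ≠ ⊤ → N ≤ LinearMap.ker θ) :
    Nonempty (ModuleTop A Q ≃ₗ[A] S) :=
  ⟨(Submodule.quotEquivOfEq _ _ (jacobson_eq_ker hθ h)).trans
    (θ.quotKerEquivOfSurjective (LinearMap.surjective_of_ne_zero hθ))⟩

/-- Projective indecomposable modules are determined by their simple tops. -/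
theorem nonempty_equiv_of_isProjectiveIndecomposable [IsSimpleModule A S] [Nontrivial Q]
    [Module.Projective A Q] {θ : Q →ₗ[A] S} (hθ : θ ≠ 0)
    (h : ∀ N : Submodule A Q, N ≠ ⊤ → N ≤ LinearMap.ker θ) {P : Type*} [AddCommGroup P]
    [Module A P] (hP : IsProjectiveIndecomposable A P) (hPS : Nonempty (ModuleTop A P ≃ₗ[A] S)) :
    Nonempty (P ≃ₗ[A] Q) := by
  obtain ⟨e⟩ := hPS
  have := hP.projective
  have hs : Function.Surjective θ := LinearMap.surjective_of_ne_zero hθ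
  let ψ : P →ₗ[A] S := e.toLinearMap ∘ₗ (Module.jacobson A P).mkQ
  have hψ : Function.Surjective ψ := e.surjective.comp (Submodule.mkQ_surjective _)
  -- `α` is onto: otherwise its range is a proper submodule, contained in the kernel of `θ`, and `ψ
  -- = θ α` vanishes.
  obtain ⟨α, hα⟩ := Module.projective_lifting_property θ ψ hs
  have hαs : LinearMap.range α = ⊤ := by
    by_contra hne
    have h1 := h _ hne
    have h2 : ψ = 0 := by
      rw [← hα]
      ext p
      exact h1 ⟨p, rfl⟩
    obtain ⟨q, hq⟩ := DFunLike.ne_iff.1 hθ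
    obtain ⟨p, hp⟩ := hψ (θ q)
    rw [h2] at hp
    exact hq hp.symm
  -- `Q` is projective, so `α` splits and its kernel is a direct summand of `P`; indecomposability
  -- makes this kernel zero.
  obtain ⟨β, hβ⟩ := Module.projective_lifting_property α LinearMap.id (LinearMap.range_eq_top.1 hαs)
  have hβ' : ∀ q, α (β q) = q := fun q => LinearMap.congr_fun hβ q
  have hc : IsCompl (LinearMap.range β) (LinearMap.ker α) := by
    refine ⟨Submodule.disjoint_def.2 ?_, codisjoint_iff.2 (eq_top_iff.2 fun p _ => ?_)⟩
    · rintro _ ⟨q, rfl⟩ hq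
      rw [LinearMap.mem_ker, hβ'] at hq
      rw [hq, map_zero]
    · refine Submodule.mem_sup.2 ⟨β (α p), ⟨_, rfl⟩, p - β (α p), ?_, by abel⟩
      rw [LinearMap.mem_ker, map_sub, hβ', sub_self]
  rcases hP.indecomposable.eq_bot_or_eq_bot _ _ hc with h1 | h1
  · exfalso
    obtain ⟨q, hq⟩ := exists_ne (0 : Q)
    apply hq
    have : β q = 0 := (Submodule.eq_bot_iff _).1 h1 _ ⟨q, rfl⟩
    rw [← hβ' q, this, map_zero]
  · exact ⟨LinearEquiv.ofBijective α ⟨LinearMap.ker_eq_bot.1 h1, LinearMap.range_eq_top.1 hαs⟩⟩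

end Local

/-! ### Splitting fields and separating idempotents -/

section Splitting

theorem finite_restrictScalars (A : Type*) [CommRing A] (M : Type*) [Monoid M] [Finite M]
    (L : Type*) [AddCommGroup L] [Module A[M] L] [h : Module.Finite A[M] L] :
    Module.Finite A (RestrictScalars A A[M] L) := by
  let _ : Module A[M] (RestrictScalars A A[M] L) := RestrictScalars.moduleOrig A A[M] L
  have : IsScalarTower A A[M] (RestrictScalars A A[M] L) := IsScalarTower.of_compHom A A[M] L
  have : Module.Finite A[M] (RestrictScalars A A[M] L) := h
  exact Module.Finite.trans A[M] _

theorem finite_extendScalars (A : Type*) [CommRing A] (B : Type*) [CommRing B] [Algebra A B]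
    (M : Type*) [Monoid M] (L : Type*) [AddCommGroup L] [Module A[M] L]
    [Module.Finite A (RestrictScalars A A[M] L)] :
    Module.Finite B[M] (ExtendScalars A B M L) :=
  Module.Finite.of_restrictScalars_finite B B[M] (ExtendScalars A B M L)

/-- The `A`-module underlying an `A[M]`-module with a compatible `A`-module structure. -/
def restrictScalarsEquiv (A : Type*) [CommRing A] (M : Type*) [Monoid M] (L : Type*)
    [AddCommGroup L] [Module A[M] L] [Module A L] [IsScalarTower A A[M] L] :
    RestrictScalars A A[M] L ≃ₗ[A] L :=
  { RestrictScalars.addEquiv A A[M] L with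
    map_smul' := fun a l => algebraMap_smul A[M] a ((RestrictScalars.addEquiv A A[M] L) l) }

/-- Over the algebraic closure the extended module is still simple, so the extended endomorphism is
a scalar `c` by Schur's lemma. The point is to descend from `c` to a scalar of `K`. -/
theorem endomorphism_eq_smul {K M : Type u} [Field K] [Monoid M] [Finite M]
    (hK : IsSplittingField K M) {V : Type u} [AddCommGroup V] [Module K[M] V]
    [hV : IsSimpleModule K[M] V] (φ : V →ₗ[K[M]] V) :
    ∃ c : K, ∀ v, φ v = algebraMap K K[M] c • v := by
  let E := AlgebraicClosure K
  let _ : Module K V := Module.compHom V (algebraMap K K[M])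
  have : IsScalarTower K K[M] V := IsScalarTower.of_compHom K K[M] V
  have := hK V hV E
  have hfin : Module.Finite K (RestrictScalars K K[M] V) := finite_restrictScalars K M V
  have hfin' : Module.Finite E (ExtendScalars K E M V) := inferInstance
  obtain ⟨c, hc⟩ := (IsSimpleModule.algebraMap_end_bijective_of_isAlgClosed (A := E[M])
    (V := ExtendScalars K E M V) E).2 (extMap E φ)
  have := IsSimpleModule.nontrivial K[M] V
  obtain ⟨v, hv⟩ := exists_ne (0 : V)
  let ι := restrictScalarsEquiv K M V
  have hmem : φ v ∈ Submodule.span K {v} := by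
    by_contra hmem
    -- A linear form vanishing at `v` but not at `φ v` would, after extension to `E`, contradict `φ
    -- v = c v`.
    obtain ⟨l, hl, hl'⟩ := Submodule.exists_dual_map_eq_bot_of_notMem hmem inferInstance
    have hlv : l v = 0 := by
      have : l v ∈ (Submodule.span K {v}).map l :=
        Submodule.mem_map_of_mem (Submodule.mem_span_singleton_self _)
      rwa [hl', Submodule.mem_bot] at this
    let l' : E ⊗[K] RestrictScalars K K[M] V →ₗ[E] E :=
      LinearMap.liftBaseChange E (Algebra.linearMap K E ∘ₗ l ∘ₗ ι.toLinearMap)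
    have h1 : (1 : E) ⊗ₜ[K] ι.symm (φ v) = c • ((1 : E) ⊗ₜ[K] ι.symm v) := by
      have h2 := LinearMap.congr_fun hc (extTmul K E M 1 v)
      rw [extMap_extTmul] at h2
      exact h2.symm
    have h2 := congrArg l' h1
    simp only [l', map_smul, LinearMap.liftBaseChange_tmul, LinearMap.comp_apply,
      LinearEquiv.coe_coe, LinearEquiv.apply_symm_apply, hlv, map_zero, smul_zero, one_smul] at h2
    exact hl ((algebraMap K E).injective (h2.trans (map_zero _).symm))
  obtain ⟨a, ha⟩ := Submodule.mem_span_singleton.1 hmem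
  refine ⟨a, fun w => ?_⟩
  by_contra hw
  -- If nonzero, `φ - a` would be injective by simplicity, but it kills `v`.
  have hne : φ - algebraMap K (Module.End K[M] V) a ≠ 0 := by
    intro h
    have := LinearMap.congr_fun h w
    rw [LinearMap.sub_apply, LinearMap.zero_apply, sub_eq_zero] at this
    exact hw (this.trans (algebraMap_smul K[M] a w).symm)
  apply hv
  apply (LinearMap.bijective_of_ne_zero hne).1
  rw [map_zero, LinearMap.sub_apply, ← ha, Module.algebraMap_end_apply, sub_self]

theorem smul_eq_zero_of_not_equiv {A : Type*} [Ring A] {f : A} (hf : IsIdempotentElem f)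
    {S : Type*} [AddCommGroup S] [Module A S] {x : S}
    (h : ∀ (S' : Type u) [AddCommGroup S'] [Module A S'], IsSimpleModule A S' →
        ∀ y : S', y ≠ 0 → f • y = y → ∃ e : S ≃ₗ[A] S', e x = y)
    {S' : Type u} [AddCommGroup S'] [Module A S'] [hS' : IsSimpleModule A S']
    (hne : IsEmpty (S ≃ₗ[A] S')) (y : S') : f • y = 0 := by
  by_contra hy
  obtain ⟨e, -⟩ := h S' hS' _ hy (by rw [smul_smul, hf.eq])
  exact hne.elim e

/-- There are finitely many isomorphism classes of simple modules. -/
theorem SimpleSystem.finite_index (K : Type u) [Field K] {A : Type u} [Ring A] [Algebra K A]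
    [Module.Finite K A] {κ : Type w} (T : SimpleSystem A κ) : Finite κ := by
  have : IsArtinianRing A := IsArtinianRing.of_finite K A
  have hs := T.simple
  choose f x hf hx hfx h using fun j => exists_idempotent_of_isSimpleModule.{u} (A := A) (T.mod j)
  -- Applying a linear relation to `x j` isolates the `j`-th coefficient, since `f i` kills `T j`
  -- for `i ≠ j`. Independence in a finite-dimensional algebra bounds the index set.
  have hli : LinearIndependent K f := by
    rw [linearIndependent_iff']
    intro s c hc j hj
    by_contra hcj
    apply hx j
    have h0 : ∀ i, i ≠ j → f i • x j = 0 := fun i hi =>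
      smul_eq_zero_of_not_equiv (hf i) (h i) ⟨fun e => hi (T.irredundant _ _ ⟨e⟩)⟩ _
    have h1 := congrArg (· • x j) hc
    simp only [Finset.sum_smul, zero_smul] at h1
    rw [Finset.sum_eq_single_of_mem j hj (fun i _ hi => by
      rw [Algebra.smul_def, mul_smul, h0 i hi, smul_zero]), Algebra.smul_def, mul_smul, hfx] at h1
    rw [← one_smul A (x j), ← map_one (algebraMap K A), ← inv_mul_cancel₀ hcj, map_mul, mul_smul,
      h1, smul_zero]
  exact (Cardinal.mk_lt_aleph0_iff (α := κ)).1 hli.lt_aleph0_of_finite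

/-- The idempotent attached to `T j` kills the other simple modules, and automorphisms of `T j` are
transitive on the nonzero elements of `f T j`. Over a splitting field these automorphisms are
scalars, so `f T j` is a line. -/
theorem exists_separating_idempotents {K M : Type u} [Field K] [Monoid M] [Finite M]
    (hK : IsSplittingField K M) {κ : Type w} (T : SimpleSystem K[M] κ) (j : κ) :
    ∃ f : K[M], IsIdempotentElem f ∧ imageDim K f (T.mod j) = 1 ∧
      ∀ i, i ≠ j → imageDim K f (T.mod i) = 0 := by
  have : IsArtinianRing K[M] := IsArtinianRing.of_finite K K[M]
  have hs := T.simple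
  obtain ⟨f, x, hf, hx, hfx, h⟩ := exists_idempotent_of_isSimpleModule.{u} (A := K[M]) (T.mod j)
  refine ⟨f, hf, imageDim_eq_one K hf hx hfx fun y hy => ?_, fun i hi => ?_⟩
  · by_cases hy0 : y = 0
    · exact ⟨0, by simp [hy0]⟩
    obtain ⟨e, he⟩ := h _ (hs j) y hy0 hy
    obtain ⟨c, hc⟩ := endomorphism_eq_smul hK e.toLinearMap
    exact ⟨c, by rw [← hc x, ← he]; rfl⟩
  · have := T.finite i
    exact imageDim_eq_zero K fun y =>
      smul_eq_zero_of_not_equiv hf h ⟨fun e => hi (T.irredundant _ _ ⟨e⟩).symm⟩ y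

end Splitting

/-! ### Lifting idempotents -/

section Lifting

theorem exists_eq_smul_iff {R : Type*} [CommRing R] {N : Type*} (π : R) (n : ℕ)
    (x : R[N]) : (∃ y : R[N], x = π ^ n • y) ↔ ∀ m, x.coeff m ∈ Ideal.span {π} ^ n := by
  classical
  rw [Ideal.span_singleton_pow]
  constructor
  · rintro ⟨y, rfl⟩ m
    exact Ideal.mem_span_singleton.2 ⟨y.coeff m, by simp⟩
  · intro h
    choose y hy using fun m => Ideal.mem_span_singleton.1 (h m)
    refine ⟨∑ m ∈ x.coeff.support, MonoidAlgebra.single m (y m), ?_⟩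
    refine MonoidAlgebra.ext (Finsupp.ext fun m => ?_)
    by_cases hm : x.coeff m = 0
    · simp [MonoidAlgebra.coeff_sum, Finsupp.single_apply, hm]
    · simp [MonoidAlgebra.coeff_sum, Finsupp.single_apply, hm, ← hy]

/-- Newton iteration `b ↦ 3 b² - 2 b³`: if `d = b² - b` is the defect, the new defect is `d² (4 d -
3)`. The iterates converge coefficientwise in the complete ring `R`. -/
theorem exists_isIdempotentElem_lift_of_sub_eq_smul {R : Type*} [CommRing R] (π : R)
    [IsAdicComplete (Ideal.span {π}) R] {N : Type*} [Monoid N] [Finite N] (a₀ u₀ : R[N])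
    (h₀ : a₀ * a₀ - a₀ = π • u₀) : ∃ a : R[N], IsIdempotentElem a ∧ ∃ y, a - a₀ = π • y := by
  classical
  let I := Ideal.span {π}
  let a : ℕ → R[N] := fun n => Nat.rec a₀ (fun _ b => 3 * b ^ 2 - 2 * b ^ 3) n
  have ha : ∀ n, a (n + 1) = 3 * a n ^ 2 - 2 * a n ^ 3 := fun n => rfl
  have hu : ∀ n, ∃ u, a n * a n - a n = π ^ (n + 1) • u := by
    intro n
    induction n with
    | zero => exact ⟨u₀, by rw [zero_add, pow_one]; exact h₀⟩
    | succ n ih =>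
      obtain ⟨u, hu⟩ := ih
      have h1 : a (n + 1) * a (n + 1) - a (n + 1) =
          (a n * a n - a n) * (a n * a n - a n) * (4 * (a n * a n - a n) - 3) := by
        rw [ha]
        noncomm_ring
      rw [h1, hu]
      -- The new defect is divisible by `π ^ (2 * n + 2)`; only `n + 2` factors are needed and the
      -- remaining `π ^ n` is absorbed.
      refine ⟨π ^ n • (u * u * (4 * π ^ (n + 1) • u - 3)), ?_⟩
      rw [smul_mul_smul_comm, smul_mul_assoc, smul_smul, ← pow_add, ← pow_add, mul_smul_comm]
      congr 2
      omega
  have hstep : ∀ n, ∃ y, a (n + 1) - a n = π ^ (n + 1) • y := by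
    intro n
    obtain ⟨u, hu⟩ := hu n
    refine ⟨(1 - 2 * a n) * u, ?_⟩
    have h1 : a (n + 1) - a n = (1 - 2 * a n) * (a n * a n - a n) := by
      rw [ha]
      noncomm_ring
    rw [h1, hu, mul_smul_comm]
  have hdiff : ∀ m n, m ≤ n → ∃ y, a n - a m = π ^ (m + 1) • y := by
    intro m n hmn
    induction n, hmn using Nat.le_induction with
    | base => exact ⟨0, by simp⟩
    | succ n hmn ih =>
      obtain ⟨y, hy⟩ := ih
      obtain ⟨z, hz⟩ := hstep n
      refine ⟨y + π ^ (n - m) • z, ?_⟩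
      rw [smul_add, ← hy, smul_smul, ← pow_add, show m + 1 + (n - m) = n + 1 by omega, ← hz]
      abel
  have hlim : ∀ m : N, ∃ l : R, ∀ n, (a n).coeff m ≡ l [SMOD (I ^ n • ⊤ : Submodule R R)] := by
    intro m
    refine IsPrecomplete.prec inferInstance fun {i j} hij => ?_
    rw [SModEq.sub_mem, smul_eq_mul, Ideal.mul_top]
    obtain ⟨y, hy⟩ := hdiff i j hij
    have : (a i).coeff m - (a j).coeff m = -(a j - a i).coeff m := by simp
    rw [this, neg_mem_iff, hy, pow_succ, mul_smul]
    exact (exists_eq_smul_iff π i _).1 ⟨_, rfl⟩ m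
  choose l hl using hlim
  let b : R[N] := MonoidAlgebra.ofCoeff (Finsupp.equivFunOnFinite.symm l)
  have hb : ∀ n, ∃ y, b - a n = π ^ n • y := by
    intro n
    rw [exists_eq_smul_iff]
    intro m
    have := hl m n
    rw [SModEq.sub_mem, smul_eq_mul, Ideal.mul_top] at this
    rw [← neg_mem_iff]
    simpa [b] using this
  refine ⟨b, ?_, ?_⟩
  -- The defect of the limit is divisible by every power of `π`, hence zero because `R` is
  -- separated.
  · have hz : ∀ n, ∃ y, b * b - b = π ^ n • y := by
      intro n
      obtain ⟨y, hy⟩ := hb n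
      obtain ⟨u, hu⟩ := hu n
      refine ⟨b * y + y * a n - y + π • u, ?_⟩
      have : b * b - b = b * (b - a n) + (b - a n) * a n - (b - a n) + (a n * a n - a n) := by
        noncomm_ring
      rw [this, hy, hu, pow_succ, mul_smul, mul_smul_comm, smul_mul_assoc, smul_add, smul_sub,
        smul_add]
    rw [IsIdempotentElem, ← sub_eq_zero]
    refine MonoidAlgebra.ext (Finsupp.ext fun m => ?_)
    refine IsHausdorff.haus (I := I) inferInstance _ fun n => ?_
    rw [SModEq.zero, smul_eq_mul, Ideal.mul_top]
    exact (exists_eq_smul_iff π n _).1 (hz n) m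
  · obtain ⟨y, hy⟩ := hb 1
    obtain ⟨z, hz⟩ := hdiff 0 1 zero_le_one
    rw [pow_one] at hy
    rw [zero_add, pow_one] at hz
    refine ⟨y + z, ?_⟩
    rw [smul_add, ← hy, ← hz]
    change _ = _ + (a 1 - a₀)
    abel

variable (𝒪 : Type*) [CommRing 𝒪] [IsDomain 𝒪] [IsDiscreteValuationRing 𝒪] (N : Type*) [Monoid N]

local notation "𝕜" => IsLocalRing.ResidueField 𝒪

theorem algMap_residue_surjective : Function.Surjective (algMap 𝒪 𝕜 N) :=
  MonoidAlgebra.map_surjective _ IsLocalRing.residue_surjective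

variable {𝒪 N}

theorem exists_eq_smul_of_algMap_eq_zero {π : 𝒪} (hπ : Irreducible π) {x : 𝒪[N]}
    (hx : algMap 𝒪 𝕜 N x = 0) : ∃ y, x = π • y := by
  have := (exists_eq_smul_iff π 1 x).2 fun m => by
    rw [pow_one, ← hπ.maximalIdeal_eq, ← IsLocalRing.residue_eq_zero_iff]
    have := congrArg (fun z => z.coeff m) hx
    simpa using this
  simpa using this

theorem algMap_smul_eq_zero {π : 𝒪} (hπ : Irreducible π) (y : 𝒪[N]) :
    algMap 𝒪 𝕜 N (π • y) = 0 := by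
  have h0 : IsLocalRing.residue 𝒪 π = 0 := by
    rw [IsLocalRing.residue_eq_zero_iff, hπ.maximalIdeal_eq]
    exact Ideal.mem_span_singleton_self π
  refine MonoidAlgebra.ext (Finsupp.ext fun m => ?_)
  simp [h0]

/-- Idempotents of `k[N]` lift to `𝒪[N]`. -/
theorem exists_isIdempotentElem_lift [IsAdicComplete (IsLocalRing.maximalIdeal 𝒪) 𝒪] [Finite N]
    {f : 𝕜[N]} (hf : IsIdempotentElem f) : ∃ a : 𝒪[N], IsIdempotentElem a ∧ algMap 𝒪 𝕜 N a = f := by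
  obtain ⟨π, hπ⟩ := IsDiscreteValuationRing.exists_irreducible 𝒪
  have hc : IsAdicComplete (Ideal.span {π}) 𝒪 := hπ.maximalIdeal_eq ▸ inferInstance
  obtain ⟨a₀, rfl⟩ := algMap_residue_surjective 𝒪 N f
  obtain ⟨u₀, hu₀⟩ := exists_eq_smul_of_algMap_eq_zero hπ (x := a₀ * a₀ - a₀)
    (by rw [map_sub, map_mul, hf.eq, sub_self])
  obtain ⟨a, ha, y, hy⟩ := exists_isIdempotentElem_lift_of_sub_eq_smul π a₀ u₀ hu₀
  refine ⟨a, ha, ?_⟩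
  rw [← sub_eq_zero, ← map_sub, hy, algMap_smul_eq_zero hπ]

end Lifting

/-! ### Reduction of lattices -/

section Lattices

/-- An idempotent factors as a projection onto its range followed by the inclusion, with the
inclusion split. The range is free over the principal ideal domain, and the splitting survives base
change. -/
theorem finrank_range_baseChange_of_isIdempotentElem {R : Type*} [CommRing R] [IsDomain R]
    [IsPrincipalIdealRing R] {L : Type*} [AddCommGroup L] [Module R L] [Module.Finite R L]
    [Module.Free R L] {g : Module.End R L} (hg : IsIdempotentElem g) (B : Type*) [Field B]
    [Algebra R B] :
    Module.finrank B (LinearMap.range (g.baseChange B)) =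
      Module.finrank R (LinearMap.range g) := by
  let N := LinearMap.range g
  have hfin : Module.Finite R N := inferInstance
  have hfree : Module.Free R N := inferInstance
  let p : L →ₗ[R] N := g.rangeRestrict
  let i : N →ₗ[R] L := N.subtype
  have hpi : p ∘ₗ i = LinearMap.id := by
    ext ⟨_, y, rfl⟩
    exact LinearMap.congr_fun hg.eq y
  have hip : i ∘ₗ p = g := rfl
  have hinj : Function.Injective (i.baseChange B) := by
    have : (p.baseChange B) ∘ₗ (i.baseChange B) = LinearMap.id := by
      rw [← LinearMap.baseChange_comp, hpi, LinearMap.baseChange_id]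
    exact Function.LeftInverse.injective (LinearMap.congr_fun this)
  have hsurj : Function.Surjective (p.baseChange B) := by
    have : (p.baseChange B) ∘ₗ (i.baseChange B) = LinearMap.id := by
      rw [← LinearMap.baseChange_comp, hpi, LinearMap.baseChange_id]
    exact Function.RightInverse.surjective (LinearMap.congr_fun this)
  rw [← hip, LinearMap.baseChange_comp, LinearMap.range_comp_of_range_eq_top _
    (LinearMap.range_eq_top.2 hsurj), LinearMap.finrank_range_of_inj hinj,
    Module.finrank_baseChange, hip]

variable {𝒪 : Type*} [CommRing 𝒪] {M : Type*} [Monoid M]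

/-- The `B`-module `B ⊗[A] L` underlying the extension of scalars of an `A[M]`-module. -/
def extendScalarsEquiv (A : Type*) [CommRing A] (B : Type*) [CommRing B] [Algebra A B]
    (M : Type*) [Monoid M] (L : Type*) [AddCommGroup L] [Module A[M] L] [Module A L]
    [IsScalarTower A A[M] L] : ExtendScalars A B M L ≃ₗ[B] B ⊗[A] L :=
  (extendScalarsRep A B M L).asModuleEquiv.trans ((restrictScalarsEquiv A M L).baseChange A B _ _)

theorem extendScalarsEquiv_extTmul {A : Type*} [CommRing A] {B : Type*} [CommRing B] [Algebra A B]
    {M : Type*} [Monoid M] {L : Type*} [AddCommGroup L] [Module A[M] L] [Module A L]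
    [IsScalarTower A A[M] L] (b : B) (l : L) :
    extendScalarsEquiv A B M L (extTmul A B M b l) = b ⊗ₜ l := rfl

theorem IsLattice.finite_of_isScalarTower {L : Type*} [AddCommGroup L] [Module 𝒪[M] L]
    (hL : IsLattice 𝒪 M L) [Module 𝒪 L] [IsScalarTower 𝒪 𝒪[M] L] : Module.Finite 𝒪 L :=
  have := hL.finite
  Module.Finite.equiv (restrictScalarsEquiv 𝒪 M L)

theorem IsLattice.free_of_isScalarTower {L : Type*} [AddCommGroup L] [Module 𝒪[M] L]
    (hL : IsLattice 𝒪 M L) [Module 𝒪 L] [IsScalarTower 𝒪 𝒪[M] L] : Module.Free 𝒪 L :=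
  have := hL.free
  Module.Free.of_equiv (restrictScalarsEquiv 𝒪 M L)

variable [IsDomain 𝒪] [IsPrincipalIdealRing 𝒪]

theorem imageDim_extendScalars {L : Type*} [AddCommGroup L] [Module 𝒪[M] L] [Module 𝒪 L]
    [IsScalarTower 𝒪 𝒪[M] L] (hL : IsLattice 𝒪 M L) {f : 𝒪[M]} (hf : IsIdempotentElem f)
    (B : Type*) [Field B] [Algebra 𝒪 B] :
    imageDim B (algMap 𝒪 B M f) (ExtendScalars 𝒪 B M L) =
      Module.finrank 𝒪 (LinearMap.range (Algebra.lsmul 𝒪 𝒪 L f)) := by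
  have := hL.finite_of_isScalarTower
  have := hL.free_of_isScalarTower
  have hg : IsIdempotentElem (Algebra.lsmul 𝒪 𝒪 L f) := hf.map _
  rw [imageDim_eq, ← finrank_range_baseChange_of_isIdempotentElem hg B]
  have h : ∀ x : ExtendScalars 𝒪 B M L, extendScalarsEquiv 𝒪 B M L (algMap 𝒪 B M f • x) =
      (Algebra.lsmul 𝒪 𝒪 L f).baseChange B (extendScalarsEquiv 𝒪 B M L x) := by
    intro x
    induction x using extendScalars_induction with
    | h0 => simp only [smul_zero, map_zero]
    | hadd x y hx hy => rw [smul_add, map_add, hx, hy, map_add, map_add]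
    | h b l =>
      rw [algMap_smul_extTmul, extendScalarsEquiv_extTmul, extendScalarsEquiv_extTmul,
        LinearMap.baseChange_tmul, Algebra.lsmul_coe]
  have h' : LinearMap.range ((Algebra.lsmul 𝒪 𝒪 L f).baseChange B) =
      (LinearMap.range (Algebra.lsmul B B (ExtendScalars 𝒪 B M L) (algMap 𝒪 B M f))).map
        (extendScalarsEquiv 𝒪 B M L).toLinearMap := by
    ext x
    simp only [LinearMap.mem_range, Submodule.mem_map, Algebra.lsmul_coe]
    constructor
    · rintro ⟨y, rfl⟩
      refine ⟨_, ⟨(extendScalarsEquiv 𝒪 B M L).symm y, rfl⟩, ?_⟩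
      rw [LinearEquiv.coe_coe, h, LinearEquiv.apply_symm_apply]
    · rintro ⟨_, ⟨y, rfl⟩, rfl⟩
      exact ⟨extendScalarsEquiv 𝒪 B M L y, (h y).symm⟩
  rw [h']
  exact ((extendScalarsEquiv 𝒪 B M L).submoduleMap _).finrank_eq

/-- The bridge between characteristic `0` and characteristic `p`: both sides equal the rank of the
direct summand `f L` of the lattice. -/
theorem imageDim_extendScalars_eq {L : Type*} [AddCommGroup L] [Module 𝒪[M] L]
    (hL : IsLattice 𝒪 M L) {f : 𝒪[M]} (hf : IsIdempotentElem f) (B B' : Type*) [Field B]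
    [Algebra 𝒪 B] [Field B'] [Algebra 𝒪 B'] :
    imageDim B (algMap 𝒪 B M f) (ExtendScalars 𝒪 B M L) =
      imageDim B' (algMap 𝒪 B' M f) (ExtendScalars 𝒪 B' M L) := by
  let _ : Module 𝒪 L := Module.compHom L (algebraMap 𝒪 𝒪[M])
  have : IsScalarTower 𝒪 𝒪[M] L := IsScalarTower.of_compHom 𝒪 𝒪[M] L
  rw [imageDim_extendScalars hL hf, imageDim_extendScalars hL hf]

theorem imageDim_one (K : Type*) [Field K] (M : Type*) [Monoid M] (V : Type*) [AddCommGroup V]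
    [Module K[M] V] : imageDim K (1 : K[M]) V = dim K M V := by
  let _ : Module K V := Module.compHom V (algebraMap K K[M])
  have : IsScalarTower K K[M] V := IsScalarTower.of_compHom K K[M] V
  rw [imageDim_eq, map_one, Module.End.one_eq_id, LinearMap.range_id, finrank_top, dim]
  exact (restrictScalarsEquiv K M V).finrank_eq.symm

end Lattices

/-! ### Decomposition numbers and idempotents of `𝒪[M]` -/

section Decomposition

variable {𝒪 : Type u} [CommRing 𝒪] [IsDomain 𝒪] [IsDiscreteValuationRing 𝒪]
  {F : Type u} [Field F] [Algebra 𝒪 F] [IsFractionRing 𝒪 F] {M : Type u} [Monoid M] [Finite M]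
  {ι : Type v} {κ : Type w} (S : SimpleSystem F[M] ι)
  (T : SimpleSystem (IsLocalRing.ResidueField 𝒪)[M] κ)

local notation "𝕜" => IsLocalRing.ResidueField 𝒪

variable (𝒪) in
/-- The chosen `𝒪[M]`-form of the simple module `S i`. -/
def simpleForm (i : ι) : ModuleCat.{u} 𝒪[M] :=
  have := S.finite i
  form 𝒪 F M (S.mod i)

variable (𝒪) in
theorem simpleForm_isForm (i : ι) : IsForm 𝒪 F M (S.mod i) (simpleForm 𝒪 S i) :=
  have := S.finite i
  (exists_isForm 𝒪 F M (S.mod i)).choose_spec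

theorem decompositionMatrix_apply (i : ι) (j : κ) :
    decompositionMatrix 𝒪 F M S T i j =
      compositionMultiplicity 𝕜[M] (ExtendScalars 𝒪 𝕜 M (simpleForm 𝒪 S i)) (T.mod j) := rfl

theorem finite_extendScalars_simpleForm (i : ι) :
    Module.Finite 𝕜[M] (ExtendScalars 𝒪 𝕜 M (simpleForm 𝒪 S i)) :=
  have := (simpleForm_isForm 𝒪 S i).lattice.finite
  finite_extendScalars _ _ _ _

/-- The dimension of `f S_i` in terms of the reduction of a form of `S_i`. -/
theorem imageDim_simple_eq_reduction (i : ι) {f : 𝒪[M]} (hf : IsIdempotentElem f) :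
    imageDim F (algMap 𝒪 F M f) (S.mod i) =
      imageDim 𝕜 (algMap 𝒪 𝕜 M f) (ExtendScalars 𝒪 𝕜 M (simpleForm 𝒪 S i)) := by
  obtain ⟨e⟩ := (simpleForm_isForm 𝒪 S i).equiv
  rw [← imageDim_congr (V := ExtendScalars 𝒪 F M (simpleForm 𝒪 S i)) F _ e,
    imageDim_extendScalars_eq (simpleForm_isForm 𝒪 S i).lattice hf F 𝕜]

theorem imageDim_simple_eq_sum [Fintype κ] (i : ι) {f : 𝒪[M]} (hf : IsIdempotentElem f) :
    imageDim F (algMap 𝒪 F M f) (S.mod i) = ∑ j, decompositionMatrix 𝒪 F M S T i j *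
      imageDim 𝕜 (algMap 𝒪 𝕜 M f) (T.mod j) := by
  have := finite_extendScalars_simpleForm (𝒪 := 𝒪) S i
  rw [imageDim_simple_eq_reduction S i hf, imageDim_eq_sum 𝕜 T (hf.map _)]
  rfl

theorem dim_simple_eq_sum [Fintype κ] (i : ι) :
    dim F M (S.mod i) = ∑ j, decompositionMatrix 𝒪 F M S T i j * dim 𝕜 M (T.mod j) := by
  have := imageDim_simple_eq_sum (𝒪 := 𝒪) S T i (f := 1) IsIdempotentElem.one
  simpa only [map_one, imageDim_one] using this

end Decomposition

/-! ### Projective indecomposable modules generated by idempotents -/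

section Projective

/-- `Q` is cyclic, so it has a simple quotient; the image of `q` there is nonzero and fixed by `f`,
which identifies this quotient with `S`. -/
theorem exists_le_ker_of_ne_top {A : Type u} [Ring A] {f : A} {Q : Type u} [AddCommGroup Q]
    [Module A Q] [Nontrivial Q] {q : Q}
    (hq : ∀ y : Q, ∃ a : A, a • q = y) (hfq : f • q = q) {S : Type u} [AddCommGroup S] [Module A S]
    (hann : ∀ x y : S, x ≠ 0 → y ≠ 0 → f • x = x → f • y = y → ∀ a : A, a • x = 0 → a • y = 0)
    (hiso : ∀ (S' : Type u) [AddCommGroup S'] [Module A S'], IsSimpleModule A S' →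
      (∃ y : S', y ≠ 0 ∧ f • y = y) → Nonempty (S' ≃ₗ[A] S)) :
    ∃ θ : Q →ₗ[A] S, θ ≠ 0 ∧ ∀ N : Submodule A Q, N ≠ ⊤ → N ≤ LinearMap.ker θ := by
  have hqt : Submodule.span A {q} = ⊤ := by
    rw [eq_top_iff]
    intro y _
    obtain ⟨a, rfl⟩ := hq y
    exact Submodule.smul_mem _ _ (Submodule.mem_span_singleton_self q)
  have hfin : Module.Finite A Q := ⟨⟨{q}, by simpa using hqt⟩⟩
  obtain ⟨N', hN', -⟩ := (eq_top_or_exists_le_coatom (⊥ : Submodule A Q)).resolve_left bot_ne_top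
  have hsimple : IsSimpleModule A (Q ⧸ N') := isSimpleModule_iff_isCoatom.2 hN'
  have hq0 : N'.mkQ q ≠ 0 := by
    intro h
    apply hN'.1
    rw [eq_top_iff, ← hqt, Submodule.span_singleton_le_iff_mem]
    simpa using h
  obtain ⟨e⟩ := hiso _ hsimple ⟨N'.mkQ q, hq0, by rw [← map_smul, hfq]⟩
  have hθ : e.toLinearMap ∘ₗ N'.mkQ ≠ 0 := by
    intro h
    have := LinearMap.congr_fun h q
    rw [LinearMap.comp_apply, LinearEquiv.coe_coe, LinearMap.zero_apply,
      LinearEquiv.map_eq_zero_iff] at this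
    exact hq0 this
  exact ⟨_, hθ, fun N hN => le_ker_of_ne_top hq hfq hann hiso hθ hN⟩

/-- A cyclic module generated by an element `q = f q`, where `f` is an idempotent that singles out
the simple module `S i`, has a unique maximal submodule, with quotient `S i`. -/
theorem exists_le_ker_of_imageDim {K : Type u} [Field K] {A : Type u} [Ring A] [Algebra K A]
    [Module.Finite K A] {ι : Type v} (S : SimpleSystem A ι) {f : A} (hf : IsIdempotentElem f)
    {i : ι} (h1 : imageDim K f (S.mod i) = 1) (h0 : ∀ i', i' ≠ i → imageDim K f (S.mod i') = 0)
    {Q : Type u} [AddCommGroup Q] [Module A Q] [Nontrivial Q] {q : Q}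
    (hq : ∀ y : Q, ∃ a : A, a • q = y) (hfq : f • q = q) :
    ∃ θ : Q →ₗ[A] S.mod i, θ ≠ 0 ∧ ∀ N : Submodule A Q, N ≠ ⊤ → N ≤ LinearMap.ker θ := by
  refine exists_le_ker_of_ne_top hq hfq ?_ ?_
  · intro x y hx hy hfx hfy a ha
    obtain ⟨c, rfl⟩ := exists_eq_smul_of_imageDim_eq_one K hf h1 hx hfx hfy
    rw [smul_smul, ← Algebra.commutes, mul_smul, ha, smul_zero]
  · rintro S' _ _ hS' ⟨y, hy, hfy⟩
    obtain ⟨i', ⟨e⟩⟩ := S.complete (ModuleCat.of A S') hS'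
    have hi : i' = i := by
      by_contra hne
      have := S.finite i'
      have hpos : 0 < imageDim K f (S.mod i') := by
        rw [imageDim_pos_iff]
        refine ⟨e y, ?_⟩
        rw [← map_smul]
        intro h
        rw [LinearEquiv.map_eq_zero_iff] at h
        exact hy (hfy.symm.trans h)
      rw [h0 i' hne] at hpos
      exact lt_irrefl _ hpos
    subst hi
    exact ⟨e⟩

variable {A : Type*} [CommRing A] (B : Type*) [CommRing B] [Algebra A B] {M : Type*} [Monoid M]

/-- The generator of the left ideal `A[M] f`. -/
def idealGenerator (f : A[M]) : Ideal.span {f} := ⟨f, Ideal.mem_span_singleton_self f⟩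

theorem smul_idealGenerator {f : A[M]} (hf : IsIdempotentElem f) (x : Ideal.span {f}) :
    (x : A[M]) • idealGenerator f = x := by
  obtain ⟨x, hx⟩ := x
  obtain ⟨a, rfl⟩ := Ideal.mem_span_singleton'.1 hx
  refine Subtype.ext ?_
  change a * f * f = a * f
  rw [mul_assoc, hf.eq]

theorem projective_span_idempotent {f : A[M]} (hf : IsIdempotentElem f) :
    Module.Projective A[M] (Ideal.span {f}) :=
  Module.Projective.of_split (Submodule.subtype _)
    (LinearMap.toSpanSingleton A[M] _ (idealGenerator f))
    (LinearMap.ext fun x => smul_idealGenerator hf x)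

/-- The inclusion of `B ⊗ A[M] f` into `B[M]`. -/
def extIdealInclusion (f : A[M]) : ExtendScalars A B M (Ideal.span {f}) →ₗ[B[M]] B[M] :=
  extLift ((algMap A B M).toAddMonoidHom.comp (Submodule.subtype (Ideal.span {f})).toAddMonoidHom)
    (fun a x => map_mul (algMap A B M) a x)

theorem extIdealInclusion_extTmul (f : A[M]) (b : B) (l : Ideal.span {f}) :
    extIdealInclusion B f (extTmul A B M b l) = algebraMap B B[M] b • algMap A B M l :=
  extLift_extTmul _ _ _ _

/-- Multiplying the generator gives a retraction of the inclusion into `B[M]`. So the extended left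
ideal is at once cyclic and a direct summand of `B[M]`. -/
theorem extIdealInclusion_smul {f : A[M]} (hf : IsIdempotentElem f)
    (y : ExtendScalars A B M (Ideal.span {f})) :
    extIdealInclusion B f y • extTmul A B M 1 (idealGenerator f) = y := by
  induction y using extendScalars_induction with
  | h0 => simp only [map_zero, zero_smul]
  | hadd x y hx hy => rw [map_add, add_smul, hx, hy]
  | h b l =>
    rw [extIdealInclusion_extTmul, smul_assoc, algMap_smul_extTmul, smul_idealGenerator hf, algebraMap_smul_extTmul, mul_one]

theorem projective_extendScalars_span_idempotent {f : A[M]} (hf : IsIdempotentElem f) :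
    Module.Projective B[M] (ExtendScalars A B M (Ideal.span {f})) :=
  Module.Projective.of_split (extIdealInclusion B f)
    (LinearMap.toSpanSingleton B[M] _ (extTmul A B M 1 (idealGenerator f)))
    (LinearMap.ext fun y => extIdealInclusion_smul B hf y)

theorem algMap_smul_extTmul_idealGenerator {f : A[M]} (hf : IsIdempotentElem f) :
    algMap A B M f • extTmul A B M 1 (idealGenerator f) =
      extTmul A B M (1 : B) (idealGenerator f) := by
  rw [algMap_smul_extTmul]
  congr 1
  exact smul_idealGenerator hf (idealGenerator f)

theorem nontrivial_extendScalars_span {f : A[M]} (hf : algMap A B M f ≠ 0) :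
    Nontrivial (ExtendScalars A B M (Ideal.span {f})) := by
  refine ⟨⟨extTmul A B M 1 (idealGenerator f), 0, fun h => hf ?_⟩⟩
  have := congrArg (extIdealInclusion B f) h
  rwa [extIdealInclusion_extTmul, map_one, one_smul, map_zero] at this

theorem isLattice_span {𝒪 : Type*} [CommRing 𝒪] [IsDomain 𝒪] [IsPrincipalIdealRing 𝒪] [Finite M]
    (f : 𝒪[M]) : IsLattice 𝒪 M (Ideal.span {f}) := by
  let N : Submodule 𝒪 𝒪[M] := (Ideal.span {f}).restrictScalars 𝒪
  let e : N ≃ₗ[𝒪] RestrictScalars 𝒪 𝒪[M] (Ideal.span {f}) :=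
    (restrictScalarsEquiv 𝒪 M (Ideal.span {f})).symm
  exact ⟨Module.Finite.equiv e, Module.Free.of_equiv e⟩

end Projective

/-! ### Simple modules over `𝒪[M]` -/

section SimpleLattice

variable {𝒪 : Type u} [CommRing 𝒪] [IsDomain 𝒪] [IsDiscreteValuationRing 𝒪]
  {M : Type u} [Monoid M]

local notation "𝕜" => IsLocalRing.ResidueField 𝒪

theorem isSimpleModule_inflate (W : ModuleCat.{u} 𝕜[M]) [IsSimpleModule 𝕜[M] W] :
    IsSimpleModule 𝒪[M] (inflate 𝒪 M W) := by
  have : RingHomSurjective (algMap 𝒪 𝕜 M) := ⟨algMap_residue_surjective 𝒪 M⟩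
  let l : inflate 𝒪 M W →ₛₗ[algMap 𝒪 𝕜 M] W :=
    { toFun := fun x => x
      map_add' := fun _ _ => rfl
      map_smul' := fun _ _ => rfl }
  exact (l.isSimpleModule_iff_of_bijective Function.bijective_id).2 inferInstance

/-- A uniformizer acts on a simple module as zero or surjectively, and surjectivity is excluded by
Nakayama's lemma; so the action factors through `k[M]`. -/
theorem exists_inflate_of_isSimpleModule [Finite M] (S : Type u) [AddCommGroup S] [Module 𝒪[M] S]
    [hS : IsSimpleModule 𝒪[M] S] : ∃ W : ModuleCat.{u} 𝕜[M], IsSimpleModule 𝕜[M] W ∧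
      Nonempty (S ≃ₗ[𝒪[M]] inflate 𝒪 M W) := by
  obtain ⟨π, hπ⟩ := IsDiscreteValuationRing.exists_irreducible 𝒪
  let _ : Module 𝒪 S := Module.compHom S (algebraMap 𝒪 𝒪[M])
  have : IsScalarTower 𝒪 𝒪[M] S := IsScalarTower.of_compHom 𝒪 𝒪[M] S
  have : Module.Finite 𝒪 S := Module.Finite.trans 𝒪[M] S
  have := IsSimpleModule.nontrivial 𝒪[M] S
  have hπS : ∀ s : S, π • s = 0 := by
    let φ : S →ₗ[𝒪[M]] S := algebraMap 𝒪 (Module.End 𝒪[M] S) π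
    have hφ : φ = 0 := by
      by_contra hne
      have hsurj := LinearMap.surjective_of_ne_zero hne
      have hle : (⊤ : Submodule 𝒪 S) ≤ Ideal.span {π} • ⊤ := by
        intro s _
        obtain ⟨t, rfl⟩ := hsurj s
        exact Submodule.smul_mem_smul (Ideal.mem_span_singleton_self π) Submodule.mem_top
      have hbot := Submodule.eq_bot_of_le_smul_of_le_jacobson_bot _ _ Module.Finite.fg_top hle
        (by rw [← hπ.maximalIdeal_eq]; exact IsLocalRing.maximalIdeal_le_jacobson _)
      exact bot_ne_top hbot.symm
    intro s
    exact LinearMap.congr_fun hφ s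
  let ψ : 𝒪[M] →+* AddMonoid.End S := Module.toAddMonoidEnd 𝒪[M] S
  have hker : RingHom.ker (algMap 𝒪 𝕜 M) ≤ RingHom.ker ψ := by
    intro x hx
    obtain ⟨y, rfl⟩ := exists_eq_smul_of_algMap_eq_zero hπ hx
    ext s
    change (π • y) • s = 0
    rw [smul_assoc, hπS]
  let ψ' : 𝕜[M] →+* AddMonoid.End S :=
    (algMap 𝒪 𝕜 M).liftOfSurjective (algMap_residue_surjective 𝒪 M) ⟨ψ, hker⟩
  have hψ' : ∀ a, ψ' (algMap 𝒪 𝕜 M a) = ψ a := fun a =>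
    RingHom.liftOfRightInverse_comp_apply _ _ _ ⟨ψ, hker⟩ a
  let _ : Module 𝕜[M] S := Module.compHom S ψ'
  have hsmul : ∀ (a : 𝒪[M]) (s : S), algMap 𝒪 𝕜 M a • s = a • s := fun a s =>
    DFunLike.congr_fun (hψ' a) s
  have : RingHomSurjective (algMap 𝒪 𝕜 M) := ⟨algMap_residue_surjective 𝒪 M⟩
  let l : S →ₛₗ[algMap 𝒪 𝕜 M] S :=
    { toFun := fun x => x
      map_add' := fun _ _ => rfl
      map_smul' := fun a s => (hsmul a s).symm }
  refine ⟨ModuleCat.of 𝕜[M] S, (l.isSimpleModule_iff_of_bijective Function.bijective_id).1 hS,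
    ⟨{ toFun := fun x => x, map_add' := fun _ _ => rfl, map_smul' := fun a s => (hsmul a s).symm,
       invFun := fun x => x, left_inv := fun _ => rfl, right_inv := fun _ => rfl }⟩⟩

end SimpleLattice

/-! ### Consequences of the decomposition matrix being a permutation matrix -/

section Permutation

theorem injective_of_imageDim_eq {K : Type*} [Field K] {A : Type*} [Ring A] [Algebra K A]
    [Module.Finite K A] {V W : Type*} [AddCommGroup V] [Module A V] [AddCommGroup W] [Module A W]
    [Module.Finite A V] {φ : V →ₗ[A] W} (hφ : Function.Surjective φ)
    (h : imageDim K (1 : A) V = imageDim K (1 : A) W) : Function.Injective φ := by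
  have : IsNoetherianRing A := IsNoetherianRing.of_finite K A
  have h1 := imageDim_eq_add K IsIdempotentElem.one (LinearMap.ker φ)
  rw [imageDim_congr K 1 (φ.quotKerEquivOfSurjective hφ), h] at h1
  rw [← LinearMap.ker_eq_bot]
  by_contra hne
  obtain ⟨x, hx, hx0⟩ := Submodule.exists_mem_ne_zero_of_ne_bot hne
  have : 0 < imageDim K (1 : A) (LinearMap.ker φ) :=
    (imageDim_pos_iff K).2 ⟨⟨x, hx⟩, by simpa using hx0⟩
  omega

theorem exists_le_ker_extendScalars_span {A : Type u} [CommRing A]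
    {M : Type u} [Monoid M] [Finite M] {K : Type u} [Field K] [Algebra A K] {ι : Type v}
    (S : SimpleSystem K[M] ι) {i : ι} {f : A[M]} (hf : IsIdempotentElem f)
    (h1 : imageDim K (algMap A K M f) (S.mod i) = 1)
    (h0 : ∀ i', i' ≠ i → imageDim K (algMap A K M f) (S.mod i') = 0) :
    Nontrivial (ExtendScalars A K M (Ideal.span {f})) ∧
    ∃ θ : ExtendScalars A K M (Ideal.span {f}) →ₗ[K[M]] S.mod i,
      θ ≠ 0 ∧ ∀ N : Submodule K[M] (ExtendScalars A K M (Ideal.span {f})),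
        N ≠ ⊤ → N ≤ LinearMap.ker θ := by
  have hne : algMap A K M f ≠ 0 := by
    intro h
    have := S.finite i
    rw [h, imageDim_eq_zero K (fun v => zero_smul _ v)] at h1
    exact zero_ne_one h1
  have := nontrivial_extendScalars_span K hne
  exact ⟨this, exists_le_ker_of_imageDim S (hf.map _) h1 h0
    (fun y => ⟨_, extIdealInclusion_smul K hf y⟩) (algMap_smul_extTmul_idealGenerator K hf)⟩

/-- A module whose only composition factor is `T j`, with multiplicity one, is isomorphic to
`T j`. -/
theorem nonempty_equiv_of_compositionMultiplicity (K : Type u) [Field K] {A : Type u} [Ring A]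
    [Algebra K A] [Module.Finite K A] {κ : Type w} [Fintype κ] (T : SimpleSystem A κ) {V : Type u}
    [AddCommGroup V] [Module A V] [Module.Finite A V] (j : κ)
    (h1 : compositionMultiplicity A V (T.mod j) = 1)
    (h0 : ∀ i, i ≠ j → compositionMultiplicity A V (T.mod i) = 0) :
    Nonempty (V ≃ₗ[A] T.mod j) := by
  have : IsArtinianRing A := IsArtinianRing.of_finite K A
  -- No idempotent distinguishes `V` from `T j` by dimension. With `f = 1` this makes a surjection
  -- onto `T j` injective; with the idempotent of another simple module it shows that the simple
  -- quotient of `V` can only be `T j`.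
  have hdim : ∀ f : A, IsIdempotentElem f → imageDim K f V = imageDim K f (T.mod j) := by
    intro f hf
    rw [imageDim_eq_sum K T hf V, Finset.sum_eq_single j, h1, one_mul]
    · intro i _ hi
      rw [h0 i hi, zero_mul]
    · simp
  have hT := T.simple j
  have hTfin := T.finite j
  have hpos : 0 < imageDim K (1 : A) V := by
    rw [hdim 1 IsIdempotentElem.one, imageDim_pos_iff]
    have := IsSimpleModule.nontrivial A (T.mod j)
    obtain ⟨x, hx⟩ := exists_ne (0 : T.mod j)
    exact ⟨x, by simpa using hx⟩
  have hnt : Nontrivial V := by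
    obtain ⟨v, hv⟩ := (imageDim_pos_iff K).1 hpos
    exact ⟨⟨v, 0, by simpa using hv⟩⟩
  obtain ⟨N, hN, -⟩ := (eq_top_or_exists_le_coatom (⊥ : Submodule A V)).resolve_left bot_ne_top
  have hsimple : IsSimpleModule A (V ⧸ N) := isSimpleModule_iff_isCoatom.2 hN
  obtain ⟨j', ⟨e⟩⟩ := T.complete (ModuleCat.of A (V ⧸ N)) hsimple
  let φ : V →ₗ[A] T.mod j' := e.toLinearMap ∘ₗ N.mkQ
  have hφ : Function.Surjective φ := e.surjective.comp N.mkQ_surjective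
  have hjj : j' = j := by
    by_contra hne
    have hs' := T.simple j'
    obtain ⟨f, x, hf, hx, hfx, h⟩ := exists_idempotent_of_isSimpleModule.{u} (A := A) (T.mod j')
    have h2 : imageDim K f (T.mod j) = 0 := imageDim_eq_zero K fun y =>
      smul_eq_zero_of_not_equiv hf h ⟨fun e => hne (T.irredundant _ _ ⟨e⟩)⟩ y
    obtain ⟨v, hv⟩ := hφ x
    have h4 : 0 < imageDim K f V := by
      rw [imageDim_pos_iff]
      refine ⟨v, fun h0 => hx ?_⟩
      rw [← hfx, ← hv, ← map_smul, h0, map_zero]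
    rw [hdim f hf] at h4
    omega
  subst hjj
  exact ⟨LinearEquiv.ofBijective φ
    ⟨injective_of_imageDim_eq hφ (hdim 1 IsIdempotentElem.one), hφ⟩⟩

variable {𝒪 : Type u} [CommRing 𝒪] [IsDomain 𝒪] [IsDiscreteValuationRing 𝒪]
  {F : Type u} [Field F] [Algebra 𝒪 F] [IsFractionRing 𝒪 F] {M : Type u} [Monoid M] [Finite M]
  {ι : Type v} {κ : Type w} {S : SimpleSystem F[M] ι}
  {T : SimpleSystem (IsLocalRing.ResidueField 𝒪)[M] κ}

local notation "𝕜" => IsLocalRing.ResidueField 𝒪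

theorem exists_separating_idempotent_lift [IsAdicComplete (IsLocalRing.maximalIdeal 𝒪) 𝒪]
    (hk : IsSplittingField 𝕜 M) (T : SimpleSystem 𝕜[M] κ) (j : κ) :
    ∃ f : 𝒪[M], IsIdempotentElem f ∧ imageDim 𝕜 (algMap 𝒪 𝕜 M f) (T.mod j) = 1 ∧
      ∀ i, i ≠ j → imageDim 𝕜 (algMap 𝒪 𝕜 M f) (T.mod i) = 0 := by
  obtain ⟨f, hf, h1, h0⟩ := exists_separating_idempotents hk T j
  obtain ⟨a, ha, rfl⟩ := exists_isIdempotentElem_lift hf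
  exact ⟨a, ha, h1, h0⟩

/-- Brauer reciprocity: `f S i` computes the homomorphisms from the projective module `F[M] f` to `S
i`, and its dimension is a decomposition number. -/
theorem imageDim_simple_eq_decompositionMatrix (S : SimpleSystem F[M] ι) (T : SimpleSystem 𝕜[M] κ)
    {j : κ} {f : 𝒪[M]} (hf : IsIdempotentElem f)
    (h1 : imageDim 𝕜 (algMap 𝒪 𝕜 M f) (T.mod j) = 1)
    (h0 : ∀ i, i ≠ j → imageDim 𝕜 (algMap 𝒪 𝕜 M f) (T.mod i) = 0) (i : ι) :
    imageDim F (algMap 𝒪 F M f) (S.mod i) = decompositionMatrix 𝒪 F M S T i j := by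
  have := SimpleSystem.finite_index 𝕜 T
  have := Fintype.ofFinite κ
  have := finite_extendScalars_simpleForm (𝒪 := 𝒪) S i
  rw [imageDim_simple_eq_reduction S i hf, decompositionMatrix_apply,
    compositionMultiplicity_eq_imageDim 𝕜 T (hf.map _) j h1 h0]

theorem dim_eq_of_permutationMatrix {σ : κ ≃ ι}
    (hD : decompositionMatrix 𝒪 F M S T = permutationMatrix σ) (j : κ) :
    dim F M (S.mod (σ j)) = dim 𝕜 M (T.mod j) := by
  classical
  have := SimpleSystem.finite_index 𝕜 T
  have := Fintype.ofFinite κ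
  rw [dim_simple_eq_sum (𝒪 := 𝒪) S T, hD, Finset.sum_eq_single j]
  · simp [permutationMatrix]
  · intro i _ hi
    simp [permutationMatrix, hi]
  · simp

/-- If the decomposition matrix is a permutation matrix, then the reduction of the simple module
`S (σ j)` is `T j`. -/
theorem reduction_equiv_of_permutationMatrix {σ : κ ≃ ι}
    (hD : decompositionMatrix 𝒪 F M S T = permutationMatrix σ) (j : κ) :
    Nonempty (ExtendScalars 𝒪 𝕜 M (simpleForm 𝒪 S (σ j)) ≃ₗ[𝕜[M]] T.mod j) := by
  classical
  have := SimpleSystem.finite_index 𝕜 T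
  have := Fintype.ofFinite κ
  have hfin := finite_extendScalars_simpleForm (𝒪 := 𝒪) S (σ j)
  refine nonempty_equiv_of_compositionMultiplicity 𝕜 T
    (V := ExtendScalars 𝒪 𝕜 M (simpleForm 𝒪 S (σ j))) j ?_ ?_
  · rw [← decompositionMatrix_apply, hD]
    simp [permutationMatrix]
  · intro i hi
    rw [← decompositionMatrix_apply, hD]
    simpa [permutationMatrix] using hi

/-- The dimensions of the `f S i` form the `j`-th column of the decomposition matrix, so an
idempotent separating `T j` also separates `S (σ j)`. -/
theorem imageDim_simple_of_permutationMatrix {σ : κ ≃ ι}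
    (hD : decompositionMatrix 𝒪 F M S T = permutationMatrix σ) {j : κ} {f : 𝒪[M]}
    (hf : IsIdempotentElem f) (h1 : imageDim 𝕜 (algMap 𝒪 𝕜 M f) (T.mod j) = 1)
    (h0 : ∀ i, i ≠ j → imageDim 𝕜 (algMap 𝒪 𝕜 M f) (T.mod i) = 0) :
    imageDim F (algMap 𝒪 F M f) (S.mod (σ j)) = 1 ∧
      ∀ i, i ≠ σ j → imageDim F (algMap 𝒪 F M f) (S.mod i) = 0 := by
  have h := imageDim_simple_eq_decompositionMatrix S T hf h1 h0
  constructor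
  · rw [h, hD]
    simp [permutationMatrix]
  · intro i hi
    rw [h, hD]
    simp [permutationMatrix, hi.symm]

/-- Projective indecomposable `𝒪[M]`-modules are determined by their simple tops. -/
theorem nonempty_equiv_span_idempotent (T : SimpleSystem 𝕜[M] κ) {j : κ} {f : 𝒪[M]}
    (hf : IsIdempotentElem f) (h1 : imageDim 𝕜 (algMap 𝒪 𝕜 M f) (T.mod j) = 1)
    (h0 : ∀ i, i ≠ j → imageDim 𝕜 (algMap 𝒪 𝕜 M f) (T.mod i) = 0) (hf0 : f ≠ 0)
    {P : Type u} [AddCommGroup P] [Module 𝒪[M] P] (hP : IsProjectiveIndecomposable 𝒪[M] P)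
    (htop : Nonempty (ModuleTop 𝒪[M] P ≃ₗ[𝒪[M]] inflate 𝒪 M (T.mod j))) :
    Nonempty (P ≃ₗ[𝒪[M]] Ideal.span {f}) := by
  have := T.simple j
  have hnt : Nontrivial (Ideal.span {f}) :=
    ⟨⟨idealGenerator f, 0, fun h => hf0 (congrArg Subtype.val h)⟩⟩
  have hproj := projective_span_idempotent hf
  have hsimple := isSimpleModule_inflate (T.mod j)
  obtain ⟨θ, hθ, hmax⟩ := exists_le_ker_of_ne_top (A := 𝒪[M]) (f := f) (q := idealGenerator f)
    (S := inflate 𝒪 M (T.mod j)) (fun y => ⟨y, smul_idealGenerator hf y⟩)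
    (smul_idealGenerator hf (idealGenerator f))
    (by
      intro x y hx hy hfx hfy a ha
      obtain ⟨c, hc⟩ := exists_eq_smul_of_imageDim_eq_one 𝕜 (hf.map (algMap 𝒪 𝕜 M)) h1
        (x := (show T.mod j from x)) (y := (show T.mod j from y)) hx hfx hfy
      have ha' : algMap 𝒪 𝕜 M a • (show T.mod j from x) = 0 := ha
      change algMap 𝒪 𝕜 M a • (show T.mod j from y) = 0
      rw [hc, smul_smul, ← Algebra.commutes, mul_smul, ha', smul_zero])
    (by
      rintro S' _ _ hS' ⟨y, hy, hfy⟩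
      -- Simple `𝒪[M]`-modules are inflated from `k[M]`, where `f` is known to detect `T j` only.
      obtain ⟨W, hW, ⟨e⟩⟩ := exists_inflate_of_isSimpleModule (𝒪 := 𝒪) (M := M) S'
      obtain ⟨i, ⟨e'⟩⟩ := T.complete W hW
      have hij : ∀ z : W, z ≠ 0 → algMap 𝒪 𝕜 M f • z = z → i = j := by
        intro z hz hfz
        by_contra hne
        have := T.finite i
        have hpos : 0 < imageDim 𝕜 (algMap 𝒪 𝕜 M f) (T.mod i) := by
          rw [imageDim_pos_iff]
          refine ⟨e' z, fun h => hz ?_⟩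
          rwa [← map_smul, hfz, LinearEquiv.map_eq_zero_iff] at h
        rw [h0 i hne] at hpos
        exact lt_irrefl _ hpos
      obtain rfl := hij (e y) (fun h => hy (e.map_eq_zero_iff.1 h))
        ((e.map_smul f y).symm.trans (congrArg e hfy))
      exact ⟨e.trans { e' with map_smul' := fun a x => e'.map_smul (algMap 𝒪 𝕜 M a) x }⟩)
  exact nonempty_equiv_of_isProjectiveIndecomposable hθ hmax hP htop

variable [IsAdicComplete (IsLocalRing.maximalIdeal 𝒪) 𝒪]

/-- `P` is isomorphic to `𝒪[M] f`, where `f` separates `T j`. Over `F` the same `f` separates `S (σ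
j)`, so `F ⊗ P` has a unique maximal submodule, with quotient `S (σ j)`. -/
theorem extendScalars_projectiveIndecomposable_of_permutationMatrix
    (hk : IsSplittingField 𝕜 M) {σ : κ ≃ ι}
    (hD : decompositionMatrix 𝒪 F M S T = permutationMatrix σ) {j : κ}
    {P : Type u} [AddCommGroup P] [Module 𝒪[M] P] (hP : IsProjectiveIndecomposable 𝒪[M] P)
    (htop : Nonempty (ModuleTop 𝒪[M] P ≃ₗ[𝒪[M]] inflate 𝒪 M (T.mod j))) :
    IsProjectiveIndecomposable F[M] (ExtendScalars 𝒪 F M P) ∧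
      Nonempty (ModuleTop F[M] (ExtendScalars 𝒪 F M P) ≃ₗ[F[M]] S.mod (σ j)) := by
  obtain ⟨f, hf, h1, h0⟩ := exists_separating_idempotent_lift hk T j
  have hf0 : f ≠ 0 := by
    rintro rfl
    have := T.finite j
    rw [map_zero, imageDim_eq_zero 𝕜 (fun v => zero_smul _ v)] at h1
    exact zero_ne_one h1
  obtain ⟨e⟩ := nonempty_equiv_span_idempotent T hf h1 h0 hf0 hP htop
  obtain ⟨h1', h0'⟩ := imageDim_simple_of_permutationMatrix hD hf h1 h0
  obtain ⟨hnt, θ, hθ, hmax⟩ := exists_le_ker_extendScalars_span S hf h1' h0'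
  have hsimple := S.simple (σ j)
  let E := extEquiv F e
  have hproj := projective_extendScalars_span_idempotent F hf
  have hnt' : Nontrivial (ExtendScalars 𝒪 F M P) := E.symm.injective.nontrivial
  have hθ' : θ ∘ₗ E.toLinearMap ≠ 0 := by
    intro h
    apply hθ
    ext x
    simpa using LinearMap.congr_fun h (E.symm x)
  have hmax' : ∀ N : Submodule F[M] (ExtendScalars 𝒪 F M P), N ≠ ⊤ →
      N ≤ LinearMap.ker (θ ∘ₗ E.toLinearMap) := by
    intro N hN x hx
    have hN' : N.map E.toLinearMap ≠ ⊤ := by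
      intro h
      apply hN
      rw [eq_top_iff]
      intro y _
      have : E y ∈ N.map E.toLinearMap := h ▸ Submodule.mem_top
      obtain ⟨z, hz, hzy⟩ := this
      rwa [← E.injective hzy]
    exact hmax _ hN' (Submodule.mem_map_of_mem hx)
  exact ⟨⟨Module.Projective.of_equiv E.symm, isIndecomposable_of_le_ker hθ' hmax'⟩,
    nonempty_moduleTop_equiv hθ' hmax'⟩

/-- With `f` and `f'` separating `T j` and `T j'`, the projective indecomposables in question are
the extensions of the lattice `𝒪[M] f`. Both Cartan numbers are the rank of `f'` on this lattice. -/
theorem cartanMatrix_eq_of_permutationMatrix (hk : IsSplittingField 𝕜 M) {σ : κ ≃ ι}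
    (hD : decompositionMatrix 𝒪 F M S T = permutationMatrix σ) (P : ProjectiveSystem S)
    (Q : ProjectiveSystem T) : cartanMatrix T Q = (cartanMatrix S P).submatrix σ σ := by
  have := SimpleSystem.finite_index 𝕜 T
  have := Fintype.ofFinite κ
  have := Fintype.ofEquiv κ σ
  ext j' j
  obtain ⟨f, hf, h1, h0⟩ := exists_separating_idempotent_lift hk T j
  obtain ⟨f', hf', h1', h0'⟩ := exists_separating_idempotent_lift hk T j'
  obtain ⟨g1, g0⟩ := imageDim_simple_of_permutationMatrix hD hf h1 h0
  obtain ⟨g1', g0'⟩ := imageDim_simple_of_permutationMatrix hD hf' h1' h0'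
  have hT := T.simple j
  have hS := S.simple (σ j)
  have hlat := isLattice_span f
  have := hlat.finite
  have hproj := projective_extendScalars_span_idempotent 𝕜 hf
  have hproj' := projective_extendScalars_span_idempotent F hf
  obtain ⟨e⟩ : Nonempty (Q.mod j ≃ₗ[𝕜[M]] ExtendScalars 𝒪 𝕜 M (Ideal.span {f})) := by
    obtain ⟨hnt, θ, hθ, hmax⟩ := exists_le_ker_extendScalars_span T hf h1 h0
    exact nonempty_equiv_of_isProjectiveIndecomposable
      (Q := ExtendScalars 𝒪 𝕜 M (Ideal.span {f})) hθ hmax (Q.projectiveIndecomposable j)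
      (Q.top j)
  obtain ⟨e'⟩ : Nonempty (P.mod (σ j) ≃ₗ[F[M]] ExtendScalars 𝒪 F M (Ideal.span {f})) := by
    obtain ⟨hnt, θ, hθ, hmax⟩ := exists_le_ker_extendScalars_span S hf g1 g0
    exact nonempty_equiv_of_isProjectiveIndecomposable
      (Q := ExtendScalars 𝒪 F M (Ideal.span {f})) hθ hmax (P.projectiveIndecomposable (σ j))
      (P.top (σ j))
  have hfin := finite_extendScalars 𝒪 𝕜 M (Ideal.span {f})
  have hfin' := finite_extendScalars 𝒪 F M (Ideal.span {f})
  have : Module.Finite 𝕜[M] (Q.mod j) := Module.Finite.equiv e.symm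
  have : Module.Finite F[M] (P.mod (σ j)) := Module.Finite.equiv e'.symm
  rw [Matrix.submatrix_apply, cartanMatrix, cartanMatrix, Matrix.of_apply, Matrix.of_apply,
    compositionMultiplicity_eq_imageDim 𝕜 T (hf'.map (algMap 𝒪 𝕜 M)) j' h1' h0',
    compositionMultiplicity_eq_imageDim F S (hf'.map (algMap 𝒪 F M)) (σ j') g1' g0',
    imageDim_congr (W := ExtendScalars 𝒪 𝕜 M (Ideal.span {f})) 𝕜 _ e,
    imageDim_congr (W := ExtendScalars 𝒪 F M (Ideal.span {f})) F _ e',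
    imageDim_extendScalars_eq hlat hf' 𝕜 F]

end Permutation

/-! ### Finite monoids: the `𝒥`-order and maximal subgroups -/

section FiniteMonoid

variable {M : Type u} [Monoid M]

/-- `x` lies in the two-sided ideal `MyM`. -/
def JLe (x y : M) : Prop := ∃ a b : M, x = a * y * b

theorem JLe.refl (x : M) : JLe x x := ⟨1, 1, by simp⟩

theorem JLe.trans {x y z : M} (h : JLe x y) (h' : JLe y z) : JLe x z := by
  obtain ⟨a, b, rfl⟩ := h
  obtain ⟨c, d, rfl⟩ := h'
  exact ⟨a * c, d * b, by simp only [mul_assoc]⟩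

theorem JLe.of_mul_right {x y z : M} (h : JLe x (y * z)) : JLe x y := by
  obtain ⟨a, b, rfl⟩ := h
  exact ⟨a, z * b, by simp only [mul_assoc]⟩

theorem JLe.of_mul_left {x y z : M} (h : JLe x (y * z)) : JLe x z := by
  obtain ⟨a, b, rfl⟩ := h
  exact ⟨a * y, b, by simp only [mul_assoc]⟩

theorem exists_isIdempotentElem_pow [Finite M] (x : M) : ∃ n, IsIdempotentElem (x ^ (n + 1)) := by
  obtain ⟨a, b, hab, h⟩ : ∃ a b : ℕ, a < b ∧ x ^ a = x ^ b := by
    obtain ⟨a, b, hne, h⟩ := Finite.exists_ne_map_eq_of_infinite (fun n : ℕ => x ^ n)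
    rcases lt_or_gt_of_ne hne with h' | h'
    exacts [⟨a, b, h', h⟩, ⟨b, a, h', h.symm⟩]
  obtain ⟨d, rfl⟩ := Nat.exists_eq_add_of_lt hab
  have h1 : ∀ n, a ≤ n → x ^ (n + (d + 1)) = x ^ n := by
    intro n hn
    obtain ⟨c, rfl⟩ := Nat.exists_eq_add_of_le hn
    rw [show a + c + (d + 1) = (a + d + 1) + c by ring, pow_add, ← h, ← pow_add]
  have h2 : ∀ k n, a ≤ n → x ^ (n + k * (d + 1)) = x ^ n := by
    intro k
    induction k with
    | zero => intro n _; simp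
    | succ k ih =>
      intro n hn
      rw [add_mul, one_mul, ← add_assoc, h1 _ (by omega), ih n hn]
  -- The exponent `(a + 1) * (d + 1)` is a multiple of the period `d + 1` and at least the preperiod
  -- `a`; the statement counts from `n + 1`, hence the `- 1`.
  refine ⟨(a + 1) * (d + 1) - 1, ?_⟩
  have h3 : (a + 1) * (d + 1) - 1 + 1 = (a + 1) * (d + 1) := by
    have : 0 < (a + 1) * (d + 1) := by positivity
    omega
  rw [h3, IsIdempotentElem, ← pow_add, h2]
  nlinarith

instance [Finite M] (e : Idem M) : Finite (Corner e) :=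
  inferInstanceAs (Finite (Subsemigroup.corner (e : M)))

variable {e : Idem M}

/-- The element `exe` of `eMe`. -/
def toCorner (e : Idem M) (x : M) : Corner e := ⟨e * x * e, x, rfl⟩

theorem toCorner_mul (x y : M) : toCorner e x * toCorner e y = toCorner e (x * e * y) := by
  refine Subtype.ext ?_
  change (e : M) * x * e * (e * y * e) = e * (x * e * y) * e
  simp only [mul_assoc]
  rw [← mul_assoc (e : M) (e : M), e.2.eq]

theorem MaxSubgroup.toM_mul_idem (g : MaxSubgroup e) : g.toM * (e : M) = g.toM := by
  rw [← MaxSubgroup.toM_one, ← MaxSubgroup.toM_mul, mul_one]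

theorem MaxSubgroup.jLe_toM (g : MaxSubgroup e) : JLe (e : M) g.toM :=
  ⟨(g⁻¹).toM, 1, by rw [mul_one, ← MaxSubgroup.toM_mul, inv_mul_cancel, MaxSubgroup.toM_one]⟩

/-- Cutting `e = a x b` down to `eMe` gives a one-sided inverse of `x`, and one-sided inverses in a
finite monoid are two-sided. The next two results use the same principle. -/
theorem exists_toM_eq [Finite M] {x : M} (hx : (e : M) * x * e = x) (h : JLe (e : M) x) :
    ∃ g : MaxSubgroup e, g.toM = x := by
  obtain ⟨a, b, hab⟩ := h
  have h1 : toCorner e a * (toCorner e x * toCorner e b) = 1 := by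
    rw [toCorner_mul, toCorner_mul]
    refine Subtype.ext ?_
    change (e : M) * (a * e * (x * e * b)) * e = e
    calc (e : M) * (a * e * (x * e * b)) * e = e * (a * (e * x * e) * b) * e := by
          simp only [mul_assoc]
      _ = e := by rw [hx, ← hab, e.2.eq, e.2.eq]
  have h2 := mul_eq_one_symm h1
  rw [mul_assoc] at h2
  refine ⟨⟨toCorner e x, toCorner e b * toCorner e a, h2, mul_eq_one_symm h2⟩, hx⟩

theorem exists_mul_eq_of_jLe [Finite M] {y : M} (hy : y * e = y) (h : JLe (e : M) y) :
    ∃ c, c * y = (e : M) := by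
  obtain ⟨a, b, hab⟩ := h
  have h1 : toCorner e (a * y) * toCorner e b = 1 := by
    rw [toCorner_mul]
    refine Subtype.ext ?_
    change (e : M) * (a * y * e * b) * e = e
    rw [mul_assoc a, hy, ← hab, e.2.eq, e.2.eq]
  have h2 := mul_eq_one_symm h1
  have h3 : (e : M) * b * e * (e * (a * y) * e) = e := congrArg Subtype.val h2
  refine ⟨e * b * e * (e * a), ?_⟩
  rw [← mul_assoc (e : M) a y, mul_assoc _ y, hy] at h3
  rw [mul_assoc, h3]

theorem exists_eq_mul_of_jLe [Finite M] {y : M} (hy : e * y = y) (h : JLe (e : M) y) :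
    ∃ c, y * c = (e : M) := by
  obtain ⟨a, b, hab⟩ := h
  have h1 : toCorner e a * toCorner e (y * b) = 1 := by
    rw [toCorner_mul]
    refine Subtype.ext ?_
    change (e : M) * (a * e * (y * b)) * e = e
    rw [mul_assoc a, ← mul_assoc (e : M) y, hy, ← mul_assoc a, ← hab, e.2.eq, e.2.eq]
  have h2 := mul_eq_one_symm h1
  have h3 : (e : M) * (y * b) * e * (e * a * e) = e := congrArg Subtype.val h2
  refine ⟨b * e * (e * a * e), ?_⟩
  rw [← mul_assoc (e : M) y, hy] at h3
  rw [← mul_assoc, ← mul_assoc y, h3]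

theorem LClass.mul_idem (l : LClass e) : l.1 * (e : M) = l.1 := by
  have h : l.1 ∈ Set.range (fun m : M => m * (e : M)) := by
    exact (Set.ext_iff.mp l.2 l.1).mp ⟨1, one_mul l.1⟩
  obtain ⟨m, hm⟩ := h
  simp only at hm
  rw [← hm, mul_assoc, e.2.eq]

theorem LClass.jLe (l : LClass e) : JLe (e : M) l.1 := by
  obtain ⟨m, hm⟩ := (Set.ext_iff.mp l.2 e).2 ⟨1, one_mul _⟩
  exact ⟨m, 1, by rw [mul_one]; exact hm.symm⟩

/-- Elements `y = ye` with `e ∈ MyM` lie in the `ℒ`-class of `e`. -/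
theorem exists_lClass_eq [Finite M] {y : M} (hy : y * e = y) (h : JLe (e : M) y) :
    ∃ l : LClass e, l.1 = y := by
  obtain ⟨c, hc⟩ := exists_mul_eq_of_jLe hy h
  refine ⟨⟨y, ?_⟩, rfl⟩
  ext x
  constructor
  · rintro ⟨m, rfl⟩
    exact ⟨m * y, by simp only [mul_assoc, hy]⟩
  · rintro ⟨m, rfl⟩
    exact ⟨m * c, by simp only [mul_assoc, hc]⟩

/-- Elements `y = ey` with `e ∈ MyM` lie in the `ℛ`-class of `e`. -/
theorem exists_rClass_eq [Finite M] {y : M} (hy : e * y = y) (h : JLe (e : M) y) :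
    ∃ r : RClass e, r.1 = y := by
  obtain ⟨c, hc⟩ := exists_eq_mul_of_jLe hy h
  refine ⟨⟨y, ?_⟩, rfl⟩
  ext x
  constructor
  · rintro ⟨m, rfl⟩
    exact ⟨y * m, by simp only [← mul_assoc, hy]⟩
  · rintro ⟨m, rfl⟩
    exact ⟨c * m, by simp only [← mul_assoc, hc]⟩

/-- The size of the ideal `MxM`. -/
def jCard (x : M) : ℕ := Set.ncard {y : M | JLe y x}

theorem jCard_le [Finite M] {x y : M} (h : JLe x y) : jCard x ≤ jCard y :=
  Set.ncard_le_ncard (fun _ hz => JLe.trans hz h) (Set.toFinite _)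

/-- Nested finite ideals of comparable size coincide; this lets the size of `MxM` stand for the
position of `x` in the `𝒥`-order. -/
theorem jLe_of_jCard_le [Finite M] {x y : M} (h : JLe x y) (h' : jCard y ≤ jCard x) : JLe y x := by
  have : {z : M | JLe z x} = {z : M | JLe z y} :=
    Set.eq_of_subset_of_ncard_le (fun _ hz => JLe.trans hz h) h' (Set.toFinite _)
  have hy : y ∈ {z : M | JLe z y} := JLe.refl y
  rwa [← this] at hy

end FiniteMonoid

/-! ### Monoid algebras and the algebras of maximal subgroups -/

section Corner

variable {M : Type u} [Monoid M] (K : Type*) [CommRing K] (e : Idem M)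

/-- The inclusion of the maximal subgroup `G_e` into `M`. -/
def MaxSubgroup.toMHom : MaxSubgroup e →ₙ* M where
  toFun := MaxSubgroup.toM
  map_mul' := MaxSubgroup.toM_mul

/-- The inclusion of `K[G_e]` into `K[M]`, which maps `1` to `e`. -/
def toAlg : K[MaxSubgroup e] →ₙ+* K[M] :=
  MonoidAlgebra.mapDomainNonUnitalRingHom K (MaxSubgroup.toMHom e)

/-- The ideal of `K[M]` spanned by the elements `m` with `e ∉ MmM`. -/
def belowIdeal : Ideal K[M] where
  carrier := Submodule.span K {x : K[M] | ∃ m, ¬ JLe (e : M) m ∧ x = MonoidAlgebra.single m 1}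
  add_mem' := Submodule.add_mem _
  zero_mem' := Submodule.zero_mem _
  smul_mem' := by
    intro c x hx
    induction hx using Submodule.span_induction with
    | mem x hx =>
      obtain ⟨m, hm, rfl⟩ := hx
      induction c using MonoidAlgebra.induction_linear with
      | zero => rw [zero_smul]; exact Submodule.zero_mem _
      | add a b ha hb => rw [add_smul]; exact Submodule.add_mem _ ha hb
      | single n c =>
        rw [smul_eq_mul, MonoidAlgebra.single_mul_single, mul_one,
          ← mul_one c, ← smul_eq_mul c, ← MonoidAlgebra.smul_single]
        exact Submodule.smul_mem _ _ (Submodule.subset_span ⟨_, fun h => hm h.of_mul_left, rfl⟩)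
    | zero => rw [smul_zero]; exact Submodule.zero_mem _
    | add x y _ _ hx hy => rw [smul_add]; exact Submodule.add_mem _ hx hy
    | smul a x _ hx => rw [smul_comm]; exact Submodule.smul_mem _ _ hx

variable {K e}

theorem mem_belowIdeal_iff {x : K[M]} : x ∈ belowIdeal K e ↔
    x ∈ Submodule.span K {x : K[M] | ∃ m, ¬ JLe (e : M) m ∧ x = MonoidAlgebra.single m 1} := Iff.rfl

theorem single_mem_belowIdeal {m : M} (hm : ¬ JLe (e : M) m) (c : K) :
    MonoidAlgebra.single m c ∈ belowIdeal K e := by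
  rw [mem_belowIdeal_iff, ← mul_one c, ← smul_eq_mul c, ← MonoidAlgebra.smul_single]
  exact Submodule.smul_mem _ _ (Submodule.subset_span ⟨_, hm, rfl⟩)

instance : (belowIdeal K e).IsTwoSided where
  mul_mem_of_left := by
    intro x c hx
    rw [mem_belowIdeal_iff] at hx
    induction hx using Submodule.span_induction with
    | mem x hx =>
      obtain ⟨m, hm, rfl⟩ := hx
      induction c using MonoidAlgebra.induction_linear with
      | zero => rw [mul_zero]; exact Submodule.zero_mem _
      | add a b ha hb => rw [mul_add]; exact Submodule.add_mem _ ha hb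
      | single n c =>
        rw [MonoidAlgebra.single_mul_single]
        exact single_mem_belowIdeal (fun h => hm h.of_mul_right) _
    | zero => rw [zero_mul]; exact Submodule.zero_mem _
    | add x y _ _ hx hy => rw [add_mul]; exact Submodule.add_mem _ hx hy
    | smul a x _ hx =>
      rw [smul_mul_assoc, Algebra.smul_def]
      exact Ideal.mul_mem_left _ _ hx

theorem belowIdeal_smul_eq_zero {V : Type*} [AddCommGroup V] [Module K[M] V]
    (h : ∀ m : M, ¬ JLe (e : M) m → ∀ v : V, (MonoidAlgebra.single m (1 : K)) • v = 0)
    (a : K[M]) (ha : a ∈ belowIdeal K e) (v : V) : a • v = 0 := by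
  rw [mem_belowIdeal_iff] at ha
  induction ha using Submodule.span_induction with
  | mem x hx =>
    obtain ⟨m, hm, rfl⟩ := hx
    exact h m hm v
  | zero => rw [zero_smul]
  | add x y _ _ hx hy => rw [add_smul, hx, hy, add_zero]
  | smul c x _ hx => rw [Algebra.smul_def, mul_smul, hx, smul_zero]

@[simp]
theorem toAlg_single (g : MaxSubgroup e) (c : K) :
    toAlg K e (MonoidAlgebra.single g c) = MonoidAlgebra.single g.toM c := by
  simp [toAlg, MaxSubgroup.toMHom]

theorem toAlg_one : toAlg K e 1 = MonoidAlgebra.single (e : M) 1 := by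
  rw [MonoidAlgebra.one_def, toAlg_single, MaxSubgroup.toM_one]

theorem toAlg_smul (c : K) (z : K[MaxSubgroup e]) : toAlg K e (c • z) = c • toAlg K e z := by
  induction z using MonoidAlgebra.induction_linear with
  | zero => simp
  | add x y hx hy => rw [smul_add, map_add, hx, hy, map_add, smul_add]
  | single g a => rw [MonoidAlgebra.smul_single, toAlg_single, toAlg_single,
      MonoidAlgebra.smul_single]

theorem idem_mul_toAlg (z : K[MaxSubgroup e]) :
    MonoidAlgebra.single (e : M) 1 * toAlg K e z = toAlg K e z := by
  rw [← toAlg_one, ← map_mul, one_mul]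

theorem toAlg_mul_idem (z : K[MaxSubgroup e]) :
    toAlg K e z * MonoidAlgebra.single (e : M) 1 = toAlg K e z := by
  rw [← toAlg_one, ← map_mul, mul_one]

theorem algMap_toAlg (B : Type*) [CommRing B] [Algebra K B] (z : K[MaxSubgroup e]) :
    algMap K B M (toAlg K e z) = toAlg B e (algMap K B (MaxSubgroup e) z) := by
  induction z using MonoidAlgebra.induction_linear with
  | zero => simp only [map_zero]
  | add x y hx hy => simp only [map_add, hx, hy]
  | single g a => rw [toAlg_single, algMap_single, algMap_single, toAlg_single]

variable (K e)

open Classical in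
/-- The element `eme` of `K[G_e]` if `eme` lies in `G_e`, and `0` otherwise. -/
def cornerEntry (m : M) : K[MaxSubgroup e] :=
  if h : ∃ g : MaxSubgroup e, g.toM = e * m * e then MonoidAlgebra.single h.choose 1 else 0

/-- The linear map `K[M] → K[G_e]` with `m ↦ eme` if `eme` lies in `G_e` and `m ↦ 0`
otherwise. -/
def cornerProj : K[M] →ₗ[K] K[MaxSubgroup e] :=
  Finsupp.linearCombination K (cornerEntry K e) ∘ₗ (MonoidAlgebra.coeffLinearEquiv K).toLinearMap

variable {K e}

theorem cornerProj_single (m : M) (c : K) :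
    cornerProj K e (MonoidAlgebra.single m c) = c • cornerEntry K e m := by
  simp [cornerProj]

theorem cornerEntry_of_eq {m : M} {g : MaxSubgroup e} (h : g.toM = e * m * e) :
    cornerEntry K e m = MonoidAlgebra.single g 1 := by
  have h' : ∃ g : MaxSubgroup e, g.toM = e * m * e := ⟨g, h⟩
  rw [cornerEntry, dif_pos h', MaxSubgroup.toM_injective (h'.choose_spec.trans h.symm)]

theorem cornerEntry_of_not_jLe {m : M} (h : ¬ JLe (e : M) m) : cornerEntry K e m = 0 := by
  rw [cornerEntry, dif_neg]
  rintro ⟨g, hg⟩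
  have := g.jLe_toM
  rw [hg] at this
  exact h this.of_mul_right.of_mul_left

theorem cornerProj_eq_zero {a : K[M]} (ha : a ∈ belowIdeal K e) : cornerProj K e a = 0 := by
  rw [mem_belowIdeal_iff] at ha
  induction ha using Submodule.span_induction with
  | mem x hx =>
    obtain ⟨m, hm, rfl⟩ := hx
    rw [cornerProj_single, cornerEntry_of_not_jLe hm, smul_zero]
  | zero => rw [map_zero]
  | add x y _ _ hx hy => rw [map_add, hx, hy, add_zero]
  | smul c x _ hx => rw [map_smul, hx, smul_zero]

@[simp]
theorem cornerProj_toAlg (z : K[MaxSubgroup e]) : cornerProj K e (toAlg K e z) = z := by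
  induction z using MonoidAlgebra.induction_linear with
  | zero => simp
  | add x y hx hy => rw [map_add, map_add, hx, hy]
  | single g a =>
    rw [toAlg_single, cornerProj_single, cornerEntry_of_eq (g := g)
      (by rw [g.idem_mul_toM, g.toM_mul_idem]), MonoidAlgebra.smul_single, smul_eq_mul, mul_one]

/-- `cornerProj` vanishes on `belowIdeal` and is a left inverse of `toAlg`. -/
theorem toAlg_notMem_belowIdeal {z : K[MaxSubgroup e]} (hz : z ≠ 0) :
    toAlg K e z ∉ belowIdeal K e := fun h =>
  hz (by rw [← cornerProj_toAlg z, cornerProj_eq_zero h])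

/-- Modulo `belowIdeal`, the corner `e K[M] e` is `K[G_e]`: an element `eme` either has `e` in its
two-sided ideal, and then is a unit of `eMe`, or lies in `belowIdeal`. -/
theorem corner_sub_mem [Finite M] (a : K[M]) :
    MonoidAlgebra.single (e : M) 1 * a * MonoidAlgebra.single (e : M) 1 -
      toAlg K e (cornerProj K e a) ∈ belowIdeal K e := by
  induction a using MonoidAlgebra.induction_linear with
  | zero => simp
  | add x y hx hy =>
    have := (belowIdeal K e).add_mem hx hy
    rw [map_add, map_add, mul_add, add_mul]
    convert this using 1
    abel
  | single m c =>
    rw [cornerProj_single, MonoidAlgebra.single_mul_single, MonoidAlgebra.single_mul_single,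
      one_mul, mul_one]
    by_cases h : JLe (e : M) (e * m * e)
    · obtain ⟨g, hg⟩ := exists_toM_eq (e := e) (x := e * m * e)
        (by simp only [mul_assoc, e.2.eq]; rw [← mul_assoc (e : M), e.2.eq]) h
      rw [cornerEntry_of_eq hg, toAlg_smul, toAlg_single, MonoidAlgebra.smul_single, smul_eq_mul,
        mul_one, hg, sub_self]
      exact Submodule.zero_mem _
    · rw [cornerEntry, dif_neg (fun ⟨g, hg⟩ => h (hg ▸ g.jLe_toM)), smul_zero, map_zero, sub_zero]
      exact single_mem_belowIdeal h c

theorem corner_smul_eq [Finite M] {V : Type*} [AddCommGroup V] [Module K[M] V]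
    (hV : ∀ a ∈ belowIdeal K e, ∀ v : V, a • v = 0) (a : K[M]) (v : V) :
    (MonoidAlgebra.single (e : M) 1 * a * MonoidAlgebra.single (e : M) 1) • v =
      toAlg K e (cornerProj K e a) • v := by
  have := hV _ (corner_sub_mem (e := e) a) v
  rwa [sub_smul, sub_eq_zero] at this

theorem algMap_cornerProj (B : Type*) [CommRing B] [Algebra K B] (a : K[M]) :
    algMap K B (MaxSubgroup e) (cornerProj K e a) = cornerProj B e (algMap K B M a) := by
  induction a using MonoidAlgebra.induction_linear with
  | zero => simp only [map_zero]
  | add x y hx hy => simp only [map_add, hx, hy]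
  | single m c =>
    rw [algMap_single, cornerProj_single, cornerProj_single, cornerEntry, cornerEntry]
    split_ifs with h
    · rw [MonoidAlgebra.smul_single, MonoidAlgebra.smul_single, algMap_single, smul_eq_mul,
        smul_eq_mul, mul_one, mul_one]
    · rw [smul_zero, smul_zero, map_zero]

theorem primitive_toAlg [Finite M] {v : K[MaxSubgroup e]} (h : ∀ z, ∃ c : K, v * z * v = c • v)
    (a : K[M]) : ∃ c : K, toAlg K e v * a * toAlg K e v - algebraMap K K[M] c * toAlg K e v ∈
      belowIdeal K e := by
  obtain ⟨c, hc⟩ := h (cornerProj K e a)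
  refine ⟨c, ?_⟩
  have h1 := Ideal.mul_mem_left _ (toAlg K e v)
    (Ideal.mul_mem_right (toAlg K e v) _ (corner_sub_mem (e := e) a))
  have h2 : toAlg K e v * ((MonoidAlgebra.single (e : M) 1 * a * MonoidAlgebra.single (e : M) 1 -
      toAlg K e (cornerProj K e a)) * toAlg K e v) =
      toAlg K e v * a * toAlg K e v - algebraMap K K[M] c * toAlg K e v := by
    rw [← Algebra.smul_def, ← toAlg_smul, ← hc, map_mul, map_mul, sub_mul, mul_sub]
    congr 1
    · simp only [mul_assoc]
      rw [idem_mul_toAlg, ← mul_assoc, toAlg_mul_idem]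
    · simp only [mul_assoc]
  rwa [h2] at h1

end Corner

/-! ### Apexes of simple modules -/

section Apex

variable {M : Type u} [Monoid M] {K : Type*} [CommRing K]

/-- Every simple `K[M]`-module has an apex. -/
theorem exists_apex [Finite M] (V : Type*) [AddCommGroup V] [Module K[M] V]
    [IsSimpleModule K[M] V] : ∃ e : Idem M, (∃ v : V, MonoidAlgebra.single (e : M) (1 : K) • v ≠ 0) ∧
      ∀ a ∈ belowIdeal K e, ∀ v : V, a • v = 0 := by
  classical
  let N : Set M := {m | ∃ v : V, MonoidAlgebra.single m (1 : K) • v ≠ 0}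
  -- By simplicity, an element of `K[M]` carries a nonzero vector of `m' V` to one not killed by
  -- `m`; some monoid element in its support will do.
  have hmul : ∀ m ∈ N, ∀ m' ∈ N, ∃ x, m * x * m' ∈ N := by
    rintro m ⟨v, hv⟩ m' ⟨v', hv'⟩
    obtain ⟨a, ha⟩ := exists_smul_eq_of_isSimpleModule (A := K[M]) hv' v
    have h1 : (MonoidAlgebra.single m (1 : K) * a * MonoidAlgebra.single m' 1) • v' ≠ 0 := by
      rwa [mul_smul, mul_smul, ha]
    by_contra! h0
    apply h1
    clear h1 ha hv hv'
    induction a using MonoidAlgebra.induction_linear with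
    | zero => simp
    | add x y hx hy => rw [mul_add, add_mul, add_smul, hx, hy, add_zero]
    | single x c =>
      have hx : MonoidAlgebra.single (m * x * m') (1 : K) • v' = 0 := by
        by_contra hne
        exact h0 x ⟨v', hne⟩
      rw [MonoidAlgebra.single_mul_single, MonoidAlgebra.single_mul_single, one_mul, mul_one,
        ← mul_one c, ← smul_eq_mul c, ← MonoidAlgebra.smul_single, Algebra.smul_def, mul_smul, hx,
        smul_zero]
  have := IsSimpleModule.nontrivial K[M] V
  obtain ⟨v, hv⟩ := exists_ne (0 : V)
  have hne : N.Nonempty := ⟨1, v, by rwa [← MonoidAlgebra.one_def, one_smul]⟩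
  obtain ⟨m, hm, hmin⟩ := Set.exists_min_image N jCard (Set.toFinite _) hne
  have hmin' : ∀ m' ∈ N, JLe m' m → JLe m m' := fun m' hm' h => jLe_of_jCard_le h (hmin m' hm')
  obtain ⟨x, hx⟩ := hmul m hm m hm
  obtain ⟨a, b, hab⟩ := hmin' _ hx ⟨1, x * m, by simp only [one_mul, mul_assoc]⟩
  -- Iterating `m = (a m x) m b` puts `m` below every power of `a m x`, while positive powers are
  -- below `m`. So an idempotent power is `𝒥`-equivalent to `m`.
  have hpow : ∀ n, m = (a * m * x) ^ n * m * b ^ n := by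
    intro n
    induction n with
    | zero => simp
    | succ n ih =>
      calc m = a * (m * x * m) * b := hab
        _ = (a * m * x) * m * b := by simp only [mul_assoc]
        _ = (a * m * x) * ((a * m * x) ^ n * m * b ^ n) * b := by rw [← ih]
        _ = _ := by rw [pow_succ', pow_succ]; simp only [mul_assoc]
  obtain ⟨n, hn⟩ := exists_isIdempotentElem_pow (a * m * x)
  let e : Idem M := ⟨_, hn⟩
  have hme : JLe m e := ⟨1, m * b ^ (n + 1), by
    rw [one_mul, ← mul_assoc]; exact hpow (n + 1)⟩
  have hem : JLe (e : M) m := ⟨a, x * (a * m * x) ^ n, by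
    change (a * m * x) ^ (n + 1) = _
    rw [pow_succ']
    simp only [mul_assoc]⟩
  have heN : (e : M) ∈ N := by
    obtain ⟨v, hv⟩ := hm
    obtain ⟨c, d, hcd⟩ := hme
    by_contra h0
    apply hv
    have h1 : ∀ w : V, MonoidAlgebra.single (e : M) (1 : K) • w = 0 := by
      intro w
      by_contra hne
      exact h0 ⟨w, hne⟩
    rw [hcd, ← one_mul (1 : K), ← MonoidAlgebra.single_mul_single, mul_smul,
      ← one_mul (1 : K), ← MonoidAlgebra.single_mul_single, mul_smul, h1, smul_zero]
  refine ⟨e, heN, belowIdeal_smul_eq_zero fun y hy v => ?_⟩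
  by_contra hne
  -- If `y` acts as nonzero, so does some `e z y`; it lies below `m`, so by minimality it is
  -- equivalent to `m`, and then `e` lies below `y`.
  obtain ⟨z, hz⟩ := hmul e heN y ⟨v, hne⟩
  apply hy
  have h1 : JLe (e * z * y) m := JLe.trans ⟨1, z * y, by simp only [one_mul, mul_assoc]⟩ hem
  exact (hem.trans (hmin' _ hz h1)).of_mul_left

end Apex

/-! ### Primitive idempotents of group algebras -/

section Primitive

/-- A nonzero idempotent `v` of `K[G]` such that `v K[G] v = K v`. -/
structure IsScalarIdempotent {K G : Type*} [CommRing K] [Monoid G] (v : K[G]) : Prop where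
  idem : IsIdempotentElem v
  ne_zero : v ≠ 0
  scalar : ∀ z : K[G], ∃ c : K, v * z * v = c • v

/-- Semisimple rings are von Neumann regular. -/
theorem exists_mul_mul_eq_self {R : Type*} [Ring R] [IsSemisimpleRing R] (c : R) :
    ∃ d, c * d * c = c := by
  obtain ⟨ε, hε, h⟩ := IsSemisimpleRing.ideal_eq_span_idempotent (Ideal.span {c})
  obtain ⟨d, hd⟩ := Ideal.mem_span_singleton'.1 (h ▸ Ideal.mem_span_singleton_self ε)
  obtain ⟨b, hb⟩ := Ideal.mem_span_singleton'.1 (h ▸ Ideal.mem_span_singleton_self c)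
  refine ⟨d, ?_⟩
  rw [mul_assoc, hd, ← hb, mul_assoc, hε.eq]

/-- For `x = v z v'` regularity gives `x d x = x`. Now `v' d x = c v'` for a scalar `c`, and `c x =
x` forces `c = 1`. This is the isomorphism of the two primitive idempotents. -/
theorem exists_mul_eq_of_scalarIdempotent {K G : Type*} [Field K] [Monoid G]
    [IsSemisimpleRing K[G]] {v v' z : K[G]} (hv : IsScalarIdempotent v)
    (hv' : IsScalarIdempotent v') (h : v * z * v' ≠ 0) :
    ∃ x y, y * x = v' ∧ v * x = x := by
  obtain ⟨x, hx⟩ : ∃ x, x = v * z * v' := ⟨_, rfl⟩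
  rw [← hx] at h
  obtain ⟨d, hd⟩ := exists_mul_mul_eq_self x
  have hvx : v * x = x := by rw [hx, ← mul_assoc, ← mul_assoc, hv.idem.eq]
  have hxv : x * v' = x := by rw [hx, mul_assoc, hv'.idem.eq]
  obtain ⟨c, hc⟩ := hv'.scalar (d * x)
  refine ⟨x, v' * d, ?_, hvx⟩
  have h1 : v' * d * x = c • v' := by rw [← hc, mul_assoc v' (d * x), mul_assoc d x, hxv, mul_assoc]
  have h2 : c • x = x := by
    calc c • x = x * (c • v') := by rw [mul_smul_comm, hxv]
      _ = x := by rw [← h1, ← mul_assoc, ← mul_assoc, hxv, hd]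
  have h3 : c = 1 := by
    by_contra hne
    have : (c - 1) • x = 0 := by rw [sub_smul, h2, one_smul, sub_self]
    rcases smul_eq_zero.1 this with h4 | h4
    · exact hne (sub_eq_zero.1 h4)
    · exact h h4
  rw [h1, h3, one_smul]

variable {K M : Type u} [Field K] [Monoid M]

instance [Finite M] (e : Idem M) : Finite (MaxSubgroup e) := inferInstanceAs (Finite (Corner e)ˣ)

theorem isIdempotentElem_toAlg {K : Type*} [CommRing K] {e : Idem M} {v : K[MaxSubgroup e]}
    (hv : IsIdempotentElem v) : IsIdempotentElem (toAlg K e v) := by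
  rw [IsIdempotentElem, ← map_mul, hv.eq]

/-- Endomorphism rings being scalar, any two independent elements of a simple module are
separated by the action of the algebra. -/
theorem exists_smul_eq_zero_smul_eq_self [Finite M] (hK : IsSplittingField K M) {V : Type u} [AddCommGroup V]
    [Module K[M] V] [IsSimpleModule K[M] V] {x y : V}
    (h : ¬ ∃ c : K, y = algebraMap K K[M] c • x) : ∃ a : K[M], a • x = 0 ∧ a • y = y := by
  classical
  let _ : Module K V := Module.compHom V (algebraMap K K[M])
  have : IsScalarTower K K[M] V := IsScalarTower.of_compHom K K[M] V
  have hmem : y ∉ Submodule.span K {x} := by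
    intro hy
    obtain ⟨c, hc⟩ := Submodule.mem_span_singleton.1 hy
    exact h ⟨c, hc.symm⟩
  obtain ⟨l, hl, hl'⟩ := Submodule.exists_dual_map_eq_bot_of_notMem hmem inferInstance
  have hlx : l x = 0 := by
    have : l x ∈ (Submodule.span K {x}).map l :=
      Submodule.mem_map_of_mem (Submodule.mem_span_singleton_self _)
    rwa [hl', Submodule.mem_bot] at this
  -- The projection onto the line of `y` along the kernel of `l` commutes with all endomorphisms, as
  -- these are scalars. By the density theorem some algebra element agrees with it at `x` and `y`.
  let f : Module.End (Module.End K[M] V) V :=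
    { toFun := fun w => ((l y)⁻¹ * l w) • y
      map_add' := fun a b => by rw [map_add, mul_add, add_smul]
      map_smul' := fun φ w => by
        obtain ⟨c, hc⟩ := endomorphism_eq_smul hK φ
        have h1 : φ • w = c • w := hc w
        have h2 : ∀ t : V, φ • t = c • t := hc
        rw [h1, map_smul, RingHom.id_apply, h2, smul_smul, smul_eq_mul]
        congr 1
        ring }
  obtain ⟨a, ha⟩ := jacobson_density f {x, y}
  refine ⟨a, ?_, ?_⟩
  · rw [← ha x (by simp)]
    change ((l y)⁻¹ * l x) • y = 0
    rw [hlx, mul_zero, zero_smul]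
  · rw [← ha y (by simp)]
    change ((l y)⁻¹ * l y) • y = y
    rw [inv_mul_cancel₀ hl, one_smul]

variable {e : Idem M}

theorem toAlg_smul_ne_zero_of_mul_mul_ne_zero {K : Type*} [Field K]
    [IsSemisimpleRing K[MaxSubgroup e]] {V : Type*} [AddCommGroup V] [Module K[M] V]
    {v v' z : K[MaxSubgroup e]} (hv : IsScalarIdempotent v) (hv' : IsScalarIdempotent v')
    (hz : v * z * v' ≠ 0) {w : V} (hw : toAlg K e v' • w ≠ 0) : ∃ y : V, toAlg K e v • y ≠ 0 := by
  obtain ⟨x, y, hyx, hvx⟩ := exists_mul_eq_of_scalarIdempotent hv hv' hz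
  refine ⟨toAlg K e x • w, fun h => hw ?_⟩
  rw [smul_smul, ← map_mul, hvx] at h
  rw [← hyx, map_mul, mul_smul, h, smul_zero]

variable [Finite M]

/-- Between elements of `K[G_e]`, an element of `K[M]` acts through its component in `K[G_e]`. -/
theorem toAlg_smul_smul_eq {K : Type*} [CommRing K] {V : Type*} [AddCommGroup V] [Module K[M] V]
    (hV : ∀ a ∈ belowIdeal K e, ∀ v : V, a • v = 0) (z z' : K[MaxSubgroup e]) (a : K[M]) (w : V) :
    toAlg K e z • a • toAlg K e z' • w = toAlg K e (z * cornerProj K e a * z') • w := by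
  have h1 : MonoidAlgebra.single (e : M) (1 : K) • toAlg K e z' • w = toAlg K e z' • w := by
    rw [smul_smul, idem_mul_toAlg]
  have h2 (y : V) : toAlg K e z • MonoidAlgebra.single (e : M) (1 : K) • y = toAlg K e z • y := by
    rw [smul_smul, toAlg_mul_idem]
  rw [map_mul, map_mul, mul_smul, mul_smul, ← corner_smul_eq hV, mul_smul, mul_smul, h1, h2]

/-- The splitting hypothesis concerns `M`, not its maximal subgroups. So scalarity of an idempotent
generator `ζ` of a minimal left ideal is tested on a simple `K[M]`-module on which `ζ` acts as
nonzero. -/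
theorem exists_scalarIdempotent_mem (hK : IsSplittingField K M)
    [IsSemisimpleRing K[MaxSubgroup e]] {J : Ideal K[MaxSubgroup e]} (hJ : J ≠ ⊥) :
    ∃ ζ : K[MaxSubgroup e], IsScalarIdempotent ζ ∧ ζ ∈ J := by
  obtain ⟨I, hI, hIJ⟩ := (eq_bot_or_exists_atom_le J).resolve_left hJ
  have hI' := isSimpleModule_iff_isAtom.2 hI
  obtain ⟨ζ, hζ, rfl⟩ := IsSemisimpleRing.ideal_eq_span_idempotent I
  have hζJ : ζ ∈ J := hIJ (Ideal.mem_span_singleton_self ζ)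
  have hζ0 : ζ ≠ 0 := by
    rintro rfl
    exact hI.1 (Ideal.span_singleton_eq_bot.2 rfl)
  -- Minimality of the left ideal: each of its nonzero elements generates `ζ`.
  have hinv : ∀ d : K[MaxSubgroup e], d * ζ = d → d ≠ 0 → ∃ b, b * d = ζ := by
    intro d hd hd0
    obtain ⟨b, hb⟩ := exists_smul_eq_of_isSimpleModule (A := K[MaxSubgroup e])
      (x := (⟨d, Ideal.mem_span_singleton'.2 ⟨d, hd⟩⟩ : Ideal.span {ζ}))
      (fun h => hd0 (congrArg Subtype.val h)) ⟨ζ, Ideal.mem_span_singleton_self ζ⟩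
    exact ⟨b, congrArg Subtype.val hb⟩
  obtain ⟨T, hT, hkill, x, hx, hζx⟩ := exists_simple_of_idempotent (belowIdeal K e)
    (isIdempotentElem_toAlg hζ) (toAlg_notMem_belowIdeal hζ0)
  -- `ζ T` is a line: an element killing `x` and fixing `y` would give a nonzero `d = ζ a ζ` with `d
  -- x = 0`, and `ζ = b d` would kill `x = ζ x`.
  have hline : ∀ y : T, toAlg K e ζ • y = y → ∃ c : K, y = algebraMap K K[M] c • x := by
    intro y hy
    by_contra hne
    obtain ⟨a, hax, hay⟩ := exists_smul_eq_zero_smul_eq_self hK hne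
    have hdx : toAlg K e (ζ * cornerProj K e a * ζ) • x = 0 := by
      rw [← toAlg_smul_smul_eq hkill, hζx, hax, smul_zero]
    have hdy : toAlg K e (ζ * cornerProj K e a * ζ) • y = y := by
      rw [← toAlg_smul_smul_eq hkill, hy, hay, hy]
    have hd0 : ζ * cornerProj K e a * ζ ≠ 0 := by
      intro h
      rw [h, map_zero, zero_smul] at hdy
      exact hne ⟨0, by rw [← hdy, map_zero, zero_smul]⟩
    obtain ⟨b, hb⟩ := hinv _ (by rw [mul_assoc, hζ.eq]) hd0
    apply hx
    rw [← hζx, ← hb, map_mul, mul_smul, hdx, smul_zero]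
  refine ⟨ζ, ⟨hζ, hζ0, fun z => ?_⟩, hζJ⟩
  obtain ⟨c, hc⟩ := hline (toAlg K e (ζ * z * ζ) • x) (by
    rw [smul_smul, ← map_mul, ← mul_assoc, ← mul_assoc, hζ.eq])
  refine ⟨c, ?_⟩
  by_contra hne
  -- This difference kills `x`; if nonzero, it would generate `ζ`, which does not kill `x`.
  obtain ⟨b, hb⟩ := hinv (ζ * z * ζ - c • ζ)
    (by rw [sub_mul, mul_assoc, hζ.eq, smul_mul_assoc, hζ.eq]) (sub_ne_zero.2 hne)
  apply hx
  have h0 : toAlg K e (ζ * z * ζ - c • ζ) • x = 0 := by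
    rw [map_sub, sub_smul, hc, toAlg_smul, Algebra.smul_def, mul_smul, hζx, sub_self]
  rw [← hζx, ← hb, map_mul, mul_smul, h0, smul_zero]

/-- If `v` and `v'` are primitive idempotents that both act as nonzero on a simple module, then
`v K[G] v' ≠ 0`. -/
theorem exists_mul_mul_ne_zero {K : Type*} [Field K] {V : Type*} [AddCommGroup V] [Module K[M] V]
    [IsSimpleModule K[M] V] (hV : ∀ a ∈ belowIdeal K e, ∀ v : V, a • v = 0)
    {v v' : K[MaxSubgroup e]} (hv : IsIdempotentElem v) {w w' : V}
    (hw : toAlg K e v • w ≠ 0) (hw' : toAlg K e v' • w' ≠ 0) : ∃ z, v * z * v' ≠ 0 := by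
  obtain ⟨a, ha⟩ := exists_smul_eq_of_isSimpleModule (A := K[M]) hw' (toAlg K e v • w)
  refine ⟨cornerProj K e a, fun h => hw ?_⟩
  have h1 := toAlg_smul_smul_eq hV v v' a w'
  rwa [h, map_zero, zero_smul, ha, smul_smul, ← map_mul, hv.eq] at h1

end Primitive

/-! ### Primitive idempotents over the residue field, the valuation ring and the fraction field -/

section PrimitiveLift

theorem algMap_smul {A B N : Type*} [CommRing A] [CommRing B] [Algebra A B] [Monoid N] (c : A)
    (x : A[N]) : algMap A B N (c • x) = algebraMap A B c • algMap A B N x := by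
  rw [Algebra.smul_def, map_mul, Algebra.smul_def]
  congr 1
  simp

theorem algMap_injective {A B : Type*} (N : Type*) [CommRing A] [CommRing B] [Algebra A B] [Monoid N]
    (h : Function.Injective (algebraMap A B)) : Function.Injective (algMap A B N) := by
  intro x y hxy
  ext n
  have := congrArg (fun z => z.coeff n) hxy
  exact h (by simpa using this)

variable {𝒪 : Type*} [CommRing 𝒪] [IsDomain 𝒪] [IsDiscreteValuationRing 𝒪] {N : Type*}

local notation "𝕜" => IsLocalRing.ResidueField 𝒪

theorem maximalIdeal_le_jacobson_bot {π : 𝒪} (hπ : Irreducible π) :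
    Ideal.span {π} ≤ (⊥ : Ideal 𝒪).jacobson := by
  rw [← hπ.maximalIdeal_eq]
  exact IsLocalRing.maximalIdeal_le_jacobson _

theorem exists_smul_eq_algMap (F : Type*) [Field F] [Algebra 𝒪 F] [IsFractionRing 𝒪 F] [Monoid N]
    (z : F[N]) : ∃ d : 𝒪, d ≠ 0 ∧ ∃ z' : 𝒪[N], algebraMap 𝒪 F d • z = algMap 𝒪 F N z' := by
  induction z using MonoidAlgebra.induction_linear with
  | zero => exact ⟨1, one_ne_zero, 0, by simp⟩
  | add x y hx hy =>
    obtain ⟨d, hd, x', hx'⟩ := hx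
    obtain ⟨d', hd', y', hy'⟩ := hy
    refine ⟨d * d', mul_ne_zero hd hd', algebraMap 𝒪 𝒪[N] d' * x' + algebraMap 𝒪 𝒪[N] d * y', ?_⟩
    rw [map_add, map_mul (algMap 𝒪 F N), map_mul (algMap 𝒪 F N), ← hx', ← hy']
    have h : ∀ c : 𝒪, algMap 𝒪 F N (algebraMap 𝒪 𝒪[N] c) = algebraMap F F[N] (algebraMap 𝒪 F c) :=
      fun c => by simp
    rw [h, h, ← Algebra.smul_def, ← Algebra.smul_def, smul_smul, smul_smul, smul_add, map_mul,
      mul_comm (algebraMap 𝒪 F d')]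
  | single n c =>
    obtain ⟨a, b, hb, rfl⟩ := IsFractionRing.div_surjective (A := 𝒪) c
    refine ⟨b, nonZeroDivisors.ne_zero hb, MonoidAlgebra.single n a, ?_⟩
    have hb' : algebraMap 𝒪 F b ≠ 0 := by
      simpa using nonZeroDivisors.ne_zero hb
    rw [algMap_single, MonoidAlgebra.smul_single, smul_eq_mul, mul_div_cancel₀ _ hb']

variable [Monoid N] [Finite N]

/-- Lifts of primitive idempotents are primitive. -/
theorem exists_eq_smul_of_residue {v : 𝒪[N]} (hv : IsIdempotentElem v)
    (h : ∀ z : 𝕜[N], ∃ c : 𝕜, algMap 𝒪 𝕜 N v * z * algMap 𝒪 𝕜 N v = c • algMap 𝒪 𝕜 N v)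
    (z : 𝒪[N]) : ∃ c : 𝒪, v * z * v = c • v := by
  obtain ⟨π, hπ⟩ := IsDiscreteValuationRing.exists_irreducible 𝒪
  let φ : 𝒪[N] →ₗ[𝒪] 𝒪[N] := LinearMap.mulRight 𝒪 v ∘ₗ LinearMap.mulLeft 𝒪 v
  have hφ : ∀ z, φ z = v * z * v := fun z => rfl
  -- Nakayama's lemma: scalarity over the residue field gives `v 𝒪[N] v ⊆ 𝒪 v + π (v 𝒪[N] v)`.
  have hle : LinearMap.range φ ≤ Submodule.span 𝒪 {v} := by
    refine Submodule.le_of_le_smul_of_le_jacobson_bot (I := Ideal.span {π})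
      (IsNoetherian.noetherian _) (maximalIdeal_le_jacobson_bot hπ) ?_
    rintro _ ⟨x, rfl⟩
    obtain ⟨c, hc⟩ := h (algMap 𝒪 𝕜 N x)
    obtain ⟨c, rfl⟩ := IsLocalRing.residue_surjective c
    obtain ⟨y, hy⟩ := exists_eq_smul_of_algMap_eq_zero (x := v * x * v - c • v) hπ (by
      rw [map_sub, map_mul, map_mul, hc, algMap_smul, sub_eq_zero]
      rfl)
    have h1 : φ x = c • v + π • φ y := by
      have h2 : φ x - c • v = v * (v * x * v - c • v) * v := by
        rw [hφ, mul_sub, sub_mul, mul_smul_comm, smul_mul_assoc, hv.eq, hv.eq]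
        congr 1
        rw [mul_assoc, mul_assoc, mul_assoc, mul_assoc, hv.eq, ← mul_assoc v v, hv.eq]
      rw [hy, mul_smul_comm, smul_mul_assoc] at h2
      rw [← sub_eq_iff_eq_add', h2, hφ]
    rw [h1]
    exact Submodule.add_mem_sup (Submodule.smul_mem _ _ (Submodule.mem_span_singleton_self v))
      (Submodule.smul_mem_smul (Ideal.mem_span_singleton_self π) ⟨y, rfl⟩)
  obtain ⟨c, hc⟩ := Submodule.mem_span_singleton.1 (hle ⟨z, rfl⟩)
  exact ⟨c, hc.symm⟩

/-- An idempotent of `𝒪[N]` lifting a primitive idempotent of `k[N]`. -/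
structure IsPrimitiveLift (v : 𝒪[N]) : Prop where
  idem : IsIdempotentElem v
  residue : IsScalarIdempotent (algMap 𝒪 𝕜 N v)

theorem IsPrimitiveLift.fraction {v : 𝒪[N]} (hv : IsPrimitiveLift v) (F : Type*) [Field F]
    [Algebra 𝒪 F] [IsFractionRing 𝒪 F] : IsScalarIdempotent (algMap 𝒪 F N v) where
  idem := hv.idem.map _
  ne_zero h := hv.residue.ne_zero (by
    rw [algMap_injective N (IsFractionRing.injective 𝒪 F) (h.trans (map_zero _).symm), map_zero])
  scalar z := by
    obtain ⟨d, hd, z', hz⟩ := exists_smul_eq_algMap (𝒪 := 𝒪) F z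
    obtain ⟨c, hc⟩ := exists_eq_smul_of_residue hv.idem hv.residue.scalar z'
    have hd' : algebraMap 𝒪 F d ≠ 0 := by simpa using hd
    refine ⟨(algebraMap 𝒪 F d)⁻¹ * algebraMap 𝒪 F c, ?_⟩
    rw [mul_smul, ← algMap_smul, ← hc, map_mul, map_mul, ← hz, mul_smul_comm, smul_mul_assoc,
      inv_smul_smul₀ hd']

/-- Both conditions say that `v 𝒪[N] v'` is nonzero: over `F` by clearing denominators, over `k` by
Nakayama's lemma. Thus isomorphism of primitive idempotents is the same over `k` and over `F`. -/
theorem exists_mul_mul_ne_zero_iff {v v' : 𝒪[N]} (hv : IsPrimitiveLift v)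
    (hv' : IsPrimitiveLift v') (F : Type*) [Field F] [Algebra 𝒪 F] [IsFractionRing 𝒪 F] :
    (∃ z, algMap 𝒪 𝕜 N v * z * algMap 𝒪 𝕜 N v' ≠ 0) ↔
      ∃ z, algMap 𝒪 F N v * z * algMap 𝒪 F N v' ≠ 0 := by
  constructor
  · rintro ⟨z, hz⟩
    obtain ⟨z, rfl⟩ := algMap_residue_surjective 𝒪 N z
    refine ⟨algMap 𝒪 F N z, fun h => hz ?_⟩
    rw [← map_mul, ← map_mul] at h ⊢
    rw [algMap_injective N (IsFractionRing.injective 𝒪 F) (h.trans (map_zero _).symm), map_zero]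
  · rintro ⟨z, hz⟩
    by_contra! h
    obtain ⟨π, hπ⟩ := IsDiscreteValuationRing.exists_irreducible 𝒪
    let φ : 𝒪[N] →ₗ[𝒪] 𝒪[N] := LinearMap.mulRight 𝒪 v' ∘ₗ LinearMap.mulLeft 𝒪 v
    have hφ : ∀ z, φ z = v * z * v' := fun z => rfl
    have hbot : LinearMap.range φ = ⊥ := by
      refine Submodule.eq_bot_of_le_smul_of_le_jacobson_bot (Ideal.span {π}) _
        (IsNoetherian.noetherian _) ?_ (maximalIdeal_le_jacobson_bot hπ)
      rintro _ ⟨x, rfl⟩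
      obtain ⟨y, hy⟩ := exists_eq_smul_of_algMap_eq_zero (x := φ x) hπ (by
        rw [hφ, map_mul, map_mul, h])
      have h1 : φ x = π • φ y := by
        have h2 : φ x = v * φ x * v' := by
          rw [hφ, mul_assoc, mul_assoc, mul_assoc, mul_assoc, hv'.idem.eq, ← mul_assoc v v,
            hv.idem.eq]
        rw [hy, mul_smul_comm, smul_mul_assoc] at h2
        rw [hy, h2, hφ]
      rw [h1]
      exact Submodule.smul_mem_smul (Ideal.mem_span_singleton_self π) ⟨y, rfl⟩
    obtain ⟨d, hd, z', hz'⟩ := exists_smul_eq_algMap (𝒪 := 𝒪) F z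
    have hd' : algebraMap 𝒪 F d ≠ 0 := by simpa using hd
    apply hz
    have h0 : v * z' * v' = 0 := by
      have : φ z' ∈ LinearMap.range φ := ⟨z', rfl⟩
      rwa [hbot, Submodule.mem_bot] at this
    have h1 : algebraMap 𝒪 F d • (algMap 𝒪 F N v * z * algMap 𝒪 F N v') = 0 := by
      rw [← smul_mul_assoc, ← mul_smul_comm, hz', ← map_mul, ← map_mul, h0, map_zero]
    exact (smul_eq_zero.1 h1).resolve_left hd'

end PrimitiveLift

/-! ### Existence of primitive lifts for semisimple group algebras -/

section PrimitiveLiftExists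

variable {𝒪 M : Type u} [CommRing 𝒪] [IsDomain 𝒪] [IsDiscreteValuationRing 𝒪]
  [IsAdicComplete (IsLocalRing.maximalIdeal 𝒪) 𝒪] [Monoid M] [Finite M] {e : Idem M}

local notation "𝕜" => IsLocalRing.ResidueField 𝒪

theorem isSemisimpleRing_of_not_dvd {K : Type*} [Field K] {p : ℕ} [CharP K p] {G : Type*} [Group G]
    [Finite G] (h : ¬ p ∣ Nat.card G) : IsSemisimpleRing K[G] := by
  have : NeZero (Nat.card G : K) := ⟨fun h' => h ((CharP.cast_eq_zero_iff K p _).1 h')⟩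
  infer_instance

theorem isSemisimpleRing_of_charZero {K : Type*} [Field K] [CharZero K] {G : Type*} [Group G]
    [Finite G] : IsSemisimpleRing K[G] := by
  have : NeZero (Nat.card G : K) := ⟨Nat.cast_ne_zero.2 Nat.card_pos.ne'⟩
  infer_instance

theorem exists_isPrimitiveLift_mem (hk : IsSplittingField 𝕜 M)
    [IsSemisimpleRing 𝕜[MaxSubgroup e]] {J : Ideal 𝕜[MaxSubgroup e]} (hJ : J ≠ ⊥) :
    ∃ v : 𝒪[MaxSubgroup e], IsPrimitiveLift v ∧ algMap 𝒪 𝕜 (MaxSubgroup e) v ∈ J := by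
  obtain ⟨ζ, hζ, hζJ⟩ := exists_scalarIdempotent_mem hk hJ
  obtain ⟨v, hv, rfl⟩ := exists_isIdempotentElem_lift hζ.idem
  exact ⟨v, ⟨hv, hζ⟩, hζJ⟩

/-- By semisimplicity, `J` has a nonzero complement; a primitive idempotent in the complement is not
in `J`. -/
theorem exists_isPrimitiveLift_notMem (hk : IsSplittingField 𝕜 M)
    [IsSemisimpleRing 𝕜[MaxSubgroup e]] {J : Ideal 𝕜[MaxSubgroup e]} (hJ : J ≠ ⊤) :
    ∃ v : 𝒪[MaxSubgroup e], IsPrimitiveLift v ∧ algMap 𝒪 𝕜 (MaxSubgroup e) v ∉ J := by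
  obtain ⟨I, hI⟩ := exists_isCompl J
  obtain ⟨v, hv, hvI⟩ := exists_isPrimitiveLift_mem hk (J := I) (by
    rintro rfl
    exact hJ (by simpa using hI.sup_eq_top))
  refine ⟨v, hv, fun h => hv.residue.ne_zero ?_⟩
  have := Submodule.mem_inf.2 ⟨h, hvI⟩
  rwa [hI.inf_eq_bot, Submodule.mem_bot] at this

/-- A right ideal containing all reductions of primitive lifts is the whole algebra. -/
theorem exists_isPrimitiveLift_op_notMem (hk : IsSplittingField 𝕜 M)
    [IsSemisimpleRing 𝕜[MaxSubgroup e]] {J : Ideal 𝕜[MaxSubgroup e]ᵐᵒᵖ} (hJ : J ≠ ⊤) :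
    ∃ v : 𝒪[MaxSubgroup e], IsPrimitiveLift v ∧
      MulOpposite.op (algMap 𝒪 𝕜 (MaxSubgroup e) v) ∉ J := by
  obtain ⟨ε, hε, rfl⟩ := IsSemisimpleRing.ideal_eq_span_idempotent J
  have hε' : ε.unop * ε.unop = ε.unop := congrArg MulOpposite.unop hε.eq
  -- The right ideal is `ε k[G]`. An idempotent lying in both `k[G] (1 - ε)` and `ε k[G]` equals its
  -- own square, which contains the factor `(1 - ε) ε = 0`.
  obtain ⟨v, hv, hvI⟩ := exists_isPrimitiveLift_mem hk (J := Ideal.span {1 - ε.unop}) (by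
    intro h
    rw [Ideal.span_singleton_eq_bot, sub_eq_zero] at h
    apply hJ
    rw [Ideal.eq_top_iff_one, show (1 : 𝕜[MaxSubgroup e]ᵐᵒᵖ) = ε from congrArg MulOpposite.op h]
    exact Ideal.mem_span_singleton_self ε)
  refine ⟨v, hv, fun h => hv.residue.ne_zero ?_⟩
  obtain ⟨a, ha⟩ := Ideal.mem_span_singleton'.1 hvI
  obtain ⟨b, hb⟩ := Ideal.mem_span_singleton'.1 h
  have hb' : ε.unop * b.unop = algMap 𝒪 𝕜 (MaxSubgroup e) v := congrArg MulOpposite.unop hb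
  rw [← hv.residue.idem.eq]
  nth_rw 1 [← ha]
  rw [← hb', mul_assoc, ← mul_assoc (1 - _), sub_mul, one_mul, hε', sub_self, zero_mul, mul_zero]

end PrimitiveLiftExists

/-! ### Ranks of reductions of matrices -/

section Purity

variable {m n : Type*} [Fintype n]

theorem range_map_mulVecLin {R K : Type*} [CommRing R] [CommRing K] [Algebra R K]
    (A : Matrix m n R) {ι : Type*} {b : ι → m → R}
    (hb : Submodule.span R (Set.range b) = LinearMap.range A.mulVecLin) :
    LinearMap.range (A.map (algebraMap R K)).mulVecLin =
      Submodule.span K (Set.range fun i => algebraMap R K ∘ b i) := by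
  classical
  have hmap : ∀ x ∈ LinearMap.range A.mulVecLin,
      algebraMap R K ∘ x ∈ Submodule.span K (Set.range fun i => algebraMap R K ∘ b i) := by
    intro x hx
    rw [← hb] at hx
    induction hx using Submodule.span_induction with
    | mem x hx =>
      obtain ⟨i, rfl⟩ := hx
      exact Submodule.subset_span ⟨i, rfl⟩
    | zero => convert Submodule.zero_mem _; ext; simp
    | add x y _ _ hx hy => convert Submodule.add_mem _ hx hy; ext; simp
    | smul c x _ hx => convert Submodule.smul_mem _ (algebraMap R K c) hx; ext; simp
  apply le_antisymm
  · rw [Matrix.range_mulVecLin, Submodule.span_le]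
    rintro _ ⟨j, rfl⟩
    refine hmap (A.col j) ?_
    rw [Matrix.range_mulVecLin]
    exact Submodule.subset_span ⟨j, rfl⟩
  · rw [Submodule.span_le]
    rintro _ ⟨i, rfl⟩
    have : b i ∈ LinearMap.range A.mulVecLin := hb ▸ Submodule.subset_span ⟨i, rfl⟩
    obtain ⟨x, hx⟩ := this
    refine ⟨algebraMap R K ∘ x, ?_⟩
    funext j
    rw [Matrix.mulVecLin_apply, ← RingHom.map_mulVec, ← Matrix.mulVecLin_apply, hx]
    rfl

/-- Linear independence after reduction modulo `π`. -/
theorem linearIndependent_reduction_iff [Finite m] {R k : Type*} [CommRing R] [IsDomain R] [Field k]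
    [Algebra R k] {π : R} (hπ : π ≠ 0) (hker : RingHom.ker (algebraMap R k) = Ideal.span {π})
    {ι : Type*} [Finite ι] {b : ι → m → R} (hb : LinearIndependent R b) :
    LinearIndependent k (fun i => algebraMap R k ∘ b i) ↔
      ∀ x : m → R, π • x ∈ Submodule.span R (Set.range b) → x ∈ Submodule.span R (Set.range b) := by
  have := Fintype.ofFinite ι
  let q : R ⧸ Ideal.span {π} →+* k := Ideal.Quotient.lift _ (algebraMap R k) fun a ha => by
    rwa [← hker] at ha
  -- Independence over `k` of vectors with entries in the image of `R` can be tested over `R ⧸ (π)`,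
  -- which embeds in `k`.
  have hq : Function.Injective q := by
    refine RingHom.lift_injective_of_ker_le_ideal _ _ (by rw [hker])
  let _ : Algebra (R ⧸ Ideal.span {π}) k := q.toAlgebra
  have : FaithfulSMul (R ⧸ Ideal.span {π}) k := (faithfulSMul_iff_algebraMap_injective _ _).2 hq
  have h1 : (fun i => algebraMap R k ∘ b i) =
      fun i => algebraMap (R ⧸ Ideal.span {π}) k ∘ (Ideal.Quotient.mk (Ideal.span {π}) ∘ b i) := rfl
  rw [h1, linearIndependent_algebraMap_comp_iff, Fintype.linearIndependent_iff]
  rw [Fintype.linearIndependent_iff] at hb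
  -- A relation modulo `π` is the same as a combination of the `b i` divisible by `π`; purity then
  -- divides its coefficients by `π`.
  have key : ∀ c : ι → R, ∑ i, (Ideal.Quotient.mk (Ideal.span {π}) (c i)) •
      (Ideal.Quotient.mk (Ideal.span {π}) ∘ b i) = 0 ↔ ∃ x : m → R, ∑ i, c i • b i = π • x := by
    intro c
    have h2 : ∀ j, (∑ i, (Ideal.Quotient.mk (Ideal.span {π}) (c i)) •
        (Ideal.Quotient.mk (Ideal.span {π}) ∘ b i)) j =
        Ideal.Quotient.mk (Ideal.span {π}) ((∑ i, c i • b i) j) := by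
      intro j
      simp
    constructor
    · intro h
      have h3 : ∀ j, ∃ y, (∑ i, c i • b i) j = π * y := by
        intro j
        have h4 := h2 j
        rw [h, Pi.zero_apply, eq_comm, Ideal.Quotient.eq_zero_iff_mem,
          Ideal.mem_span_singleton] at h4
        exact h4
      choose x hx using h3
      exact ⟨x, funext fun j => by rw [hx]; rfl⟩
    · rintro ⟨x, hx⟩
      funext j
      rw [h2, hx, Pi.zero_apply, Ideal.Quotient.eq_zero_iff_mem, Ideal.mem_span_singleton]
      exact ⟨x j, rfl⟩
  constructor
  · intro h x hx
    obtain ⟨c, hc⟩ := (Submodule.mem_span_range_iff_exists_fun R).1 hx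
    have h2 := h _ ((key c).2 ⟨x, hc⟩)
    have h3 : ∀ i, ∃ d, c i = π * d := fun i => by
      have := h2 i
      rwa [Ideal.Quotient.eq_zero_iff_mem, Ideal.mem_span_singleton] at this
    choose d hd using h3
    refine (Submodule.mem_span_range_iff_exists_fun R).2 ⟨d, ?_⟩
    apply smul_right_injective _ hπ
    simp only [← hc, Finset.smul_sum, smul_smul, hd]
  · intro h c hc i
    choose d hd using fun i => Ideal.Quotient.mk_surjective (c i)
    obtain rfl : (fun i => Ideal.Quotient.mk _ (d i)) = c := funext hd
    obtain ⟨x, hx⟩ := (key d).1 hc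
    have h2 := h x ((Submodule.mem_span_range_iff_exists_fun R).2 ⟨d, hx⟩)
    obtain ⟨f, hf⟩ := (Submodule.mem_span_range_iff_exists_fun R).1 h2
    have h3 := hb (fun i => d i - π * f i) (by
      simp only [sub_smul, Finset.sum_sub_distrib, hx, mul_smul, ← Finset.smul_sum, hf, sub_self]) i
    rw [Ideal.Quotient.eq_zero_iff_mem, Ideal.mem_span_singleton]
    exact ⟨f i, sub_eq_zero.1 h3⟩

theorem exists_linearIndependent_span_eq {R V : Type*} [CommRing R] [IsDomain R]
    [IsPrincipalIdealRing R] [AddCommGroup V] [Module R V] [Module.Free R V] [Module.Finite R V]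
    (N : Submodule R V) :
    ∃ (t : ℕ) (b : Fin t → V), LinearIndependent R b ∧ Submodule.span R (Set.range b) = N := by
  let b := Module.finBasis R N
  refine ⟨_, fun i => (b i : V), b.linearIndependent.map' N.subtype (Submodule.ker_subtype _), ?_⟩
  have h := congrArg (Submodule.map N.subtype) b.span_eq
  rwa [Submodule.map_span, ← Set.range_comp, Submodule.map_top, Submodule.range_subtype] at h

/-- A matrix over a principal ideal domain has the same rank over the field of fractions and
modulo a prime `π` if and only if its column space is `π`-pure. -/
theorem rank_map_eq_rank_map_iff [Finite m] {R F k : Type*} [CommRing R] [IsDomain R] [IsPrincipalIdealRing R]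
    [Field F] [Algebra R F] [FaithfulSMul R F] [Field k] [Algebra R k] {π : R} (hπ : π ≠ 0)
    (hker : RingHom.ker (algebraMap R k) = Ideal.span {π}) (A : Matrix m n R) :
    (A.map (algebraMap R F)).rank = (A.map (algebraMap R k)).rank ↔
      ∀ x, π • x ∈ LinearMap.range A.mulVecLin → x ∈ LinearMap.range A.mulVecLin := by
  -- A basis of the column space stays independent over `F`, so the rank there is `t`. Modulo `π`
  -- its reduction spans the column space, so the rank is `t` exactly when the reduction is
  -- independent.
  obtain ⟨t, b, hind, hspan⟩ := exists_linearIndependent_span_eq (LinearMap.range A.mulVecLin)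
  have hF : (A.map (algebraMap R F)).rank = Fintype.card (Fin t) := by
    rw [Matrix.rank, range_map_mulVecLin A hspan]
    exact (linearIndependent_iff_card_eq_finrank_span.1
      (linearIndependent_algebraMap_comp_iff.2 hind)).symm
  rw [hF, Matrix.rank, range_map_mulVecLin A hspan, ← hspan,
    ← linearIndependent_reduction_iff hπ hker hind, linearIndependent_iff_card_eq_finrank_span]
  rfl

end Purity

/-! ### Sandwich matrices and dimensions of simple modules -/

section Sandwich

variable {M : Type u} [Monoid M]

instance [Finite M] (e : Idem M) : Fintype (LClass e) := Fintype.ofFinite _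

/-- The coefficients at `1` of the elements `rl` of `ℤG_e`. -/
def sandwichMatrix (e : Idem M) : Matrix (RClass e) (LClass e) ℤ :=
  Matrix.of fun r l => (sandwichEntry l r).coeff 1

/-- The linear map of the sandwich matrix. -/
def sandwichLin [Finite M] (R : Type*) [CommRing R] (e : Idem M) :
    (LClass e → R) →ₗ[R] (RClass e → R) :=
  ((sandwichMatrix e).map (Int.cast : ℤ → R)).mulVecLin

/-- The right action of `R[G_e]` on functions on `R_e`. -/
def rAct (R : Type*) [CommRing R] (e : Idem M) :
    R[MaxSubgroup e] →ₗ[R] Module.End R (RClass e → R) :=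
  Finsupp.linearCombination R (fun g : MaxSubgroup e =>
    LinearMap.funLeft R R (fun r : RClass e => g • r)) ∘ₗ
      (MonoidAlgebra.coeffLinearEquiv R).toLinearMap

variable {R : Type*} [CommRing R] {e : Idem M}

theorem rAct_single (g : MaxSubgroup e) (c : R) (w : RClass e → R) (r : RClass e) :
    rAct R e (MonoidAlgebra.single g c) w r = c * w (g • r) := by
  simp [rAct, LinearMap.funLeft]

theorem rAct_mul (z z' : R[MaxSubgroup e]) (w : RClass e → R) :
    rAct R e (z * z') w = rAct R e z' (rAct R e z w) := by
  induction z using MonoidAlgebra.induction_linear with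
  | zero => simp
  | add x y hx hy => rw [add_mul, map_add, map_add, LinearMap.add_apply, hx, hy, LinearMap.add_apply,
      map_add]
  | single g c =>
    induction z' using MonoidAlgebra.induction_linear with
    | zero => simp
    | add x y hx hy => rw [mul_add, map_add, map_add, LinearMap.add_apply, hx, hy,
        LinearMap.add_apply]
    | single g' c' =>
      funext r
      rw [MonoidAlgebra.single_mul_single, rAct_single, rAct_single, rAct_single, mul_smul]
      ring

theorem rAct_one (w : RClass e → R) : rAct R e 1 w = w := by
  funext r
  rw [MonoidAlgebra.one_def, rAct_single, one_mul, one_smul]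

theorem rAct_map (B : Type*) [CommRing B] [Algebra R B] (z : R[MaxSubgroup e]) (w : RClass e → R) :
    rAct B e (algMap R B _ z) (algebraMap R B ∘ w) = algebraMap R B ∘ rAct R e z w := by
  induction z using MonoidAlgebra.induction_linear with
  | zero => funext; simp
  | add x y hx hy =>
    rw [map_add, map_add, map_add, LinearMap.add_apply, LinearMap.add_apply, hx, hy]
    funext
    simp
  | single g c =>
    funext r
    rw [algMap_single, rAct_single, Function.comp_apply, Function.comp_apply, rAct_single, map_mul]

theorem cornerEntry_mul (l : LClass e) (r : RClass e) :
    cornerEntry R e (r.1 * l.1) = algMap ℤ R _ (sandwichEntry l r) := by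
  have h : (e : M) * (r.1 * l.1) * e = r.1 * l.1 := by
    rw [← mul_assoc, r.idem_mul, mul_assoc, l.mul_idem]
  by_cases hg : ∃ g : MaxSubgroup e, g.toM = r.1 * l.1
  · obtain ⟨g, hg⟩ := hg
    rw [sandwichEntry_of_eq hg, cornerEntry_of_eq (hg.trans h.symm), algMap_single, map_one]
  · rw [sandwichEntry, dif_neg hg, cornerEntry, dif_neg (by rwa [h]), map_zero]

variable (R) in
/-- The linear combination of the elements `rl` of `R[G_e]` with coefficients `u l`. -/
def sandwichSum [Finite M] (u : LClass e → R) (r : RClass e) : R[MaxSubgroup e] :=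
  ∑ l, u l • algMap ℤ R _ (sandwichEntry l r)

variable [Finite M]

theorem sandwichLin_apply (u : LClass e → R) (r : RClass e) :
    sandwichLin R e u r = (sandwichSum R u r).coeff 1 := by
  simp [sandwichLin, sandwichSum, Matrix.mulVec, dotProduct, sandwichMatrix, MonoidAlgebra.coeff_sum,
    mul_comm]

theorem sandwichSum_smul (u : LClass e → R) (g : MaxSubgroup e) (r : RClass e) :
    sandwichSum R u (g • r) = MonoidAlgebra.single g 1 * sandwichSum R u r := by
  rw [sandwichSum, sandwichSum, Finset.mul_sum]
  refine Finset.sum_congr rfl fun l _ => ?_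
  rw [sandwichEntry_smul, map_mul, algMap_single, map_one, mul_smul_comm]

/-- `sandwichSum` is equivariant in `r`, so only coefficients at `1` need recording. Under this
encoding, right multiplication by `v` becomes `rAct`. -/
theorem rAct_sandwichLin (v : R[MaxSubgroup e]) (u : LClass e → R) (r : RClass e) :
    rAct R e v (sandwichLin R e u) r = (sandwichSum R u r * v).coeff 1 := by
  induction v using MonoidAlgebra.induction_linear with
  | zero => simp
  | add x y hx hy =>
    rw [map_add, LinearMap.add_apply, Pi.add_apply, hx, hy, mul_add]
    rfl
  | single g c =>
    rw [rAct_single, sandwichLin_apply, sandwichSum_smul]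
    simp [mul_comm]

/-- The dimension of a simple module with apex `e` is the rank of a sandwich matrix. -/
theorem dim_eq_finrank_range {K : Type*} [Field K] [IsSemisimpleRing K[MaxSubgroup e]]
    {V : Type*} [AddCommGroup V] [Module K[M] V] [IsSimpleModule K[M] V]
    (hV : ∀ a ∈ belowIdeal K e, ∀ v : V, a • v = 0) {v : K[MaxSubgroup e]}
    (hv : IsScalarIdempotent v) {x : V} (hx : x ≠ 0) (hvx : toAlg K e v • x = x) :
    dim K M V = Module.finrank K (LinearMap.range (rAct K e v ∘ₗ sandwichLin K e)) := by
  let _ : Module K V := Module.compHom V (algebraMap K K[M])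
  have : IsScalarTower K K[M] V := IsScalarTower.of_compHom K K[M] V
  have hex : MonoidAlgebra.single (e : M) (1 : K) • x = x := by
    rw [← hvx, smul_smul, idem_mul_toAlg]
  -- `V` is spanned by the vectors `l x` with `l ∈ L_e`, because the other `m e` act as zero. Its
  -- dimension is therefore read off from the kernel of `Θ`.
  let Θ : (LClass e → K) →ₗ[K] V :=
    Fintype.linearCombination K fun l : LClass e => MonoidAlgebra.single l.1 (1 : K) • x
  have hΘ : ∀ u, Θ u = ∑ l, u l • MonoidAlgebra.single l.1 (1 : K) • x := fun u => rfl
  have hsingle : ∀ (a : M) (c : K) (y : V), MonoidAlgebra.single a c • y =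
      c • MonoidAlgebra.single a (1 : K) • y := by
    intro a c y
    rw [← smul_assoc, MonoidAlgebra.smul_single, smul_eq_mul, mul_one]
  have hsurj : Function.Surjective Θ := by
    intro y
    obtain ⟨a, rfl⟩ := exists_smul_eq_of_isSimpleModule (A := K[M]) hx y
    rw [← LinearMap.mem_range]
    induction a using MonoidAlgebra.induction_linear with
    | zero => rw [zero_smul]; exact Submodule.zero_mem _
    | add a b ha hb => rw [add_smul]; exact Submodule.add_mem _ ha hb
    | single m c =>
      rw [hsingle]
      refine Submodule.smul_mem _ _ ?_
      rw [← hex, smul_smul, MonoidAlgebra.single_mul_single, one_mul]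
      by_cases h : JLe (e : M) (m * e)
      · obtain ⟨l, hl⟩ := exists_lClass_eq (e := e) (y := m * e)
          (by rw [mul_assoc, e.2.eq]) h
        classical
        refine ⟨Pi.single l 1, ?_⟩
        rw [← hl]
        simp [Θ, Fintype.linearCombination_apply, Pi.single_apply]
      · rw [hV _ (single_mem_belowIdeal h 1)]
        exact Submodule.zero_mem _
  have hr : ∀ u r, MonoidAlgebra.single (r : RClass e).1 (1 : K) • Θ u =
      toAlg K e (sandwichSum K u r) • x := by
    intro u r
    have h1 : ∀ l : LClass e, MonoidAlgebra.single r.1 (1 : K) • MonoidAlgebra.single l.1 (1 : K) •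
        x = toAlg K e (algMap ℤ K _ (sandwichEntry l r)) • x := by
      intro l
      rw [← cornerEntry_mul, ← one_smul K (cornerEntry K e _), ← cornerProj_single,
        ← corner_smul_eq hV, smul_smul, MonoidAlgebra.single_mul_single,
        MonoidAlgebra.single_mul_single, MonoidAlgebra.single_mul_single, ← mul_assoc (e : M),
        r.idem_mul, mul_assoc r.1, l.mul_idem]
      simp only [mul_one]
    rw [hΘ, Finset.smul_sum, sandwichSum, map_sum, Finset.sum_smul]
    refine Finset.sum_congr rfl fun l _ => ?_
    rw [toAlg_smul, smul_assoc, ← h1, smul_comm]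
  -- `K[G_e] v` acts faithfully on `x`: with `c v d c v = c v`, the scalar `a` in `v d c v = a v`
  -- must vanish because `c x = 0`.
  have hzero : ∀ c : K[MaxSubgroup e], toAlg K e c • x = 0 → c * v = 0 := by
    intro c hc
    obtain ⟨d, hd⟩ := exists_mul_mul_eq_self (c * v)
    obtain ⟨a, ha⟩ := hv.scalar (d * c)
    have h1 : a • x = 0 := by
      calc a • x = a • toAlg K e v • x := by rw [hvx]
        _ = toAlg K e (v * (d * c) * v) • x := by rw [ha, toAlg_smul, smul_assoc]
        _ = 0 := by rw [map_mul, mul_smul, hvx, map_mul, map_mul, mul_smul, mul_smul, hc, smul_zero,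
            smul_zero]
    have h2 : a = 0 := (smul_eq_zero.1 h1).resolve_right hx
    calc c * v = c * (v * (d * c) * v) := by rw [← hd]; simp only [mul_assoc]
      _ = 0 := by rw [ha, h2, zero_smul, mul_zero]
  have hker : LinearMap.ker Θ = LinearMap.ker (rAct K e v ∘ₗ sandwichLin K e) := by
    ext u
    rw [LinearMap.mem_ker, LinearMap.mem_ker, LinearMap.comp_apply]
    constructor
    · intro hu
      funext r
      rw [rAct_sandwichLin, hzero _ (by rw [← hr, hu, smul_zero])]
      rfl
    · intro hu
      have h1 : ∀ r, sandwichSum K u r * v = 0 := by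
        intro r
        ext g
        -- The coefficient at `g` for `r` is the coefficient at `1` for `g⁻¹ r`.
        have h2 := congrFun hu (g⁻¹ • r)
        rw [rAct_sandwichLin, sandwichSum_smul, mul_assoc] at h2
        simpa using h2
      by_contra hne
      -- A nonzero `Θ u` would generate `x = e x`; but each `e m` is in `R_e` or acts as zero, and
      -- `R_e` kills `Θ u`.
      obtain ⟨a, ha⟩ := exists_smul_eq_of_isSimpleModule (A := K[M]) hne x
      apply hx
      rw [← hex, ← ha]
      clear ha
      induction a using MonoidAlgebra.induction_linear with
      | zero => rw [zero_smul, smul_zero]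
      | add a b ha hb => rw [add_smul, smul_add, ha, hb, add_zero]
      | single m c =>
        rw [hsingle m c, smul_comm, smul_smul, MonoidAlgebra.single_mul_single, one_mul]
        by_cases h : JLe (e : M) (e * m)
        · obtain ⟨r, hr'⟩ := exists_rClass_eq (e := e) (y := e * m)
            (by rw [← mul_assoc, e.2.eq]) h
          rw [← hr', hr, ← hvx, smul_smul, ← map_mul, h1, map_zero, zero_smul, smul_zero]
        · rw [hV _ (single_mem_belowIdeal h 1), smul_zero]
  have h1 := LinearMap.finrank_range_add_finrank_ker Θ
  have h2 := LinearMap.finrank_range_add_finrank_ker (rAct K e v ∘ₗ sandwichLin K e)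
  rw [← hker, ← h1, LinearMap.range_eq_top.2 hsurj, finrank_top] at h2
  rw [dim, (restrictScalarsEquiv K M V).finrank_eq]
  omega

end Sandwich

/-! ### Purity of sandwich maps -/

section SandwichPurity

variable {M : Type u} [Monoid M] {e : Idem M}

/-- Either equation says that `x` is the inverse of `g` in `eMe`. -/
theorem mul_eq_idem_comm {x : M} (hx : (e : M) * x * e = x) (g : MaxSubgroup e) :
    g.toM * x = e ↔ x * g.toM = e := by
  have hl : (e : M) * x = x := by
    rw [← hx, ← mul_assoc, ← mul_assoc, e.2.eq]
  have hr : x * (e : M) = x := by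
    rw [← hx, mul_assoc, e.2.eq]
  have h1 : (g⁻¹).toM * g.toM = e := by
    rw [← MaxSubgroup.toM_mul, inv_mul_cancel, MaxSubgroup.toM_one]
  have h2 : g.toM * (g⁻¹).toM = e := by
    rw [← MaxSubgroup.toM_mul, mul_inv_cancel, MaxSubgroup.toM_one]
  constructor
  · intro h
    rw [← hl, ← h1, mul_assoc (g⁻¹).toM, h, MaxSubgroup.toM_mul_idem, h1]
  · intro h
    rw [← hr, ← h2, ← mul_assoc x, h, MaxSubgroup.idem_mul_toM, h2]

open Classical in
theorem sandwichMatrix_apply (r : RClass e) (l : LClass e) :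
    sandwichMatrix e r l = if r.1 * l.1 = e then 1 else 0 := by
  rw [sandwichMatrix, Matrix.of_apply]
  by_cases h : ∃ g : MaxSubgroup e, g.toM = r.1 * l.1
  · obtain ⟨g, hg⟩ := h
    rw [sandwichEntry_of_eq hg, ← hg, ← MaxSubgroup.toM_one, MonoidAlgebra.coeff_single,
      Finsupp.single_apply]
    simp only [MaxSubgroup.toM_injective.eq_iff]
  · rw [sandwichEntry, dif_neg h, if_neg]
    · rfl
    · exact fun h' => h ⟨1, h'.symm⟩

variable [Finite M] {R : Type*} [CommRing R]

theorem exists_lClass_mul (l : LClass e) (g : MaxSubgroup e) :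
    ∃ l' : LClass e, l'.1 = l.1 * g.toM := by
  refine exists_lClass_eq (by rw [mul_assoc, g.toM_mul_idem]) ?_
  have h : JLe (e : M) (l.1 * g.toM * (g⁻¹).toM) := by
    rw [mul_assoc, ← MaxSubgroup.toM_mul, mul_inv_cancel, MaxSubgroup.toM_one, l.mul_idem]
    exact l.jLe
  exact h.of_mul_right

/-- A group element `g` permutes the columns of the sandwich matrix: the column of `l` goes to that
of `l g`, because `g r l = e` if and only if `r l g = e`. -/
theorem rAct_mem_range (z : R[MaxSubgroup e]) {w : RClass e → R}
    (hw : w ∈ LinearMap.range (sandwichLin R e)) :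
    rAct R e z w ∈ LinearMap.range (sandwichLin R e) := by
  induction z using MonoidAlgebra.induction_linear with
  | zero => simp
  | add x y hx hy => rw [map_add, LinearMap.add_apply]; exact Submodule.add_mem _ hx hy
  | single g c =>
    rw [sandwichLin, Matrix.range_mulVecLin] at hw ⊢
    induction hw using Submodule.span_induction with
    | mem x hx =>
      obtain ⟨l, rfl⟩ := hx
      obtain ⟨l', hl'⟩ := exists_lClass_mul l g
      have : rAct R e (MonoidAlgebra.single g c)
          (((sandwichMatrix e).map (Int.cast : ℤ → R)).col l) =
          c • ((sandwichMatrix e).map (Int.cast : ℤ → R)).col l' := by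
        classical
        funext r
        rw [rAct_single, Pi.smul_apply, smul_eq_mul, Matrix.col_apply, Matrix.col_apply,
          Matrix.map_apply, Matrix.map_apply, sandwichMatrix_apply, sandwichMatrix_apply, hl',
          RClass.coe_smul, mul_assoc g.toM, ← mul_assoc r.1]
        have h : (e : M) * (r.1 * l.1) * e = r.1 * l.1 := by
          rw [← mul_assoc, r.idem_mul, mul_assoc, l.mul_idem]
        rw [if_congr (mul_eq_idem_comm h g) rfl rfl]
      rw [this]
      exact Submodule.smul_mem _ _ (Submodule.subset_span ⟨l', rfl⟩)
    | zero => rw [map_zero]; exact Submodule.zero_mem _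
    | add x y _ _ hx hy => rw [map_add]; exact Submodule.add_mem _ hx hy
    | smul a x _ hx => rw [map_smul]; exact Submodule.smul_mem _ _ hx

theorem sandwichLin_map (B : Type*) [CommRing B] [Algebra R B] (u : LClass e → R) :
    sandwichLin B e (algebraMap R B ∘ u) = algebraMap R B ∘ sandwichLin R e u := by
  funext r
  simp [sandwichLin, Matrix.mulVec, dotProduct]

theorem map_toMatrix_rAct_sandwichLin [DecidableEq (LClass e)] (B : Type*) [CommRing B]
    [Algebra R B] (v : R[MaxSubgroup e]) :
    ((LinearMap.toMatrix' (rAct R e v ∘ₗ sandwichLin R e)).map (algebraMap R B)).mulVecLin =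
      rAct B e (algMap R B _ v) ∘ₗ sandwichLin B e := by
  refine LinearMap.pi_ext' fun l => LinearMap.ext_ring ?_
  have h : (Pi.single l 1 : LClass e → B) = algebraMap R B ∘ (Pi.single l 1 : LClass e → R) := by
    funext l'
    simp [Pi.single_apply]
  rw [LinearMap.comp_apply, LinearMap.comp_apply, LinearMap.comp_apply, LinearMap.single_apply, h,
    sandwichLin_map, rAct_map]
  funext r
  rw [Matrix.mulVecLin_apply, ← RingHom.map_mulVec, LinearMap.toMatrix'_mulVec]
  rfl

/-- The submodule `N` is `π`-pure. -/
def IsPure {R V : Type*} [CommRing R] [AddCommGroup V] [Module R V] (π : R)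
    (N : Submodule R V) : Prop :=
  ∀ x, π • x ∈ N → x ∈ N

/-- The range is stable under `v`, so its `v`-part consists of its elements fixed by `v`; this
condition is insensitive to multiplication by `π`. -/
theorem isPure_rAct {π : R} (hπ : IsSMulRegular R π) (h : IsPure π (LinearMap.range (sandwichLin R e)))
    {v : R[MaxSubgroup e]} (hv : IsIdempotentElem v) :
    IsPure π (LinearMap.range (rAct R e v ∘ₗ sandwichLin R e)) := by
  rintro w ⟨u, hu⟩
  rw [LinearMap.comp_apply] at hu
  have h1 : rAct R e v w = w := by
    have : π • rAct R e v w = π • w := by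
      rw [← map_smul, ← hu, ← rAct_mul, hv.eq]
    funext r
    exact hπ (congrFun this r)
  have h2 : w ∈ LinearMap.range (sandwichLin R e) :=
    h w (hu ▸ rAct_mem_range v ⟨u, rfl⟩)
  obtain ⟨u', hu'⟩ := h2
  exact ⟨u', by rw [LinearMap.comp_apply, hu', h1]⟩

end SandwichPurity

/-! ### The cokernel of the sandwich map and the sandwich matrix -/

section Coker

variable {M : Type u} [Monoid M] {e : Idem M}

/-- The basis element `r` of `ℤR_e`. -/
def zrBasis (r : RClass e) : ZR e :=
  (Representation.asModuleEquiv (Representation.ofMulAction ℤ (MaxSubgroup e) (RClass e))).symm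
    (MonoidAlgebra.single r 1)

theorem single_smul_zrBasis (g : MaxSubgroup e) (r : RClass e) :
    (MonoidAlgebra.single g (1 : ℤ)) • zrBasis r = zrBasis (g • r) := by
  rw [Representation.single_smul, one_smul, zrBasis, LinearEquiv.apply_symm_apply,
    Representation.ofMulAction_single]
  rfl

theorem zrDual_ext {α β : ZRDual e} (h : ∀ r, α (zrBasis r) = β (zrBasis r)) : α = β := by
  refine LinearMap.ext fun x => ?_
  obtain ⟨x, rfl⟩ := (Representation.asModuleEquiv _).symm.surjective x
  induction x using MonoidAlgebra.induction_linear with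
  | zero => simp only [map_zero]
  | add x y hx hy => rw [map_add, map_add, map_add, hx, hy]
  | single r n =>
    have h1 : (MonoidAlgebra.single r n : ℤ[RClass e]) = n • MonoidAlgebra.single r 1 := by
      rw [MonoidAlgebra.smul_single, smul_eq_mul, mul_one]
    rw [h1, map_zsmul, map_zsmul, map_zsmul]
    exact congrArg (n • ·) (h r)

/-- The `ℤG_e`-linear map `ℤR_e → ℤG_e` with prescribed values on `R_e`. -/
def zrDualMk (f : RClass e → ℤ[MaxSubgroup e])
    (hf : ∀ g r, f (g • r) = MonoidAlgebra.single g 1 * f r) : ZRDual e :=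
  MonoidAlgebra.equivariantOfLinearOfComm
    (Finsupp.linearCombination ℤ f ∘ₗ
      (MonoidAlgebra.coeffLinearEquiv ℤ).toLinearMap ∘ₗ
      (Representation.asModuleEquiv _).toLinearMap) (fun g v => by
    obtain ⟨x, rfl⟩ := (Representation.asModuleEquiv _).symm.surjective v
    rw [Representation.single_smul, one_smul, LinearEquiv.apply_symm_apply]
    simp only [LinearMap.comp_apply, LinearEquiv.coe_coe, LinearEquiv.apply_symm_apply]
    change Finsupp.linearCombination ℤ f (MonoidAlgebra.coeffLinearEquiv ℤ
      (Representation.ofMulAction ℤ (MaxSubgroup e) (RClass e) g x)) = _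
    induction x using MonoidAlgebra.induction_linear with
    | zero => simp
    | add x y hx hy => simp only [map_add, hx, hy, smul_add]
    | single r n =>
      rw [Representation.ofMulAction_single]
      simp [hf, Int.cast_comm, mul_assoc])

theorem zrDualMk_zrBasis (f : RClass e → ℤ[MaxSubgroup e])
    (hf : ∀ g r, f (g • r) = MonoidAlgebra.single g 1 * f r) (r : RClass e) :
    zrDualMk f hf (zrBasis r) = f r := by
  change Finsupp.linearCombination ℤ f (MonoidAlgebra.coeffLinearEquiv ℤ
    (MonoidAlgebra.single r 1)) = f r
  simp

theorem sandwichFunctional_zrBasis (l : LClass e) (r : RClass e) :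
    sandwichFunctional l (zrBasis r) = sandwichEntry l r := by
  change Finsupp.linearCombination ℤ (sandwichEntry l) (MonoidAlgebra.coeffLinearEquiv ℤ
    (MonoidAlgebra.single r 1)) = sandwichEntry l r
  simp

/-- Functionals on `ℤR_e` as functions on `R_e`. -/
def zrDualCoeff (e : Idem M) : ZRDual e →+ (RClass e → ℤ) where
  toFun α r := (α (zrBasis r)).coeff 1
  map_zero' := by funext; simp
  map_add' α β := by funext; simp

theorem zrDualCoeff_injective : Function.Injective (zrDualCoeff e) := by
  intro α β h
  refine zrDual_ext fun r => ?_
  ext g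
  have h1 := congrFun h (g⁻¹ • r)
  change (α (zrBasis (g⁻¹ • r))).coeff 1 = (β (zrBasis (g⁻¹ • r))).coeff 1 at h1
  rw [← single_smul_zrBasis, map_smul, map_smul, smul_eq_mul, smul_eq_mul] at h1
  simpa using h1

theorem zrDualCoeff_surjective [Finite M] : Function.Surjective (zrDualCoeff e) := by
  intro w
  have := Fintype.ofFinite (MaxSubgroup e)
  -- The functional `r ↦ ∑ w(h r) h⁻¹` is equivariant, and its coefficient at `1` comes from `h =
  -- 1`.
  refine ⟨zrDualMk (fun r => ∑ h : MaxSubgroup e, MonoidAlgebra.single h⁻¹ (w (h • r))) ?_, ?_⟩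
  · intro g r
    rw [Finset.mul_sum, ← Equiv.sum_comp (Equiv.mulRight g⁻¹)]
    refine Finset.sum_congr rfl fun h _ => ?_
    rw [MonoidAlgebra.single_mul_single, one_mul, Equiv.coe_mulRight, smul_smul,
      inv_mul_cancel_right, mul_inv_rev, inv_inv]
  · funext r
    change (zrDualMk _ _ (zrBasis r)).coeff 1 = w r
    rw [zrDualMk_zrBasis, MonoidAlgebra.coeff_sum, Finsupp.finsetSum_apply,
      Finset.sum_eq_single 1]
    · simp
    · intro h _ hne
      rw [MonoidAlgebra.coeff_single, Finsupp.single_eq_of_ne]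
      simpa using hne
    · simp

theorem zrDualCoeff_mem_range_iff [Finite M] (α : ZRDual e) :
    zrDualCoeff e α ∈ LinearMap.range (sandwichLin ℤ e) ↔ α ∈ (sandwichMap e).range := by
  have key : ∀ x : ℤ[LClass e], zrDualCoeff e (sandwichMap e x) = sandwichLin ℤ e (x.coeff) := by
    intro x
    induction x using MonoidAlgebra.induction_linear with
    | zero => simp only [map_zero]; exact (map_zero _).symm
    | add x y hx hy =>
      rw [map_add, map_add, hx, hy, ← map_add]
      rfl
    | single l c =>
      have h1 : (MonoidAlgebra.single l c : ℤ[LClass e]) = c • MonoidAlgebra.single l 1 := by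
        rw [MonoidAlgebra.smul_single, smul_eq_mul, mul_one]
      have h2 : sandwichMap e (MonoidAlgebra.single l 1) = sandwichFunctional l := by
        simp [sandwichMap]
      rw [h1, map_zsmul, map_zsmul, h2, MonoidAlgebra.coeff_smul, Finsupp.coe_smul, map_smul]
      congr 1
      funext r
      change (sandwichFunctional l (zrBasis r)).coeff 1 = _
      rw [sandwichFunctional_zrBasis]
      classical
      simp [sandwichLin, sandwichMatrix, Matrix.mulVec, dotProduct, Finsupp.single_apply]
  constructor
  · rintro ⟨u, hu⟩
    refine ⟨MonoidAlgebra.ofCoeff (Finsupp.equivFunOnFinite.symm u), zrDualCoeff_injective ?_⟩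
    rw [key, ← hu]
    rfl
  · rintro ⟨x, rfl⟩
    exact ⟨_, (key x).symm⟩

/-- A prime divides the order of the torsion subgroup of the cokernel of `φ_e` if and only if the
image of the sandwich matrix is not pure at this prime. -/
theorem dvd_card_torsion_iff [Finite M] {p : ℕ} (hp : p.Prime) :
    p ∣ Nat.card (AddCommGroup.torsion (SandwichCoker e)) ↔
      ¬ IsPure (p : ℤ) (LinearMap.range (sandwichLin ℤ e)) := by
  have := Fact.mk hp
  -- Finiteness matters: `Nat.card` of an infinite type is `0`, which `p` would divide. It holds
  -- because the dual embeds in the finitely generated group of functions on `R_e`.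
  have hfin : Finite (AddCommGroup.torsion (SandwichCoker e)) := by
    have : Module.Finite ℤ (ZRDual e) :=
      Module.Finite.of_injective (zrDualCoeff e).toIntLinearMap zrDualCoeff_injective
    have : Module.Finite ℤ (SandwichCoker e) :=
      Module.Finite.of_surjective (QuotientAddGroup.mk' (sandwichMap e).range).toIntLinearMap
        (QuotientAddGroup.mk'_surjective _)
    have : Module.Finite ℤ (AddCommGroup.torsion (SandwichCoker e)) :=
      Module.Finite.of_injective (AddCommGroup.torsion (SandwichCoker e)).subtype.toIntLinearMap
        Subtype.val_injective
    have : AddGroup.FG (AddCommGroup.torsion (SandwichCoker e)) :=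
      Module.Finite.iff_addGroup_fg.1 this
    refine AddCommGroup.finite_of_fg_isAddTorsion _ ?_
    rintro ⟨x, hx⟩
    obtain ⟨n, hn, h⟩ := isOfFinAddOrder_iff_nsmul_eq_zero.1 hx
    exact isOfFinAddOrder_iff_nsmul_eq_zero.2 ⟨n, hn, Subtype.ext h⟩
  constructor
  · intro h hpure
    obtain ⟨⟨x, hx⟩, hxp⟩ := exists_prime_addOrderOf_dvd_card' p h
    obtain ⟨α, rfl⟩ := QuotientAddGroup.mk_surjective x
    have h1 : p • (QuotientAddGroup.mk α : SandwichCoker e) = 0 := by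
      have := addOrderOf_nsmul_eq_zero (⟨_, hx⟩ : AddCommGroup.torsion (SandwichCoker e))
      rw [hxp] at this
      exact congrArg Subtype.val this
    rw [← QuotientAddGroup.mk_nsmul, QuotientAddGroup.eq_zero_iff, ← zrDualCoeff_mem_range_iff,
      map_nsmul, ← natCast_zsmul] at h1
    have h2 := (zrDualCoeff_mem_range_iff α).1 (hpure _ h1)
    have h3 : (⟨_, hx⟩ : AddCommGroup.torsion (SandwichCoker e)) = 0 :=
      Subtype.ext ((QuotientAddGroup.eq_zero_iff _).2 h2)
    rw [h3, addOrderOf_zero] at hxp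
    exact hp.one_lt.ne hxp
  · intro h
    rw [IsPure] at h
    push Not at h
    obtain ⟨w, hw, hw'⟩ := h
    obtain ⟨α, rfl⟩ := zrDualCoeff_surjective w
    rw [natCast_zsmul, ← map_nsmul, zrDualCoeff_mem_range_iff, ← QuotientAddGroup.eq_zero_iff,
      QuotientAddGroup.mk_nsmul] at hw
    rw [zrDualCoeff_mem_range_iff, ← QuotientAddGroup.eq_zero_iff] at hw'
    have hmem : (QuotientAddGroup.mk α : SandwichCoker e) ∈
        AddCommGroup.torsion (SandwichCoker e) :=
      isOfFinAddOrder_iff_nsmul_eq_zero.2 ⟨p, hp.pos, hw⟩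
    have h1 : addOrderOf (⟨_, hmem⟩ : AddCommGroup.torsion (SandwichCoker e)) = p :=
      addOrderOf_eq_prime (Subtype.ext hw) fun h => hw' (congrArg Subtype.val h)
    rw [← h1]
    exact addOrderOf_dvd_natCard _

end Coker

/-! ### Purity over discrete valuation rings -/

section PurityDVR

variable {𝒪 M : Type u} [CommRing 𝒪] [IsDomain 𝒪] [IsDiscreteValuationRing 𝒪] [Monoid M] [Finite M]
  {e : Idem M}

local notation "𝕜" => IsLocalRing.ResidueField 𝒪

theorem ker_algebraMap_residueField {π : 𝒪} (hπ : Irreducible π) :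
    RingHom.ker (algebraMap 𝒪 𝕜) = Ideal.span {π} := by
  rw [← hπ.maximalIdeal_eq]
  exact IsLocalRing.ker_residue

theorem finrank_range_eq_iff_isPure {π : 𝒪} (hπ : Irreducible π) (F : Type*) [Field F]
    [Algebra 𝒪 F] [FaithfulSMul 𝒪 F] (v : 𝒪[MaxSubgroup e]) :
    Module.finrank F (LinearMap.range (rAct F e (algMap 𝒪 F _ v) ∘ₗ sandwichLin F e)) =
      Module.finrank 𝕜 (LinearMap.range (rAct 𝕜 e (algMap 𝒪 𝕜 _ v) ∘ₗ sandwichLin 𝕜 e)) ↔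
    IsPure π (LinearMap.range (rAct 𝒪 e v ∘ₗ sandwichLin 𝒪 e)) := by
  classical
  have h := rank_map_eq_rank_map_iff (F := F) hπ.ne_zero (ker_algebraMap_residueField hπ)
    (LinearMap.toMatrix' (rAct 𝒪 e v ∘ₗ sandwichLin 𝒪 e))
  rw [Matrix.rank, Matrix.rank, map_toMatrix_rAct_sandwichLin, map_toMatrix_rAct_sandwichLin,
    ← Matrix.toLin'_apply', Matrix.toLin'_toMatrix'] at h
  exact h

theorem map_ringHom_eq_intCast {m n B : Type*} [Ring B] (A : Matrix m n ℤ) (f : ℤ →+* B) :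
    A.map f = A.map (Int.cast : ℤ → B) := by
  ext
  simp

theorem map_ringHom_comp_intCast {m n R B : Type*} [Ring R] [Ring B] (A : Matrix m n ℤ)
    (f : R →+* B) : (A.map (Int.cast : ℤ → R)).map f = A.map (Int.cast : ℤ → B) := by
  ext
  simp

/-- Both purities say that one integer matrix has the same rank over `F` and over `k`. -/
theorem isPure_int_iff {π : 𝒪} (hπ : Irreducible π) {p : ℕ} (hp : p.Prime) [CharP 𝕜 p]
    (F : Type*) [Field F] [CharZero F] [Algebra 𝒪 F] [FaithfulSMul 𝒪 F] :
    IsPure (p : ℤ) (LinearMap.range (sandwichLin ℤ e)) ↔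
      IsPure π (LinearMap.range (sandwichLin 𝒪 e)) := by
  have h1 := rank_map_eq_rank_map_iff (F := F) hπ.ne_zero (ker_algebraMap_residueField hπ)
    ((sandwichMatrix e).map (Int.cast : ℤ → 𝒪))
  have h2 := rank_map_eq_rank_map_iff (F := F) (π := (p : ℤ)) (by exact_mod_cast hp.ne_zero)
    (CharP.ker_intAlgebraMap_eq_span (R := 𝕜) p) (sandwichMatrix e)
  have hint : sandwichLin ℤ e = (sandwichMatrix e).mulVecLin := by
    rw [sandwichLin]
    congr 1
  rw [map_ringHom_comp_intCast, map_ringHom_comp_intCast] at h1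
  rw [map_ringHom_eq_intCast, map_ringHom_eq_intCast, h1] at h2
  rw [IsPure, IsPure, hint]
  exact h2.symm

variable [IsAdicComplete (IsLocalRing.maximalIdeal 𝒪) 𝒪]

theorem isPure_of_forall_isPrimitiveLift (hk : IsSplittingField 𝕜 M)
    [IsSemisimpleRing 𝕜[MaxSubgroup e]] {π : 𝒪} (hπ : Irreducible π)
    (h : ∀ v : 𝒪[MaxSubgroup e], IsPrimitiveLift v →
      IsPure π (LinearMap.range (rAct 𝒪 e v ∘ₗ sandwichLin 𝒪 e))) :
    IsPure π (LinearMap.range (sandwichLin 𝒪 e)) := by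
  rintro w ⟨u, hu⟩
  let N := LinearMap.range (sandwichLin 𝒪 e)
  -- The classes having a lift that moves `w` into `N` form a right ideal; purity of the `v`-parts
  -- puts the reductions of all primitive lifts in it.
  let J : Ideal 𝕜[MaxSubgroup e]ᵐᵒᵖ :=
    { carrier := {x | ∃ z : 𝒪[MaxSubgroup e], algMap 𝒪 𝕜 _ z = x.unop ∧ rAct 𝒪 e z w ∈ N}
      zero_mem' := ⟨0, by simp, by rw [map_zero]; exact N.zero_mem⟩
      add_mem' := by
        rintro x y ⟨z, hz, hz'⟩ ⟨t, ht, ht'⟩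
        exact ⟨z + t, by rw [map_add, hz, ht]; rfl, by rw [map_add]; exact N.add_mem hz' ht'⟩
      smul_mem' := by
        rintro c x ⟨z, hz, hz'⟩
        obtain ⟨c', hc'⟩ := algMap_residue_surjective 𝒪 _ c.unop
        exact ⟨z * c', by rw [map_mul, hz, hc']; rfl, by rw [rAct_mul]; exact rAct_mem_range _ hz'⟩ }
  have hJ : J = ⊤ := by
    by_contra hne
    obtain ⟨v, hv, hvJ⟩ := exists_isPrimitiveLift_op_notMem hk hne
    apply hvJ
    refine ⟨v, rfl, ?_⟩
    have h1 := h v hv (rAct 𝒪 e v w) ⟨u, by rw [LinearMap.comp_apply, hu, map_smul]⟩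
    obtain ⟨u', hu'⟩ := h1
    rw [← hu', LinearMap.comp_apply]
    exact rAct_mem_range _ ⟨u', rfl⟩
  obtain ⟨z, hz, hzN⟩ : (1 : 𝕜[MaxSubgroup e]ᵐᵒᵖ) ∈ J := hJ ▸ Submodule.mem_top
  obtain ⟨y, hy⟩ := exists_eq_smul_of_algMap_eq_zero (x := 1 - z) hπ (by
    rw [map_sub, hz, map_one, MulOpposite.unop_one, sub_self])
  -- Since `1 = z + π y`, purity follows from `w z ∈ N` and `π w ∈ N`.
  have h1 : w = rAct 𝒪 e z w + rAct 𝒪 e y (π • w) := by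
    rw [map_smul, ← LinearMap.smul_apply, ← map_smul, ← LinearMap.add_apply, ← map_add, ← hy,
      add_sub_cancel, rAct_one]
  rw [h1]
  exact N.add_mem hzN (rAct_mem_range _ ⟨u, hu⟩)

end PurityDVR

/-! ### Parametrization of simple modules by primitive idempotents of maximal subgroups -/

section Representatives

variable {M : Type u} [Monoid M]

/-- The `𝒥`-equivalence of idempotents. -/
def jSetoid (M : Type u) [Monoid M] : Setoid (Idem M) where
  r e f := JLe (e : M) f ∧ JLe (f : M) e
  iseqv := ⟨fun _ => ⟨JLe.refl _, JLe.refl _⟩, fun h => ⟨h.2, h.1⟩,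
    fun h h' => ⟨h.1.trans h'.1, h'.2.trans h.2⟩⟩

/-- A representative of the `𝒥`-class of an idempotent. -/
def jRep (e : Idem M) : Idem M := (Quotient.mk (jSetoid M) e).out

theorem jRep_spec (e : Idem M) : JLe (jRep e : M) e ∧ JLe (e : M) (jRep e) :=
  Quotient.exact (Quotient.out_eq (Quotient.mk (jSetoid M) e))

theorem jRep_eq {e f : Idem M} (h : JLe (e : M) f) (h' : JLe (f : M) e) : jRep e = jRep f :=
  congrArg Quotient.out (Quotient.sound (s := jSetoid M) ⟨h, h'⟩)

theorem jRep_jRep (e : Idem M) : jRep (jRep e) = jRep e :=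
  jRep_eq (jRep_spec e).1 (jRep_spec e).2

theorem belowIdeal_smul_eq_zero_of_jLe {K : Type*} [CommRing K] {V : Type*} [AddCommGroup V]
    [Module K[M] V] {e f : Idem M} (h : JLe (f : M) e)
    (hV : ∀ a ∈ belowIdeal K e, ∀ v : V, a • v = 0) (a : K[M]) (ha : a ∈ belowIdeal K f) (v : V) :
    a • v = 0 :=
  belowIdeal_smul_eq_zero (fun _ hm =>
    hV _ (single_mem_belowIdeal (fun h' => hm (h.trans h')) 1)) a ha v

theorem single_smul_ne_zero_of_jLe {K : Type*} [CommRing K] {V : Type*} [AddCommGroup V]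
    [Module K[M] V] {m n : M} (h : JLe m n) {v : V} (hv : MonoidAlgebra.single m (1 : K) • v ≠ 0) :
    ∃ w : V, MonoidAlgebra.single n (1 : K) • w ≠ 0 := by
  obtain ⟨a, b, rfl⟩ := h
  refine ⟨MonoidAlgebra.single b (1 : K) • v, fun h0 => hv ?_⟩
  rw [← one_mul (1 : K), ← MonoidAlgebra.single_mul_single, mul_smul,
    ← one_mul (1 : K), ← MonoidAlgebra.single_mul_single, mul_smul, one_mul, h0, smul_zero]

/-- Every simple module has an apex among the representatives of the `𝒥`-classes. -/
theorem exists_apex_jRep [Finite M] {K : Type*} [CommRing K] (V : Type*) [AddCommGroup V]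
    [Module K[M] V] [IsSimpleModule K[M] V] : ∃ e : Idem M, jRep e = e ∧
      (∃ v : V, MonoidAlgebra.single (e : M) (1 : K) • v ≠ 0) ∧
      ∀ a ∈ belowIdeal K e, ∀ v : V, a • v = 0 := by
  obtain ⟨e, ⟨v, hv⟩, h⟩ := exists_apex (M := M) (K := K) V
  exact ⟨jRep e, jRep_jRep e, single_smul_ne_zero_of_jLe (jRep_spec e).2 hv,
    belowIdeal_smul_eq_zero_of_jLe (jRep_spec e).1 h⟩

end Representatives

/-! ### Labels of simple modules -/

section Labels

variable {M : Type u} [Monoid M] {K : Type u} [Field K]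

/-- The module `V` is annihilated by the elements of `M` not above `e`, but not by `v`. -/
structure HasLabel (V : Type*) [AddCommGroup V] [Module K[M] V] (e : Idem M)
    (v : K[MaxSubgroup e]) : Prop where
  kill : ∀ a ∈ belowIdeal K e, ∀ x : V, a • x = 0
  ne : ∃ x : V, toAlg K e v • x ≠ 0

variable {e : Idem M} {v : K[MaxSubgroup e]}

section

variable {V W : Type*} [AddCommGroup V] [Module K[M] V] [AddCommGroup W] [Module K[M] W]

theorem HasLabel.exists_eq (h : HasLabel V e v) (hv : IsIdempotentElem v) :
    ∃ x : V, x ≠ 0 ∧ toAlg K e v • x = x := by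
  obtain ⟨x, hx⟩ := h.ne
  exact ⟨_, hx, by rw [smul_smul, ← map_mul, hv.eq]⟩

theorem HasLabel.congr (h : HasLabel V e v) (φ : V ≃ₗ[K[M]] W) : HasLabel W e v where
  kill a ha x := by rw [← φ.apply_symm_apply x, ← map_smul, h.kill a ha, map_zero]
  ne := by
    obtain ⟨x, hx⟩ := h.ne
    exact ⟨φ x, by rwa [← map_smul, ne_eq, LinearEquiv.map_eq_zero_iff]⟩

theorem jLe_of_smul_ne_zero (hV : ∀ a ∈ belowIdeal K e, ∀ x : V, a • x = 0) {f : Idem M}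
    {z : K[MaxSubgroup f]} {x : V} (hx : toAlg K f z • x ≠ 0) : JLe (e : M) f := by
  by_contra h
  apply hx
  rw [← idem_mul_toAlg, mul_smul, hV _ (single_mem_belowIdeal h 1)]

variable [Finite M] [IsSimpleModule K[M] V] [IsSimpleModule K[M] W]

theorem HasLabel.nonempty_equiv (h : HasLabel V e v) (h' : HasLabel W e v)
    (hv : IsScalarIdempotent v) : Nonempty (V ≃ₗ[K[M]] W) := by
  obtain ⟨x, hx, hvx⟩ := h.exists_eq hv.idem
  obtain ⟨x', hx', hvx'⟩ := h'.exists_eq hv.idem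
  obtain ⟨φ, -⟩ := exists_linearEquiv_of_primitive (belowIdeal K e) (primitive_toAlg hv.scalar)
    h.kill h'.kill hx hx' hvx hvx'
  exact ⟨φ⟩

theorem HasLabel.imageDim_eq_one (h : HasLabel V e v) (hv : IsScalarIdempotent v) :
    imageDim K (toAlg K e v) V = 1 := by
  obtain ⟨x, hx, hvx⟩ := h.exists_eq hv.idem
  exact MonoidRep.imageDim_eq_one K (isIdempotentElem_toAlg hv.idem) hx hvx fun y hy =>
    exists_smul_eq_of_primitive (belowIdeal K e) (primitive_toAlg hv.scalar) h.kill hx hvx hy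

end

/-- Every primitive idempotent of `K[G_e]` is a label, since its image in `K[M]` is an idempotent
outside `belowIdeal`. -/
theorem SimpleSystem.exists_hasLabel {ι : Type*} (S : SimpleSystem K[M] ι)
    (hv : IsScalarIdempotent v) : ∃ i, HasLabel (S.mod i) e v := by
  obtain ⟨V, hV, hkill, x, hx, hvx⟩ := exists_simple_of_idempotent (belowIdeal K e)
    (isIdempotentElem_toAlg hv.idem) (toAlg_notMem_belowIdeal hv.ne_zero)
  obtain ⟨i, ⟨φ⟩⟩ := S.complete V hV
  exact ⟨i, HasLabel.congr ⟨hkill, x, by rwa [hvx]⟩ φ⟩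

end Labels

/-! ### The bijection between simple modules over `k[M]` and `F[M]` -/

section Correspondence

variable {𝒪 F M : Type u} [CommRing 𝒪] [IsDomain 𝒪] [IsDiscreteValuationRing 𝒪] [Field F]
  [Algebra 𝒪 F] [IsFractionRing 𝒪 F] [Monoid M]

local notation "𝕜" => IsLocalRing.ResidueField 𝒪

/-- A representative idempotent `e` with an idempotent of `𝒪[G_e]` lifting a primitive idempotent
of `k[G_e]`. -/
structure Label (𝒪 M : Type u) [CommRing 𝒪] [IsDomain 𝒪] [IsDiscreteValuationRing 𝒪]
    [Monoid M] where
  e : Idem M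
  jRep_eq : jRep e = e
  v : 𝒪[MaxSubgroup e]
  isPrimitiveLift : IsPrimitiveLift v

/-- `V` has label `x`. -/
abbrev Label.Of (K : Type u) [Field K] [Algebra 𝒪 K] (x : Label 𝒪 M) (V : Type*) [AddCommGroup V]
    [Module K[M] V] : Prop :=
  HasLabel V x.e (algMap 𝒪 K _ x.v)

theorem Label.e_eq {x y : Label 𝒪 M} (h : JLe (x.e : M) y.e) (h' : JLe (y.e : M) x.e) :
    x.e = y.e := by
  rw [← x.jRep_eq, ← y.jRep_eq, MonoidRep.jRep_eq h h']

theorem Label.e_eq_of {x y : Label 𝒪 M} {K : Type u} [Field K] [Algebra 𝒪 K] {V : Type*}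
    [AddCommGroup V] [Module K[M] V] (hx : x.Of K V) (hy : y.Of K V) : x.e = y.e := by
  obtain ⟨w, hw⟩ := hx.ne
  obtain ⟨w', hw'⟩ := hy.ne
  exact Label.e_eq (jLe_of_smul_ne_zero hx.kill hw') (jLe_of_smul_ne_zero hy.kill hw)

variable [Finite M]

/-- Two labels of one simple `k[M]`-module have isomorphic idempotents; the isomorphism transfers to
`F`, where the labels are again interchangeable. The converse transfer is the next result. -/
theorem Label.of_residue {x y : Label 𝒪 M} [IsSemisimpleRing F[MaxSubgroup y.e]] {V W : Type*}
    [AddCommGroup V] [Module 𝕜[M] V] [IsSimpleModule 𝕜[M] V] [AddCommGroup W] [Module F[M] W]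
    (hx : x.Of 𝕜 V) (hy : y.Of 𝕜 V) (hW : x.Of F W) : y.Of F W := by
  have he := Label.e_eq_of hx hy
  obtain ⟨e, h, v, hv⟩ := x
  obtain ⟨e', h', v', hv'⟩ := y
  obtain rfl : e = e' := he
  obtain ⟨a, ha⟩ := hx.ne
  obtain ⟨b, hb⟩ := hy.ne
  obtain ⟨z, hz⟩ := (exists_mul_mul_ne_zero_iff hv' hv F).1
    (exists_mul_mul_ne_zero hx.kill hv'.residue.idem hb ha)
  obtain ⟨c, hc⟩ := hW.ne
  exact ⟨hW.kill, toAlg_smul_ne_zero_of_mul_mul_ne_zero (hv'.fraction F) (hv.fraction F) hz hc⟩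

theorem Label.of_fraction {x y : Label 𝒪 M} [IsSemisimpleRing 𝕜[MaxSubgroup y.e]] {V W : Type*}
    [AddCommGroup V] [Module F[M] V] [IsSimpleModule F[M] V] [AddCommGroup W] [Module 𝕜[M] W]
    (he : x.e = y.e) (hx : x.Of F V) {b : V} (hb : toAlg F y.e (algMap 𝒪 F _ y.v) • b ≠ 0)
    (hW : x.Of 𝕜 W) : y.Of 𝕜 W := by
  obtain ⟨e, h, v, hv⟩ := x
  obtain ⟨e', h', v', hv'⟩ := y
  obtain rfl : e = e' := he
  obtain ⟨a, ha⟩ := hx.ne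
  obtain ⟨z, hz⟩ := (exists_mul_mul_ne_zero_iff hv' hv F).2
    (exists_mul_mul_ne_zero hx.kill (hv'.fraction F).idem hb ha)
  obtain ⟨c, hc⟩ := hW.ne
  exact ⟨hW.kill, toAlg_smul_ne_zero_of_mul_mul_ne_zero hv'.residue hv.residue hz hc⟩

theorem exists_isPrimitiveLift_smul_ne_zero [IsAdicComplete (IsLocalRing.maximalIdeal 𝒪) 𝒪]
    (hk : IsSplittingField 𝕜 M) {e : Idem M} [IsSemisimpleRing 𝕜[MaxSubgroup e]] {V : Type*}
    [AddCommGroup V] [Module 𝕜[M] V] {x : V} (hx : MonoidAlgebra.single (e : M) (1 : 𝕜) • x ≠ 0) :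
    ∃ v : 𝒪[MaxSubgroup e], IsPrimitiveLift v ∧
      ∃ y : V, toAlg 𝕜 e (algMap 𝒪 𝕜 _ v) • y ≠ 0 := by
  let J : Ideal 𝕜[MaxSubgroup e] :=
    { carrier := {z | toAlg 𝕜 e z • x = 0}
      zero_mem' := by simp
      add_mem' := by
        intro a b ha hb
        rw [Set.mem_ofPred_eq] at ha hb ⊢
        rw [map_add, add_smul, ha, hb, add_zero]
      smul_mem' := by
        intro c a ha
        rw [Set.mem_ofPred_eq] at ha ⊢
        rw [smul_eq_mul, map_mul, mul_smul, ha, smul_zero] }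
  obtain ⟨v, hv, hvJ⟩ := exists_isPrimitiveLift_notMem (𝒪 := 𝒪) hk (J := J) (by
    rw [Ideal.ne_top_iff_one]
    intro h
    exact hx (by rw [← toAlg_one]; exact h))
  exact ⟨v, hv, x, hvJ⟩

theorem smul_simple_ne_zero_iff {ι : Type v} (S : SimpleSystem F[M] ι) (i : ι)
    {f : 𝒪[M]} (hf : IsIdempotentElem f) :
    (∃ x : S.mod i, algMap 𝒪 F M f • x ≠ 0) ↔
      ∃ x : ExtendScalars 𝒪 𝕜 M (simpleForm 𝒪 S i), algMap 𝒪 𝕜 M f • x ≠ 0 := by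
  have := S.finite i
  have := finite_extendScalars_simpleForm (𝒪 := 𝒪) S i
  rw [← imageDim_pos_iff F, ← imageDim_pos_iff (V := ExtendScalars 𝒪 𝕜 M (simpleForm 𝒪 S i)) 𝕜,
    imageDim_simple_eq_reduction S i hf]

variable [IsAdicComplete (IsLocalRing.maximalIdeal 𝒪) 𝒪] {ι : Type v} {κ : Type w}
  (S : SimpleSystem F[M] ι)

theorem exists_label_residue (hk : IsSplittingField 𝕜 M)
    (hss : ∀ e : Idem M, IsSemisimpleRing 𝕜[MaxSubgroup e]) (V : Type*) [AddCommGroup V]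
    [Module 𝕜[M] V] [IsSimpleModule 𝕜[M] V] : ∃ x : Label 𝒪 M, x.Of 𝕜 V := by
  obtain ⟨e, he, ⟨x, hx⟩, hkill⟩ := exists_apex_jRep (M := M) (K := 𝕜) V
  obtain ⟨v, hv, hv'⟩ := exists_isPrimitiveLift_smul_ne_zero (𝒪 := 𝒪) hk hx
  exact ⟨⟨e, he, v, hv⟩, hkill, hv'⟩

/-- Labels must come from primitive idempotents over `k`, so one is found on the reduction of a form
of `S i` and then carried back to `S i` by comparing dimensions. -/
theorem exists_label_fraction (hk : IsSplittingField 𝕜 M)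
    (hss : ∀ e : Idem M, IsSemisimpleRing 𝕜[MaxSubgroup e]) (i : ι) :
    ∃ x : Label 𝒪 M, x.Of F (S.mod i) := by
  have := S.simple i
  obtain ⟨e, he, ⟨x, hx⟩, hkill⟩ := exists_apex_jRep (M := M) (K := F) (S.mod i)
  have hidem : IsIdempotentElem (MonoidAlgebra.single (e : M) (1 : 𝒪)) := by
    rw [IsIdempotentElem, MonoidAlgebra.single_mul_single, e.2.eq, one_mul]
  obtain ⟨y, hy⟩ := (smul_simple_ne_zero_iff (𝒪 := 𝒪) S i hidem).1
    ⟨x, by rwa [algMap_single, map_one]⟩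
  rw [algMap_single, map_one] at hy
  obtain ⟨v, hv, y', hy'⟩ := exists_isPrimitiveLift_smul_ne_zero (𝒪 := 𝒪)
    (V := ExtendScalars 𝒪 𝕜 M (simpleForm 𝒪 S i)) hk hy
  obtain ⟨z, hz⟩ := (smul_simple_ne_zero_iff (𝒪 := 𝒪) S i
    (isIdempotentElem_toAlg hv.idem)).2 ⟨y', by rwa [algMap_toAlg]⟩
  exact ⟨⟨e, he, v, hv⟩, hkill, z, by rwa [algMap_toAlg] at hz⟩

/-- A bijection between the simple modules over `k[M]` and `F[M]` that preserves labels. -/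
theorem exists_equiv_label (T : SimpleSystem 𝕜[M] κ) (hk : IsSplittingField 𝕜 M)
    (hss : ∀ e : Idem M, IsSemisimpleRing 𝕜[MaxSubgroup e])
    (hss' : ∀ e : Idem M, IsSemisimpleRing F[MaxSubgroup e]) :
    ∃ (σ : κ ≃ ι) (x : κ → Label 𝒪 M), ∀ j, (x j).Of 𝕜 (T.mod j) ∧ (x j).Of F (S.mod (σ j)) := by
  have hT := T.simple
  have hS := S.simple
  choose x hx using fun j => exists_label_residue (𝒪 := 𝒪) hk hss (T.mod j)
  choose σ hσ using fun j => S.exists_hasLabel ((x j).isPrimitiveLift.fraction F)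
  -- Labels determine simple modules on both sides, and transferring labels from `F` to `k` and from
  -- `k` to `F` gives injectivity and surjectivity, respectively.
  have hbij : Function.Bijective σ := by
    constructor
    · intro j j' hjj'
      have h1 := hσ j
      have h2 := hσ j'
      rw [← hjj'] at h2
      obtain ⟨b, hb⟩ := h2.ne
      have h3 := Label.of_fraction (Label.e_eq_of h1 h2) h1 hb (hx j)
      exact T.irredundant j j' (h3.nonempty_equiv (hx j') (x j').isPrimitiveLift.residue)
    · intro i
      obtain ⟨y, hy⟩ := exists_label_fraction (𝒪 := 𝒪) S hk hss i
      obtain ⟨j, hj⟩ := T.exists_hasLabel y.isPrimitiveLift.residue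
      have h3 := Label.of_residue (hx j) hj (hσ j)
      exact ⟨j, S.irredundant _ _ (h3.nonempty_equiv hy (y.isPrimitiveLift.fraction F))⟩
  exact ⟨Equiv.ofBijective σ hbij, x, fun j => ⟨hx j, hσ j⟩⟩

end Correspondence

/-! ### The decomposition matrix in terms of labels -/

section Triangular

variable {𝒪 F M : Type u} [CommRing 𝒪] [IsDomain 𝒪] [IsDiscreteValuationRing 𝒪] [Field F]
  [Algebra 𝒪 F] [IsFractionRing 𝒪 F] [Monoid M] [Finite M] {ι : Type v} {κ : Type w}
  {S : SimpleSystem F[M] ι} {T : SimpleSystem (IsLocalRing.ResidueField 𝒪)[M] κ}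

local notation "𝕜" => IsLocalRing.ResidueField 𝒪

theorem dim_le_of_decompositionMatrix_ne_zero {i : ι} {j : κ}
    (h : decompositionMatrix 𝒪 F M S T i j ≠ 0) : dim 𝕜 M (T.mod j) ≤ dim F M (S.mod i) := by
  have := SimpleSystem.finite_index 𝕜 T
  have := Fintype.ofFinite κ
  rw [dim_simple_eq_sum (𝒪 := 𝒪) S T]
  calc dim 𝕜 M (T.mod j) ≤ decompositionMatrix 𝒪 F M S T i j * dim 𝕜 M (T.mod j) :=
        Nat.le_mul_of_pos_left _ (Nat.pos_of_ne_zero h)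
    _ ≤ _ := Finset.single_le_sum (f := fun j => decompositionMatrix 𝒪 F M S T i j *
        dim 𝕜 M (T.mod j)) (fun _ _ => Nat.zero_le _) (Finset.mem_univ j)

theorem dim_residue_pos (T : SimpleSystem 𝕜[M] κ) (j : κ) : 0 < dim 𝕜 M (T.mod j) := by
  have := T.finite j
  have := T.simple j
  have := IsSimpleModule.nontrivial 𝕜[M] (T.mod j)
  obtain ⟨x, hx⟩ := exists_ne (0 : T.mod j)
  rw [← imageDim_one, imageDim_pos_iff]
  exact ⟨x, by rwa [one_smul]⟩

/-- The diagonal term already exhausts `dim S (σ j) = ∑ d dim T`, and the dimensions of the other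
simple modules are positive. -/
theorem eq_permutationMatrix_of_dim_eq {σ : κ ≃ ι}
    (h1 : ∀ j, decompositionMatrix 𝒪 F M S T (σ j) j = 1)
    (h2 : ∀ j, dim F M (S.mod (σ j)) = dim 𝕜 M (T.mod j)) :
    decompositionMatrix 𝒪 F M S T = permutationMatrix σ := by
  classical
  have := SimpleSystem.finite_index 𝕜 T
  have := Fintype.ofFinite κ
  ext i j'
  obtain ⟨j, rfl⟩ := σ.surjective i
  by_cases hj : j' = j
  · subst hj
    rw [h1]
    simp [permutationMatrix]
  · have h3 := dim_simple_eq_sum (𝒪 := 𝒪) S T (σ j)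
    rw [← Finset.add_sum_erase _ _ (Finset.mem_univ j), h1, one_mul, h2] at h3
    have h4 : ∑ x ∈ Finset.univ.erase j, decompositionMatrix 𝒪 F M S T (σ j) x *
        dim 𝕜 M (T.mod x) = 0 := by omega
    have h5 := Finset.sum_eq_zero_iff.1 h4 j' (by simp [hj])
    rw [(mul_eq_zero.1 h5).resolve_right (dim_residue_pos T j').ne']
    simp [permutationMatrix, hj]

/-- A nonzero entry makes the idempotent of `j'` act as nonzero on `S (σ j)`, whose apex therefore
lies below that of `j'`. If the apexes agreed, `T j` and `T j'` would share a label. -/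
theorem jCard_lt_of_decompositionMatrix_ne_zero {σ : κ ≃ ι} {x : κ → Label 𝒪 M}
    (hx : ∀ j, (x j).Of 𝕜 (T.mod j) ∧ (x j).Of F (S.mod (σ j)))
    (hss : ∀ e : Idem M, IsSemisimpleRing 𝕜[MaxSubgroup e]) {j j' : κ} (hj : j ≠ j')
    (hD : decompositionMatrix 𝒪 F M S T (σ j) j' ≠ 0) :
    jCard ((x j).e : M) < jCard ((x j').e : M) := by
  have hT := T.simple
  have hS := S.simple
  have := SimpleSystem.finite_index 𝕜 T
  have := Fintype.ofFinite κ
  have := S.finite (σ j)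
  have hpos : 0 < imageDim F (algMap 𝒪 F M (toAlg 𝒪 _ (x j').v)) (S.mod (σ j)) := by
    rw [imageDim_simple_eq_sum S T _ (isIdempotentElem_toAlg (x j').isPrimitiveLift.idem)]
    refine Finset.sum_pos' (fun _ _ => Nat.zero_le _) ⟨j', Finset.mem_univ _, ?_⟩
    rw [algMap_toAlg, (hx j').1.imageDim_eq_one (x j').isPrimitiveLift.residue, mul_one]
    exact Nat.pos_of_ne_zero hD
  obtain ⟨b, hb⟩ := (imageDim_pos_iff F).1 hpos
  rw [algMap_toAlg] at hb
  have h1 : JLe ((x j).e : M) (x j').e := jLe_of_smul_ne_zero (hx j).2.kill hb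
  refine lt_of_le_of_ne (jCard_le h1) fun h2 => hj ?_
  have h3 := Label.e_eq h1 (jLe_of_jCard_le h1 h2.ge)
  have h4 := Label.of_fraction h3 (hx j).2 hb (hx j).1
  exact T.irredundant j j' (h4.nonempty_equiv (hx j').1 (x j').isPrimitiveLift.residue)

/-- Measured by the idempotent of label `j`, both `S (σ j)` and `T j` have dimension one. Another
factor seen by this idempotent would have its apex both below that of `j` and, by the previous
result, strictly larger. -/
theorem decompositionMatrix_diagonal {σ : κ ≃ ι} {x : κ → Label 𝒪 M}
    (hx : ∀ j, (x j).Of 𝕜 (T.mod j) ∧ (x j).Of F (S.mod (σ j)))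
    (hss : ∀ e : Idem M, IsSemisimpleRing 𝕜[MaxSubgroup e])
    (j : κ) : decompositionMatrix 𝒪 F M S T (σ j) j = 1 := by
  have hT := T.simple
  have hS := S.simple
  have := SimpleSystem.finite_index 𝕜 T
  have := Fintype.ofFinite κ
  have h := imageDim_simple_eq_sum S T (σ j)
    (isIdempotentElem_toAlg (x j).isPrimitiveLift.idem)
  rw [Finset.sum_eq_single j, algMap_toAlg, algMap_toAlg,
    (hx j).2.imageDim_eq_one ((x j).isPrimitiveLift.fraction F),
    (hx j).1.imageDim_eq_one (x j).isPrimitiveLift.residue, mul_one] at h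
  · exact h.symm
  · intro j' _ hj'
    by_contra hne
    have := T.finite j'
    obtain ⟨hD, hne'⟩ := mul_ne_zero_iff.1 hne
    obtain ⟨b, hb⟩ := (imageDim_pos_iff 𝕜).1 (Nat.pos_of_ne_zero hne')
    rw [algMap_toAlg] at hb
    have h1 := jCard_le (jLe_of_smul_ne_zero (hx j').1.kill hb)
    have h2 := jCard_lt_of_decompositionMatrix_ne_zero hx hss hj'.symm hD
    omega
  · simp

theorem isUpperUnitriangular_of_label {σ : κ ≃ ι} {x : κ → Label 𝒪 M}
    (hx : ∀ j, (x j).Of 𝕜 (T.mod j) ∧ (x j).Of F (S.mod (σ j)))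
    (hss : ∀ e : Idem M, IsSemisimpleRing 𝕜[MaxSubgroup e]) :
    IsUpperUnitriangular (decompositionMatrix 𝒪 F M S T) σ := by
  have := SimpleSystem.finite_index 𝕜 T
  obtain ⟨n, ⟨g⟩⟩ := Finite.exists_equiv_fin κ
  -- Sorting by the size of the apex ideal gives the triangular order; ties are harmless because
  -- off-diagonal entries require a strict increase.
  let c : Fin n → ℕ := fun a => jCard ((x (g.symm a)).e : M)
  refine ⟨n, (Tuple.sort c).trans g.symm, fun a => decompositionMatrix_diagonal hx hss _,
    fun a b hab => ?_⟩
  by_contra hne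
  have h1 := jCard_lt_of_decompositionMatrix_ne_zero hx hss (fun h => hab.ne
    (((Tuple.sort c).trans g.symm).injective h).symm) hne
  exact absurd (Tuple.monotone_sort c hab.le) (not_le.2 h1)

end Triangular

/-! ### Reduction of annihilators, and dimensions -/

section Reduction

theorem extTmul_one_injective {A : Type*} [CommRing A] (B : Type*) [CommRing B] [Algebra A B]
    [FaithfulSMul A B] {M : Type*} [Monoid M] {L : Type*} [AddCommGroup L] [Module A[M] L]
    (hL : IsLattice A M L) : Function.Injective (extTmul A B M (1 : B) : L → _) := by
  intro l l' h
  have := hL.free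
  exact Module.Flat.tensorProduct_mk_injective A (RestrictScalars A A[M] L) B h

variable {𝒪 F M : Type u} [CommRing 𝒪] [IsDomain 𝒪] [IsDiscreteValuationRing 𝒪] [Field F]
  [Algebra 𝒪 F] [IsFractionRing 𝒪 F] [Monoid M] [Finite M] {ι : Type v} {κ : Type w}
  {S : SimpleSystem F[M] ι} {T : SimpleSystem (IsLocalRing.ResidueField 𝒪)[M] κ}

local notation "𝕜" => IsLocalRing.ResidueField 𝒪

/-- The form embeds in `F ⊗ L`, so an element of `𝒪[M]` killing the latter kills the form and hence
its reduction. -/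
theorem smul_reduction_eq_zero {i : ι} {a : 𝒪[M]}
    (h : ∀ y : S.mod i, algMap 𝒪 F M a • y = 0)
    (y : ExtendScalars 𝒪 𝕜 M (simpleForm 𝒪 S i)) : algMap 𝒪 𝕜 M a • y = 0 := by
  obtain ⟨φ⟩ := (simpleForm_isForm 𝒪 S i).equiv
  have hL : ∀ l : simpleForm 𝒪 S i, a • l = 0 := by
    intro l
    apply extTmul_one_injective F (simpleForm_isForm 𝒪 S i).lattice
    rw [extTmul_zero, ← algMap_smul_extTmul]
    apply φ.injective
    rw [map_smul, h, map_zero]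
  induction y using extendScalars_induction with
  | h0 => exact smul_zero _
  | hadd x y hx hy => rw [smul_add, hx, hy, add_zero]
  | h b l => rw [algMap_smul_extTmul, hL, extTmul_zero]

theorem belowIdeal_smul_of_permutationMatrix {σ : κ ≃ ι}
    (hD : decompositionMatrix 𝒪 F M S T = permutationMatrix σ) {e : Idem M} {j : κ}
    (h : ∀ a ∈ belowIdeal F e, ∀ y : S.mod (σ j), a • y = 0) (a : 𝕜[M]) (ha : a ∈ belowIdeal 𝕜 e)
    (y : T.mod j) : a • y = 0 := by
  refine belowIdeal_smul_eq_zero (fun m hm y => ?_) a ha y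
  obtain ⟨φ⟩ := reduction_equiv_of_permutationMatrix hD j
  obtain ⟨y, rfl⟩ := φ.surjective y
  have h1 := smul_reduction_eq_zero (𝒪 := 𝒪) (S := S) (i := σ j)
    (a := MonoidAlgebra.single m 1) (fun z => by
      rw [algMap_single, map_one]
      exact h _ (single_mem_belowIdeal hm 1) z) y
  rw [algMap_single, map_one] at h1
  rw [← map_smul, h1, map_zero]

/-- The two dimensions are the ranks of one matrix over `𝒪`, taken over `F` and over `k`. -/
theorem dim_eq_dim_iff_isPure {e : Idem M} {v : 𝒪[MaxSubgroup e]} (hv : IsPrimitiveLift v)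
    [IsSemisimpleRing 𝕜[MaxSubgroup e]] [IsSemisimpleRing F[MaxSubgroup e]] {π : 𝒪}
    (hπ : Irreducible π) {V W : Type*} [AddCommGroup V] [Module F[M] V] [IsSimpleModule F[M] V]
    [AddCommGroup W] [Module 𝕜[M] W] [IsSimpleModule 𝕜[M] W]
    (hV : HasLabel V e (algMap 𝒪 F _ v)) (hW : HasLabel W e (algMap 𝒪 𝕜 _ v)) :
    dim F M V = dim 𝕜 M W ↔ IsPure π (LinearMap.range (rAct 𝒪 e v ∘ₗ sandwichLin 𝒪 e)) := by
  obtain ⟨x, hx, hvx⟩ := hV.exists_eq (hv.fraction F).idem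
  obtain ⟨y, hy, hvy⟩ := hW.exists_eq hv.residue.idem
  rw [dim_eq_finrank_range hV.kill (hv.fraction F) hx hvx,
    dim_eq_finrank_range hW.kill hv.residue hy hvy, finrank_range_eq_iff_isPure hπ]

/-- The simple `F[M]`-module with label `v` reduces to a simple module with the same label and the
same dimension, so each `v`-part is pure. -/
theorem isPure_of_permutationMatrix [IsAdicComplete (IsLocalRing.maximalIdeal 𝒪) 𝒪]
    (hk : IsSplittingField 𝕜 M) {σ : κ ≃ ι}
    (hD : decompositionMatrix 𝒪 F M S T = permutationMatrix σ) {e : Idem M}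
    [IsSemisimpleRing 𝕜[MaxSubgroup e]] [IsSemisimpleRing F[MaxSubgroup e]] {π : 𝒪}
    (hπ : Irreducible π) : IsPure π (LinearMap.range (sandwichLin 𝒪 e)) := by
  refine isPure_of_forall_isPrimitiveLift hk hπ fun v hv => ?_
  obtain ⟨i, hi⟩ := S.exists_hasLabel (hv.fraction F)
  obtain ⟨j, rfl⟩ := σ.surjective i
  have := S.simple (σ j)
  have := T.simple j
  have hj : HasLabel (T.mod j) e (algMap 𝒪 𝕜 _ v) := by
    refine ⟨belowIdeal_smul_of_permutationMatrix hD hi.kill, ?_⟩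
    obtain ⟨φ⟩ := reduction_equiv_of_permutationMatrix hD j
    obtain ⟨y, hy⟩ := (smul_simple_ne_zero_iff (𝒪 := 𝒪) S (σ j)
      (isIdempotentElem_toAlg hv.idem)).1 (by rw [algMap_toAlg]; exact hi.ne)
    refine ⟨φ y, ?_⟩
    rw [algMap_toAlg] at hy
    rwa [← map_smul, ne_eq, LinearEquiv.map_eq_zero_iff]
  exact (dim_eq_dim_iff_isPure hv hπ hi hj).1 (dim_eq_of_permutationMatrix hD j)

end Reduction

/-! ### The trivial representations of the maximal subgroups -/

section Trivial

/-- The sum of all elements of `G`. -/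
def groupSum (K G : Type*) [CommRing K] [Fintype G] : K[G] := ∑ g : G, MonoidAlgebra.single g 1

theorem coeff_groupSum {K G : Type*} [CommRing K] [Fintype G] (h : G) : (groupSum K G).coeff h = 1 := by
  classical
  simp [groupSum, MonoidAlgebra.coeff_sum, Finsupp.single_apply]

variable {K G : Type*} [CommRing K] [Group G] [Fintype G]

theorem eq_smul_groupSum {a : K[G]} (h : ∀ g, MonoidAlgebra.single g 1 * a = a) :
    a = a.coeff 1 • groupSum K G := by
  ext g
  rw [MonoidAlgebra.coeff_smul_apply, coeff_groupSum, smul_eq_mul, mul_one]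
  nth_rw 1 [← h g]
  simp

theorem single_mul_groupSum (g : G) :
    MonoidAlgebra.single g 1 * groupSum K G = groupSum K G := by
  rw [groupSum, Finset.mul_sum, ← Equiv.sum_comp (Equiv.mulLeft g)
    (fun h => MonoidAlgebra.single h (1 : K))]
  refine Finset.sum_congr rfl fun h _ => ?_
  rw [MonoidAlgebra.single_mul_single, one_mul, Equiv.coe_mulLeft]

theorem exists_mul_groupSum (z : K[G]) : ∃ c : K, z * groupSum K G = c • groupSum K G := by
  induction z using MonoidAlgebra.induction_linear with
  | zero => exact ⟨0, by simp⟩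
  | add x y hx hy =>
    obtain ⟨c, hc⟩ := hx
    obtain ⟨d, hd⟩ := hy
    exact ⟨c + d, by rw [add_mul, hc, hd, add_smul]⟩
  | single g c =>
    refine ⟨c, ?_⟩
    rw [← mul_one c, ← smul_eq_mul c, ← MonoidAlgebra.smul_single, smul_mul_assoc,
      single_mul_groupSum, smul_eq_mul, mul_one]

theorem groupSum_mul_groupSum :
    groupSum K G * groupSum K G = (Nat.card G : K) • groupSum K G := by
  nth_rw 1 [groupSum]
  rw [Finset.sum_mul, Finset.sum_congr rfl (fun g _ => single_mul_groupSum g), Finset.sum_const,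
    Finset.card_univ, Nat.card_eq_fintype_card, Nat.cast_smul_eq_nsmul]

theorem isScalarIdempotent_groupSum {K : Type*} [Field K] (h : (Nat.card G : K) ≠ 0) :
    IsScalarIdempotent ((Nat.card G : K)⁻¹ • groupSum K G) where
  idem := by
    rw [IsIdempotentElem, smul_mul_assoc, mul_smul_comm, groupSum_mul_groupSum, inv_smul_smul₀ h]
  ne_zero h0 := by
    have := congrArg (fun z : K[G] => z.coeff 1) h0
    simp only [MonoidAlgebra.coeff_smul_apply, coeff_groupSum, smul_eq_mul, mul_one] at this
    exact inv_ne_zero h this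
  scalar z := by
    obtain ⟨c, hc⟩ := exists_mul_groupSum
      (((Nat.card G : K)⁻¹ • groupSum K G) * z)
    exact ⟨c, by rw [mul_smul_comm, hc, smul_comm]⟩

end Trivial

/-! ### A permutation matrix forces `p` to be prime to the maximal subgroups -/

section NotDvd

/-- An element of the algebra of a maximal subgroup is zero if it annihilates all simple modules
that are annihilated by the elements of `M` not above `e`. -/
theorem eq_zero_of_forall_smul_eq_zero {M K : Type u} [Monoid M] [Field K] {e : Idem M}
    [IsSemisimpleRing K[MaxSubgroup e]] {ι : Type v} (S : SimpleSystem K[M] ι)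
    {y : K[MaxSubgroup e]}
    (h : ∀ i, (∀ a ∈ belowIdeal K e, ∀ x : S.mod i, a • x = 0) →
      ∀ x : S.mod i, toAlg K e y • x = 0) : y = 0 := by
  obtain ⟨d, hd⟩ := exists_mul_mul_eq_self y
  by_contra hy
  have hidem : IsIdempotentElem (y * d) := by
    rw [IsIdempotentElem, ← mul_assoc, hd]
  have hne : y * d ≠ 0 := fun h0 => hy (by rw [← hd, h0, zero_mul])
  obtain ⟨V, hV, hkill, x, hx, hvx⟩ := exists_simple_of_idempotent (belowIdeal K e)
    (isIdempotentElem_toAlg hidem) (toAlg_notMem_belowIdeal hne)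
  obtain ⟨i, ⟨φ⟩⟩ := S.complete V hV
  apply hx
  apply φ.injective
  rw [map_zero, ← hvx, map_mul, mul_smul, map_smul]
  refine h i (fun a ha z => ?_) _
  rw [← φ.apply_symm_apply z, ← map_smul, hkill a ha, map_zero]

variable {𝒪 F M : Type u} [CommRing 𝒪] [IsDomain 𝒪] [IsDiscreteValuationRing 𝒪]
  [IsAdicComplete (IsLocalRing.maximalIdeal 𝒪) 𝒪] [Field F]
  [Algebra 𝒪 F] [IsFractionRing 𝒪 F] [Monoid M] [Finite M] {ι : Type v} {κ : Type w}
  {S : SimpleSystem F[M] ι} {T : SimpleSystem (IsLocalRing.ResidueField 𝒪)[M] κ}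

local notation "𝕜" => IsLocalRing.ResidueField 𝒪

theorem not_dvd_card_of_permutationMatrix [CharZero F] {p : ℕ} [CharP 𝕜 p]
    (hk : IsSplittingField 𝕜 M) {σ : κ ≃ ι}
    (hD : decompositionMatrix 𝒪 F M S T = permutationMatrix σ) (e : Idem M) :
    ¬ p ∣ Nat.card (MaxSubgroup e) := by
  have := Fintype.ofFinite (MaxSubgroup e)
  have : IsSemisimpleRing F[MaxSubgroup e] := isSemisimpleRing_of_charZero
  have hcard : (Nat.card (MaxSubgroup e) : F) ≠ 0 := Nat.cast_ne_zero.2 Nat.card_pos.ne'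
  have hε := isScalarIdempotent_groupSum (G := MaxSubgroup e) hcard
  obtain ⟨i, hi⟩ := S.exists_hasLabel hε
  obtain ⟨j, rfl⟩ := σ.surjective i
  have hSj := S.simple (σ j)
  have hTj := T.simple j
  have hTfin := T.finite j
  have hkill := belowIdeal_smul_of_permutationMatrix hD hi.kill
  -- the group acts trivially on `e S`
  have htriv : ∀ (g : MaxSubgroup e) (y : S.mod (σ j)),
      toAlg F e (MonoidAlgebra.single g 1 - 1) • y = 0 := by
    intro g y
    obtain ⟨x, hx, hvx⟩ := hi.exists_eq hε.idem
    obtain ⟨a, ha⟩ := exists_smul_eq_of_isSimpleModule (A := F[M]) hx y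
    have h1 := toAlg_smul_smul_eq hi.kill (MonoidAlgebra.single g 1 - 1)
      ((Nat.card (MaxSubgroup e) : F)⁻¹ • groupSum F (MaxSubgroup e)) a x
    rw [hvx, ha] at h1
    obtain ⟨c, hc⟩ := exists_mul_groupSum (cornerProj F e a)
    rw [h1, mul_assoc, mul_smul_comm, hc, mul_smul_comm, mul_smul_comm, sub_mul,
      single_mul_groupSum, one_mul, sub_self, smul_zero, smul_zero, map_zero, zero_smul]
  -- an element `x` of `e T`
  have hidem : IsIdempotentElem (MonoidAlgebra.single (e : M) (1 : 𝒪)) := by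
    rw [IsIdempotentElem, MonoidAlgebra.single_mul_single, e.2.eq, one_mul]
  obtain ⟨x, hx0, hx⟩ : ∃ x : T.mod j, x ≠ 0 ∧ MonoidAlgebra.single (e : M) (1 : 𝕜) • x = x := by
    obtain ⟨z, hz⟩ := hi.ne
    obtain ⟨φ⟩ := reduction_equiv_of_permutationMatrix hD j
    obtain ⟨y, hy⟩ := (smul_simple_ne_zero_iff (𝒪 := 𝒪) S (σ j) hidem).1
      ⟨_, by rwa [algMap_single, map_one, smul_smul, idem_mul_toAlg]⟩
    rw [algMap_single, map_one] at hy
    refine ⟨MonoidAlgebra.single (e : M) (1 : 𝕜) • φ y, ?_, ?_⟩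
    · rwa [← map_smul, ne_eq, LinearEquiv.map_eq_zero_iff]
    · rw [smul_smul, MonoidAlgebra.single_mul_single, e.2.eq, one_mul]
  -- an element `a` of `𝒪[M]` that acts as zero on the other simple modules and fixes `x`
  obtain ⟨f, hf, h1, h0⟩ := exists_separating_idempotent_lift hk T j
  have hF := (imageDim_simple_of_permutationMatrix hD hf h1 h0).2
  obtain ⟨z, hz⟩ := (imageDim_pos_iff 𝕜).1 (h1 ▸ Nat.one_pos)
  obtain ⟨b, hb⟩ := exists_smul_eq_of_isSimpleModule (A := 𝕜[M]) hx0 z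
  obtain ⟨c, hc⟩ := exists_smul_eq_of_isSimpleModule (A := 𝕜[M]) hz x
  obtain ⟨b, rfl⟩ := algMap_residue_surjective 𝒪 M b
  obtain ⟨c, rfl⟩ := algMap_residue_surjective 𝒪 M c
  -- `b` carries `x` to `z` and `c` carries `f z` back to `x`, while the factor `f` kills every `S
  -- i` with `i ≠ σ j`.
  obtain ⟨a', ha'⟩ : ∃ a', a' = cornerProj 𝒪 e (c * f * b) := ⟨_, rfl⟩
  have hact : toAlg 𝕜 e (algMap 𝒪 𝕜 _ a') • x = x := by
    rw [ha', algMap_cornerProj, ← corner_smul_eq hkill, mul_smul, mul_smul, hx, map_mul, map_mul,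
      mul_smul, mul_smul, hb, hc, hx]
  have hfix : ∀ g : MaxSubgroup e, MonoidAlgebra.single g 1 * a' = a' := by
    intro g
    apply algMap_injective _ (IsFractionRing.injective 𝒪 F)
    rw [map_mul, algMap_single, map_one]
    rw [← sub_eq_zero]
    -- The difference `g a' - a'` kills `S (σ j)` because the group acts trivially there, and the
    -- other simple modules because of `f`; semisimplicity of `F[G_e]` makes it zero.
    refine eq_zero_of_forall_smul_eq_zero S fun i hi' y => ?_
    have h2 : MonoidAlgebra.single g 1 * algMap 𝒪 F (MaxSubgroup e) a' -
        algMap 𝒪 F (MaxSubgroup e) a' =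
        (MonoidAlgebra.single g 1 - 1) * algMap 𝒪 F (MaxSubgroup e) a' := by
      rw [sub_mul, one_mul]
    rw [h2, map_mul, mul_smul]
    by_cases hij : i = σ j
    · subst hij
      exact htriv g _
    · have := S.finite i
      have h3 : ∀ w : S.mod i, algMap 𝒪 F M f • w = 0 := by
        intro w
        by_contra hne
        exact ((imageDim_pos_iff F).2 ⟨w, hne⟩).ne' (hF i hij)
      rw [ha', algMap_cornerProj, ← corner_smul_eq hi', map_mul, map_mul]
      simp only [mul_smul, h3, smul_zero]
  have hx' : ∀ g : MaxSubgroup e, MonoidAlgebra.single g.toM (1 : 𝕜) • x = x := by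
    intro g
    rw [← toAlg_single]
    nth_rw 1 [← hact]
    rw [smul_smul, ← map_mul]
    have h2 := congrArg (algMap 𝒪 𝕜 (MaxSubgroup e)) (hfix g)
    rw [map_mul, algMap_single, map_one] at h2
    rw [h2, hact]
  intro hdvd
  apply hx0
  have hzero : (Nat.card (MaxSubgroup e) : 𝕜) = 0 := (CharP.cast_eq_zero_iff 𝕜 p _).2 hdvd
  -- Being invariant, `a'` is a multiple of the sum of the group, so `x = a' x` is a multiple of
  -- `|G_e| x = 0`.
  rw [eq_smul_groupSum hfix, algMap_smul, toAlg_smul, groupSum, map_sum, map_sum] at hact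
  rw [← hact, Algebra.smul_def, mul_smul, Finset.sum_smul]
  have h4 : ∀ g : MaxSubgroup e, toAlg 𝕜 e (algMap 𝒪 𝕜 _ (MonoidAlgebra.single g 1)) • x = x := by
    intro g
    rw [algMap_single, map_one, toAlg_single, hx' g]
  rw [Finset.sum_congr rfl (fun g _ => h4 g), Finset.sum_const, Finset.card_univ,
    ← Nat.card_eq_fintype_card, ← Nat.cast_smul_eq_nsmul 𝕜[M], ← map_natCast (algebraMap 𝕜 𝕜[M]),
    hzero, map_zero, zero_smul, smul_zero]

end NotDvd

end

end MonoidRep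

/-! ### The main theorem -/

theorem theoremt (p : ℕ) (hp : p.Prime)
    -- a finite monoid
    (M : Type u) [Monoid M] [Finite M]
    -- a `p`-modular system `(F, 𝒪, k)`, where `k` is the residue field of `𝒪`
    (𝒪 : Type u) [CommRing 𝒪] [IsDomain 𝒪] [IsDiscreteValuationRing 𝒪]
    [IsAdicComplete (IsLocalRing.maximalIdeal 𝒪) 𝒪] [CharZero 𝒪]
    [CharP (IsLocalRing.ResidueField 𝒪) p]
    (F : Type u) [Field F] [Algebra 𝒪 F] [IsFractionRing 𝒪 F]
    -- that is splitting for `M`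
    (hF : IsSplittingField F M) (hk : IsSplittingField (IsLocalRing.ResidueField 𝒪) M)
    -- representatives of the isomorphism classes of simple modules over `F[M]` and `k[M]`
    {ι : Type v} {κ : Type w} (S : SimpleSystem F[M] ι)
    (T : SimpleSystem (IsLocalRing.ResidueField 𝒪)[M] κ) :
    ((∀ e : Idem M, ¬ p ∣ Nat.card (MaxSubgroup e)) →
      ∃ σ : κ ≃ ι,
        (∀ j, dim (IsLocalRing.ResidueField 𝒪) M (T.mod j) ≤ dim F M (S.mod (σ j))) ∧
        IsUpperUnitriangular (decompositionMatrix 𝒪 F M S T) σ) ∧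
    (¬ IsStronglyModular M p →
      ∃ σ : κ ≃ ι,
        (∀ j, dim (IsLocalRing.ResidueField 𝒪) M (T.mod j) ≤ dim F M (S.mod (σ j))) ∧
        IsUpperUnitriangular (decompositionMatrix 𝒪 F M S T) σ ∧
        (∀ j, ∃ L : ModuleCat.{u} 𝒪[M], IsLattice 𝒪 M L ∧
          Nonempty (ExtendScalars 𝒪 (IsLocalRing.ResidueField 𝒪) M L
            ≃ₗ[(IsLocalRing.ResidueField 𝒪)[M]] T.mod j) ∧
          IsSimpleModule F[M] (ExtendScalars 𝒪 F M L) ∧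
          Nonempty (ExtendScalars 𝒪 F M L ≃ₗ[F[M]] S.mod (σ j)) ∧
          ∀ P : ModuleCat.{u} 𝒪[M], IsProjectiveIndecomposable 𝒪[M] P →
            Nonempty (ModuleTop 𝒪[M] P ≃ₗ[𝒪[M]] inflate 𝒪 M (T.mod j)) →
            IsProjectiveIndecomposable F[M] (ExtendScalars 𝒪 F M P) ∧
            Nonempty (ModuleTop F[M] (ExtendScalars 𝒪 F M P) ≃ₗ[F[M]] ExtendScalars 𝒪 F M L)) ∧
        decompositionMatrix 𝒪 F M S T = permutationMatrix σ ∧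
        -- conjugating by the permutation matrix of `σ` is reindexing rows and columns along `σ`
        ∀ (P : ProjectiveSystem S) (Q : ProjectiveSystem T),
          cartanMatrix T Q = (cartanMatrix S P).submatrix σ σ) ∧
    (IsStronglyModular M p → ¬ IsPermutationMatrix (decompositionMatrix 𝒪 F M S T)) := by
  have : CharZero F := charZero_of_injective_algebraMap (IsFractionRing.injective 𝒪 F)
  have hssF : ∀ e : Idem M, IsSemisimpleRing F[MaxSubgroup e] :=
    fun e => isSemisimpleRing_of_charZero
  have hssk : (∀ e : Idem M, ¬ p ∣ Nat.card (MaxSubgroup e)) →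
      ∀ e : Idem M, IsSemisimpleRing (IsLocalRing.ResidueField 𝒪)[MaxSubgroup e] :=
    fun h e => isSemisimpleRing_of_not_dvd (p := p) (h e)
  obtain ⟨π, hπ⟩ := IsDiscreteValuationRing.exists_irreducible 𝒪
  refine ⟨fun h => ?_, fun h => ?_, ?_⟩
  · obtain ⟨σ, x, hx⟩ := exists_equiv_label S T hk (hssk h) hssF
    exact ⟨σ, fun j => dim_le_of_decompositionMatrix_ne_zero
      (by rw [decompositionMatrix_diagonal hx (hssk h)]; exact one_ne_zero),
      isUpperUnitriangular_of_label hx (hssk h)⟩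
  · have hG : ∀ e : Idem M, ¬ p ∣ Nat.card (MaxSubgroup e) := fun e he => h ⟨e, Or.inl he⟩
    have hss := hssk hG
    obtain ⟨σ, x, hx⟩ := exists_equiv_label S T hk hss hssF
    have hdim : ∀ j, dim F M (S.mod (σ j)) =
        dim (IsLocalRing.ResidueField 𝒪) M (T.mod j) := by
      intro j
      have := S.simple (σ j)
      have := T.simple j
      refine (dim_eq_dim_iff_isPure (x j).isPrimitiveLift hπ (hx j).2 (hx j).1).2 ?_
      refine isPure_rAct (fun a b hab => mul_left_cancel₀ hπ.ne_zero hab) ?_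
        (x j).isPrimitiveLift.idem
      rw [← isPure_int_iff hπ hp F]
      by_contra hne
      exact h ⟨_, Or.inr ((dvd_card_torsion_iff hp).2 hne)⟩
    -- Once this holds, any bijection giving ones on the diagonal of the decomposition matrix
    -- coincides with `σ`.
    have hD := eq_permutationMatrix_of_dim_eq
      (fun j => decompositionMatrix_diagonal hx hss j) hdim
    refine ⟨σ, fun j => (hdim j).ge, isUpperUnitriangular_of_label hx hss, fun j => ?_, hD,
      cartanMatrix_eq_of_permutationMatrix hk hD⟩
    obtain ⟨φ⟩ := (simpleForm_isForm 𝒪 S (σ j)).equiv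
    have := S.simple (σ j)
    refine ⟨simpleForm 𝒪 S (σ j), (simpleForm_isForm 𝒪 S (σ j)).lattice,
      reduction_equiv_of_permutationMatrix hD j, IsSimpleModule.congr φ, ⟨φ⟩, fun P hP htop => ?_⟩
    obtain ⟨h1, ⟨ψ⟩⟩ := extendScalars_projectiveIndecomposable_of_permutationMatrix hk hD hP htop
    exact ⟨h1, ⟨ψ.trans φ.symm⟩⟩
  · rintro ⟨e, he⟩ ⟨σ, hD⟩
    have hG := not_dvd_card_of_permutationMatrix (p := p) hk hD
    have := hssk hG e
    -- The group orders are excluded first: purity of the sandwich matrix relies on the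
    -- semisimplicity of `k[G_e]`.
    refine he.elim (hG e) fun h => (dvd_card_torsion_iff hp).1 h ?_
    exact (isPure_int_iff hπ hp F).2 (isPure_of_permutationMatrix hk hD hπ)
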